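/- Let $\nu\ge 0$, $\ell_0>0$, and let $\ell\colon[0,+\infty)\to[\ell_0,+\infty)$ be Lipschitz with $\ell(0)=\ell_0$ and $0\le\dot\ell(t)\le1$ for a.e. $t\ge0$. Put $\Omega=\{(t,x)\mid t>0,\ 0<x<\ell(t)\}$, $\Omega_T=\{(t,x)\in\Omega\mid t<T\}$, and let $\widetilde H^1(\Omega)$ be the space of all $v\in H^1_{\mathrm{loc}}(\Omega)$ with $v\in H^1(\Omega_T)$ for every $T>0$. Let $z\in H^1(0,b)$ for every $b>0$, $v_0\in H^1(0,\ell_0)$, $v_1\in L^2(0,\ell_0)$, where $z$ and $v_0$ are identified with their continuous representatives on $[0,+\infty)$ and $[0,\ell_0]$, and assume the compatibility conditions $v_0(0)=z(0)$, $v_0(\ell_0)=0$. Then there is a unique (up to equality a.e. in $\Omega$) solution $v\in\widetilde H^1(\Omega)$ of $$\begin{cases} v_{tt}-v_{xx}-\frac{\nu^2}{4}v=0, & t>0,\ 0<x<\ell(t),\\ v(t,0)=z(t), & t>0,\\ v(t,\ell(t))=0, & t>0,\\ v(0,x)=v_0(x), & 0<x<\ell_0,\\ v_t(0,x)=v_1(x),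 & 0<x<\ell_0,\end{cases}$$ where the equation holds in the sense of distributions in $\Omega$, the boundary conditions hold in the sense of traces, and the initial conditions for $v$ and $v_t$ hold in the sense of $L^2(0,\ell_0)$ and $H^{-1}(0,\ell_0)$ respectively. Moreover $v$ has a continuous representative on $\overline\Omega$ and, setting $v\equiv0$ outside $\overline\Omega$, $$v\in C^0([0,+\infty);H^1(0,+\infty))\cap C^1([0,+\infty);L^2(0,+\infty)).$$ Finally, a function $u$ is a solution in $\widetilde H^1(\Omega)$, in the same sense, of the damped problem $u_{tt}-u_{xx}+\nu u_t=0$ in $\Omega$, $u(t,0)=e^{-\nu t/2}z(t)$ and $u(t,\ell(t))=0$ for $t>0$, $u(0,x)=v_0(x)$ and $u_t(0,x)=v_1(x)-\frac{\nu}{2}v_0(x)$ for $0<x<\ell_0$, if and only if $v(t,x)=e^{\nu t/2}u(t,x)$ is a solution in $\widetilde H^1(\Omega)$ of the problem above. -/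

import Mathlib

open MeasureTheory Set Filter Topology
open scoped ENNReal ContDiff

namespace Debonding

noncomputable section

/-- `φ ∈ C_c^∞(U)`. -/
def IsTest {E : Type*} [NormedAddCommGroup E] [NormedSpace ℝ E] (U : Set E) (φ : E → ℝ) : Prop :=
  ContDiff ℝ ∞ φ ∧ HasCompactSupport φ ∧ tsupport φ ⊆ U

/-- The directional derivative `∂_e φ`. -/
def dirDeriv {E : Type*} [NormedAddCommGroup E] [NormedSpace ℝ E] (e : E) (φ : E → ℝ) : E → ℝ :=
  fun p => fderiv ℝ φ p e

/-- `g` is the weak derivative of `u` in the direction `e` on the open set `U`. -/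
def HasWeakDeriv {E : Type*} [NormedAddCommGroup E] [NormedSpace ℝ E] [MeasureSpace E]
    (U : Set E) (e : E) (u g : E → ℝ) : Prop :=
  LocallyIntegrableOn u U ∧ LocallyIntegrableOn g U ∧
    ∀ φ : E → ℝ, IsTest U φ → ∫ p in U, u p * dirDeriv e φ p = -∫ p in U, g p * φ p

/-- `u ∈ H¹(U)`, for an open subset `U` of a finite-dimensional space. -/
def MemH1 {E : Type*} [NormedAddCommGroup E] [NormedSpace ℝ E] [MeasureSpace E]
    (U : Set E) (u : E → ℝ) : Prop :=
  MemLp u 2 (volume.restrict U) ∧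
    ∀ e : E, ∃ g : E → ℝ, MemLp g 2 (volume.restrict U) ∧ HasWeakDeriv U e u g

/-- `u ∈ H¹(a, b)`, where `u` is the continuous representative on `[a, b]`. -/
def MemH1Icc (a b : ℝ) (u : ℝ → ℝ) : Prop :=
  MemH1 (Ioo a b) u ∧ ContinuousOn u (Icc a b)

/-- The norm of `f` in `H⁻¹(0, c)`, the dual of `H¹₀(0, c)` (in which `C_c^∞(0, c)` is dense). -/
def hNegOneNorm (c : ℝ) (f : ℝ → ℝ) : ℝ≥0∞ :=
  ⨆ (φ : ℝ → ℝ) (_ : IsTest (Ioo 0 c) φ ∧ ∫ x in Ioo 0 c, (φ x ^ 2 + deriv φ x ^ 2) ≤ 1),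
    ENNReal.ofReal |∫ x in Ioo 0 c, f x * φ x|

/-- `s → 0⁺` up to a null set of values of `s`: a property holds eventually along this filter iff
it holds for almost every `s ∈ (0, δ)`, for some `δ > 0`. -/
def zeroRightAE : Filter ℝ := 𝓝[>] 0 ⊓ ae volume

/-- `f s → g` in `L²(0, c)` as `s → 0⁺` (up to a null set of values of `s`). -/
def L2LimitAtZero (c : ℝ) (f : ℝ → ℝ → ℝ) (g : ℝ → ℝ) : Prop :=
  Tendsto (fun s => eLpNorm (fun r => f s r - g r) 2 (volume.restrict (Ioo 0 c)))
    zeroRightAE (𝓝 0)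

/-- `Ω = {(t, x) | t > 0, 0 < x < ℓ(t)}`. Points of `ℝ × ℝ` are written `(t, x)`. -/
def Omega (l : ℝ → ℝ) : Set (ℝ × ℝ) := {p | 0 < p.1 ∧ 0 < p.2 ∧ p.2 < l p.1}

/-- `Ω_T = {(t, x) ∈ Ω | t < T}`. -/
def OmegaT (l : ℝ → ℝ) (T : ℝ) : Set (ℝ × ℝ) := {p | p ∈ Omega l ∧ p.1 < T}

/-- The time derivative `φ_t`. -/
def dt (φ : ℝ × ℝ → ℝ) : ℝ × ℝ → ℝ := dirDeriv (1, 0) φ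

/-- The space derivative `φ_x`. -/
def dx (φ : ℝ × ℝ → ℝ) : ℝ × ℝ → ℝ := dirDeriv (0, 1) φ

/-- `v` belongs to `H̃¹(Ω)` and solves the problem
`v_tt - v_xx + a v_t + b v = 0` in `Ω`, `v(t, 0) = g(t)`, `v(t, ℓ(t)) = 0`,
`v(0, x) = f₀(x)`, `v_t(0, x) = f₁(x)` for `0 < x < ℓ(0)`.
The space `H̃¹(Ω)` consists of the functions that are in `H¹(Ω_T)` for every `T > 0` (these are
automatically in `H¹_loc(Ω)`, because a compact subset of `Ω` lies in some `Ω_T`).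
The trace on a lateral boundary curve is the `L²(0, T)`-limit of the restrictions to the translates
of that curve. -/
structure IsSolution (a b : ℝ) (l g f₀ f₁ : ℝ → ℝ) (v : ℝ × ℝ → ℝ) : Prop where
  memH1 : ∀ T : ℝ, 0 < T → MemH1 (OmegaT l T) v
  equation : ∀ φ : ℝ × ℝ → ℝ, IsTest (Omega l) φ →
    ∫ p in Omega l, v p * (dt (dt φ) p - dx (dx φ) p - a * dt φ p + b * φ p) = 0
  trace_zero : ∀ T : ℝ, 0 < T → L2LimitAtZero T (fun y t => v (t, y)) g
  trace_front : ∀ T : ℝ, 0 < T → L2LimitAtZero T (fun y t => v (t, l t - y)) (fun _ => 0)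
  initial_value : L2LimitAtZero (l 0) (fun t x => v (t, x)) f₀
  initial_velocity : ∃ vt : ℝ × ℝ → ℝ, HasWeakDeriv (Omega l) (1, 0) v vt ∧
    Tendsto (fun t => hNegOneNorm (l 0) (fun x => vt (t, x) - f₁ x)) zeroRightAE (𝓝 0)

/-- The measure of `L²(0, +∞)`. -/
abbrev halfLine : Measure ℝ := volume.restrict (Ioi 0)

/-- `v ∈ C⁰([0, +∞); H¹(0, +∞))`: the curves `t ↦ v(t, ·)` and `t ↦ v_x(t, ·)` (weak derivative)
are continuous with values in `L²(0, +∞)`. -/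
def MemC0H1 (v : ℝ × ℝ → ℝ) : Prop :=
  ∃ V D : ℝ → Lp ℝ 2 halfLine, ContinuousOn V (Ici 0) ∧ ContinuousOn D (Ici 0) ∧
    ∀ t : ℝ, 0 ≤ t → (V t =ᵐ[halfLine] fun x => v (t, x)) ∧
      HasWeakDeriv (Ioi 0) 1 (fun x => v (t, x)) (D t)

/-- `v ∈ C¹([0, +∞); L²(0, +∞))`. -/
def MemC1L2 (v : ℝ × ℝ → ℝ) : Prop :=
  ∃ V : ℝ → Lp ℝ 2 halfLine, ContDiffOn ℝ 1 V (Ici 0) ∧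
    ∀ t : ℝ, 0 ≤ t → V t =ᵐ[halfLine] fun x => v (t, x)

end

end Debonding

/-! Multiplication by `Real.exp (μ * t)` only changes the lower-order coefficients and the data, so
the damped and the undamped problems are equivalent (`IsSolution.exp_mul` with `μ = ν / 2` and `μ =
-(ν / 2)`). The rest concerns v_tt - v_xx = (ν²/4) v. The leading thought is that, in the
characteristic directions (1, 1) and (1, -1), the wave operator is a mixed second derivative.

Uniqueness. The difference u of two solutions, extended by zero to negative times, solves the
equation across t = 0, because both solutions attain the same data in L² and H⁻¹
(`IsSolution.weak_form_sub`). Integrating a mixed derivative over a characteristic parallelogram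
gives the alternating sum of u at its four corners (`ae_double_translation`). If u vanishes before
T₀ and one side of the parallelogram goes back by a time δ, then two corners disappear for times
below T₀ + δ: |u| at a point is bounded by |u| at an earlier point of the same characteristic plus a
double integral of |u|. The earlier point is averaged over a thin strip along the lateral boundary,
where the zero trace makes u small. The L¹ mass N of u before T₀ + δ then satisfies N ≤ Cη + N/2 for
every η > 0 (`IsNull.step`), so N = 0. As δ does not depend on T₀, finitely many steps reach any
time (`IsNull.ae_eq_zero`).

Existence. By d'Alembert and Duhamel, v = f(t + x) + g(t - x) + k D with k = ν²/8, where D is the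
integral of v over the backward cone and D_tt - D_xx = 2v. The left condition expresses g through f.
The front condition expresses f(s) through f(ω(s)) and values of D, where ω labels the wave
reflected from t + x = s. The system for (f, v) is a contraction in a sup norm with weight e^{λt}
M(t) (`exists_fixedPoint`): a reflection goes back in time by at least ℓ₀ and gains e^{-λℓ₀}, the
Duhamel term gains 1/λ², and M absorbs the possible growth of z.

Regularity. That f is in H¹_loc follows by induction along ω, with H¹_loc encoded by the increment
inequality `EnergyOn`, which survives composition with nondecreasing 1-Lipschitz maps. The weak
derivatives of v are then translates of L²_loc functions plus continuous terms, hence continuous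
curves in L². As v vanishes on the front, extension by zero creates no jump, and the derivatives of
the extension are the truncated ones (`memC0H1_wave`, `memC1L2_wave`). -/

namespace Debonding

set_option linter.unusedSectionVars false

/-! ### Test functions and weak derivatives. -/

section TestFunctions

variable {E : Type*} [NormedAddCommGroup E] [NormedSpace ℝ E] {U V : Set E} {φ ψ : E → ℝ} {e : E}

theorem IsTest.mono (h : IsTest U φ) (hUV : U ⊆ V) : IsTest V φ :=
  ⟨h.1, h.2.1, h.2.2.trans hUV⟩

theorem IsTest.mul_left (h : IsTest U φ) (hψ : ContDiff ℝ ∞ ψ) :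
    IsTest U (fun p => ψ p * φ p) :=
  ⟨hψ.mul h.1, h.2.1.mul_left, (tsupport_mul_subset_right (f := ψ) (g := φ)).trans h.2.2⟩

theorem IsTest.dirDeriv (h : IsTest U φ) (e : E) : IsTest U (dirDeriv e φ) := by
  refine ⟨?_, h.2.1.fderiv_apply ℝ e, (tsupport_fderiv_apply_subset ℝ e).trans h.2.2⟩
  exact (h.1.fderiv_right (m := ∞) (by simp)).clm_apply contDiff_const

theorem IsTest.differentiable (h : IsTest U φ) : Differentiable ℝ φ :=
  h.1.differentiable (by simp)

theorem IsTest.continuous (h : IsTest U φ) : Continuous φ := h.1.continuous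

theorem IsTest.eq_zero (h : IsTest U φ) {p : E} (hp : p ∉ U) : φ p = 0 :=
  image_eq_zero_of_notMem_tsupport fun h' => hp (h.2.2 h')

theorem dirDeriv_mul (hψ : Differentiable ℝ ψ) (hφ : Differentiable ℝ φ) (e : E) :
    dirDeriv e (fun p => ψ p * φ p) = fun p => ψ p * dirDeriv e φ p + dirDeriv e ψ p * φ p := by
  funext p
  simp only [dirDeriv]
  rw [fderiv_fun_mul (hψ p) (hφ p)]
  simp; ring

theorem dirDeriv_add (hψ : Differentiable ℝ ψ) (hφ : Differentiable ℝ φ) (e : E) :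
    dirDeriv e (fun p => ψ p + φ p) = fun p => dirDeriv e ψ p + dirDeriv e φ p := by
  funext p
  simp only [dirDeriv]
  rw [fderiv_fun_add (hψ p) (hφ p)]
  simp

theorem dirDeriv_const_mul (c : ℝ) (hφ : Differentiable ℝ φ) (e : E) :
    dirDeriv e (fun p => c * φ p) = fun p => c * dirDeriv e φ p := by
  funext p
  simp only [dirDeriv]
  rw [fderiv_const_mul (hφ p)]
  simp

variable [MeasureSpace E]

theorem setIntegral_eq_of_test {F : E → ℝ} (hF : ∀ p, p ∉ U → F p = 0) (hUV : U ⊆ V) :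
    ∫ p in U, F p = ∫ p in V, F p := by
  rw [setIntegral_eq_integral_of_forall_compl_eq_zero hF,
    setIntegral_eq_integral_of_forall_compl_eq_zero fun p hp => hF p fun h => hp (hUV h)]

theorem setIntegral_eq_integral_of_test {F : E → ℝ} (hF : ∀ p, p ∉ U → F p = 0) :
    ∫ p in U, F p = ∫ p, F p :=
  setIntegral_eq_integral_of_forall_compl_eq_zero hF

variable [BorelSpace E]

theorem integrable_mul_test {u : E → ℝ} (hu : LocallyIntegrableOn u U)
    (h : IsTest U φ) : Integrable (fun p => u p * φ p) := by
  have hK : IsCompact (tsupport φ) := h.2.1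
  have h1 : IntegrableOn (fun p => u p * φ p) (tsupport φ) :=
    (hu.integrableOn_compact_subset h.2.2 hK).mul_continuousOn h.continuous.continuousOn hK
  refine (integrableOn_iff_integrable_of_support_subset ?_).1 h1
  intro p hp
  by_contra hp'
  exact hp (by simp [image_eq_zero_of_notMem_tsupport hp'])

theorem HasWeakDeriv.mono {u g : E → ℝ} (h : HasWeakDeriv U e u g) (hVU : V ⊆ U) :
    HasWeakDeriv V e u g := by
  refine ⟨h.1.mono_set hVU, h.2.1.mono_set hVU, fun φ hφ => ?_⟩
  have := h.2.2 φ (hφ.mono hVU)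
  rwa [← setIntegral_eq_of_test (U := V) (V := U) _ hVU,
    ← setIntegral_eq_of_test (U := V) (V := U) _ hVU] at this
  · intro p hp; simp [hφ.eq_zero hp]
  · intro p hp; simp [(hφ.dirDeriv e).eq_zero hp]

theorem HasWeakDeriv.ae_eq [FiniteDimensional ℝ E]
    {u g g' : E → ℝ} (hU : IsOpen U) (h : HasWeakDeriv U e u g) (h' : HasWeakDeriv U e u g') :
    g =ᵐ[volume.restrict U] g' := by
  rw [Filter.EventuallyEq, ae_restrict_iff' hU.measurableSet]
  have := hU.ae_eq_zero_of_integral_contDiff_smul_eq_zero (μ := volume) (f := g - g')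
    (h.2.1.sub h'.2.1) (fun φ h1 h2 h3 => ?_)
  · filter_upwards [this] with p hp hpU
    simpa [sub_eq_zero] using hp hpU
  · have hφ : IsTest U φ := ⟨h1, h2, h3⟩
    have e1 := h.2.2 φ hφ
    rw [h'.2.2 φ hφ, neg_inj, setIntegral_eq_integral_of_test, setIntegral_eq_integral_of_test] at e1
    · have : ∀ p, φ p • (g - g') p = g p * φ p - g' p * φ p := by
        intro p; simp; ring
      simp_rw [this]
      rw [integral_sub (integrable_mul_test h.2.1 hφ) (integrable_mul_test h'.2.1 hφ), e1, sub_self]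
    · intro p hp; simp [hφ.eq_zero hp]
    · intro p hp; simp [hφ.eq_zero hp]

end TestFunctions

/-! ### The filter of almost every small positive parameter. -/

section ZeroFilter

theorem eventually_zeroRightAE {T : ℝ} (hT : 0 < T) {P : ℝ → Prop}
    (h : ∀ᵐ t, t ∈ Ioo 0 T → P t) : ∀ᶠ t in zeroRightAE, P t := by
  have h1 : ∀ᶠ t in zeroRightAE, t ∈ Ioo 0 T :=
    (Ioo_mem_nhdsGT hT : Ioo 0 T ∈ 𝓝[>] (0:ℝ)) |> fun h => Filter.mem_inf_of_left h
  have h2 : ∀ᶠ t in zeroRightAE, t ∈ Ioo 0 T → P t := Filter.mem_inf_of_right h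
  filter_upwards [h1, h2] with t a b using b a

theorem eventually_zeroRightAE_iff {P : ℝ → Prop} :
    (∀ᶠ t in zeroRightAE, P t) ↔ ∃ δ > 0, ∀ᵐ t, t ∈ Ioo 0 δ → P t := by
  constructor
  · intro h
    rw [zeroRightAE, Filter.eventually_inf] at h
    obtain ⟨s, hs, t, ht, hst⟩ := h
    obtain ⟨δ, hδ, hs⟩ := mem_nhdsGT_iff_exists_Ioo_subset.1 hs
    refine ⟨δ, hδ, ?_⟩
    filter_upwards [ht] with x hx hx'
    exact hst x ⟨hs hx', hx⟩
  · rintro ⟨δ, hδ, h⟩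
    exact eventually_zeroRightAE hδ h

theorem zeroRightAE_le : zeroRightAE ≤ 𝓝 0 :=
  inf_le_left.trans nhdsWithin_le_nhds

end ZeroFilter

/-! ### The norm of H⁻¹. -/

section NegativeNorm

variable {c : ℝ} {f g : ℝ → ℝ}

theorem ofReal_abs_integral_le_hNegOneNorm {φ : ℝ → ℝ} (hφ : IsTest (Ioo 0 c) φ)
    (h : ∫ x in Ioo 0 c, (φ x ^ 2 + deriv φ x ^ 2) ≤ 1) :
    ENNReal.ofReal |∫ x in Ioo 0 c, f x * φ x| ≤ hNegOneNorm c f :=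
  le_iSup₂_of_le (f := fun (φ : ℝ → ℝ)
    (_ : IsTest (Ioo 0 c) φ ∧ ∫ x in Ioo 0 c, (φ x ^ 2 + deriv φ x ^ 2) ≤ 1) =>
      ENNReal.ofReal |∫ x in Ioo 0 c, f x * φ x|) φ ⟨hφ, h⟩ le_rfl

theorem IsTest.memLp {E : Type*} [NormedAddCommGroup E] [NormedSpace ℝ E] [MeasurableSpace E]
    [BorelSpace E] {U : Set E} {φ : E → ℝ} (h : IsTest U φ) (p : ℝ≥0∞) (μ : Measure E)
    [IsFiniteMeasureOnCompacts μ] : MemLp φ p μ :=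
  h.continuous.memLp_of_hasCompactSupport h.2.1

theorem hNegOneNorm_add_le (hf : MemLp f 2 (volume.restrict (Ioo 0 c)))
    (hg : MemLp g 2 (volume.restrict (Ioo 0 c))) :
    hNegOneNorm c (fun x => f x + g x) ≤ hNegOneNorm c f + hNegOneNorm c g := by
  refine iSup₂_le fun φ hφ => ?_
  have hφ2 : MemLp φ 2 (volume.restrict (Ioo 0 c)) := hφ.1.memLp _ _
  have e : ∫ x in Ioo 0 c, (f x + g x) * φ x
      = (∫ x in Ioo 0 c, f x * φ x) + ∫ x in Ioo 0 c, g x * φ x := by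
    simp only [add_mul]
    exact integral_add (hf.integrable_mul hφ2) (hg.integrable_mul hφ2)
  rw [e]
  calc _ ≤ ENNReal.ofReal (|∫ x in Ioo 0 c, f x * φ x| + |∫ x in Ioo 0 c, g x * φ x|) :=
        ENNReal.ofReal_le_ofReal (abs_add_le _ _)
    _ ≤ _ := ENNReal.ofReal_add_le
    _ ≤ _ := add_le_add (ofReal_abs_integral_le_hNegOneNorm hφ.1 hφ.2)
        (ofReal_abs_integral_le_hNegOneNorm hφ.1 hφ.2)

theorem hNegOneNorm_const_mul_le (k : ℝ) :
    hNegOneNorm c (fun x => k * f x) ≤ ENNReal.ofReal |k| * hNegOneNorm c f := by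
  refine iSup₂_le fun φ hφ => ?_
  simp_rw [mul_assoc]
  rw [integral_const_mul, abs_mul, ENNReal.ofReal_mul (abs_nonneg _)]
  gcongr
  exact ofReal_abs_integral_le_hNegOneNorm hφ.1 hφ.2

theorem ofReal_abs_integral_mul_le_eLpNorm {α : Type*} [MeasurableSpace α] {μ : Measure α}
    {f g : α → ℝ} (hf : AEStronglyMeasurable f μ) (hg : AEStronglyMeasurable g μ) :
    ENNReal.ofReal |∫ x, f x * g x ∂μ| ≤ eLpNorm f 2 μ * eLpNorm g 2 μ := by
  rw [← Real.norm_eq_abs, ofReal_norm]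
  refine (enorm_integral_le_lintegral_enorm _).trans ?_
  have h := eLpNorm_smul_le_mul_eLpNorm (p := 2) (q := 2) (r := 1) hg hf
  rw [eLpNorm_one_eq_lintegral_enorm] at h
  exact h

theorem IsTest.eLpNorm_le_one {φ : ℝ → ℝ} (hφ : IsTest (Ioo 0 c) φ)
    (h : ∫ x in Ioo 0 c, (φ x ^ 2 + deriv φ x ^ 2) ≤ 1) :
    eLpNorm φ 2 (volume.restrict (Ioo 0 c)) ≤ 1 := by
  have h1 : MemLp φ 2 (volume.restrict (Ioo 0 c)) := hφ.memLp _ _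
  have h2 : MemLp (deriv φ) 2 (volume.restrict (Ioo 0 c)) := by
    have := (hφ.dirDeriv (1 : ℝ)).memLp 2 (volume.restrict (Ioo 0 c))
    exact this
  rw [h1.eLpNorm_eq_integral_rpow_norm (by simp) (by simp)]
  rw [← ENNReal.ofReal_one]
  apply ENNReal.ofReal_le_ofReal
  have : ∫ x in Ioo 0 c, φ x ^ 2 ≤ 1 := by
    refine le_trans (integral_mono h1.integrable_sq (h1.integrable_sq.add h2.integrable_sq) ?_) h
    intro x; simp; positivity
  apply Real.rpow_le_one
  · positivity
  · simpa using this
  · simp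

theorem hNegOneNorm_le_eLpNorm (hf : AEStronglyMeasurable f (volume.restrict (Ioo 0 c))) :
    hNegOneNorm c f ≤ eLpNorm f 2 (volume.restrict (Ioo 0 c)) := by
  refine iSup₂_le fun φ hφ => ?_
  refine (ofReal_abs_integral_mul_le_eLpNorm hf
    hφ.1.continuous.aestronglyMeasurable).trans ?_
  exact mul_le_of_le_one_right' (hφ.1.eLpNorm_le_one hφ.2)

end NegativeNorm

/-! ### The front and the geometry of the domain. -/

section Front

/-- The admissible fronts: nondecreasing, `1`-Lipschitz and positive on `[0, +∞)`. -/
structure IsFront (l : ℝ → ℝ) : Prop where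
  mono : ∀ s t, 0 ≤ s → s ≤ t → l s ≤ l t
  lip : ∀ s t, 0 ≤ s → s ≤ t → l t - l s ≤ t - s
  pos : 0 < l 0

/-- The extension of the front by a constant to negative times. -/
noncomputable def ext (l : ℝ → ℝ) (t : ℝ) : ℝ := l (max t 0)

variable {l : ℝ → ℝ}

/-- A Lipschitz function is absolutely continuous, so the bounds on its derivative integrate to
bounds on increments. All later arguments use the increments only. -/
theorem isFront_of_deriv {K : NNReal} (hl_lip : LipschitzOnWith K l (Ici 0)) (h0 : 0 < l 0)
    (hl_deriv : ∀ᵐ t ∂(volume.restrict (Ici (0 : ℝ))), 0 ≤ deriv l t ∧ deriv l t ≤ 1) :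
    IsFront l := by
  have key : ∀ s t, 0 ≤ s → s ≤ t → 0 ≤ l t - l s ∧ l t - l s ≤ t - s := by
    intro s t hs hst
    have hsub : uIcc s t ⊆ Ici 0 := by
      rw [uIcc_of_le hst]; exact fun x hx => hs.trans hx.1
    have hac : AbsolutelyContinuousOnInterval l s t :=
      (hl_lip.mono hsub).absolutelyContinuousOnInterval
    have hsub' : Icc s t ⊆ Ici 0 := by rwa [uIcc_of_le hst] at hsub
    have hd : ∀ᵐ x ∂(volume.restrict (Icc s t)), 0 ≤ deriv l x ∧ deriv l x ≤ 1 :=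
      ae_restrict_of_ae_restrict_of_subset hsub' hl_deriv
    rw [← hac.integral_deriv_eq_sub]
    constructor
    · exact intervalIntegral.integral_nonneg_of_ae_restrict hst (hd.mono fun x hx => hx.1)
    · calc _ ≤ ∫ x in s..t, (1 : ℝ) :=
          intervalIntegral.integral_mono_ae_restrict hst hac.intervalIntegrable_deriv
            (by simp) (hd.mono fun x hx => hx.2)
        _ = t - s := by simp
  exact ⟨fun s t hs hst => by linarith [(key s t hs hst).1], fun s t hs hst => (key s t hs hst).2, h0⟩

theorem ext_of_nonneg {t : ℝ} (ht : 0 ≤ t) : ext l t = l t := by simp [ext, ht]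

theorem ext_of_nonpos {t : ℝ} (ht : t ≤ 0) : ext l t = l 0 := by simp [ext, ht]

namespace IsFront

variable (hl : IsFront l)
include hl

theorem ext_mono {s t : ℝ} (h : s ≤ t) : ext l s ≤ ext l t :=
  hl.mono _ _ (le_max_right _ _) (max_le_max_right 0 h)

theorem ext_lip {s t : ℝ} (h : s ≤ t) : ext l t - ext l s ≤ t - s := by
  refine (hl.lip _ _ (le_max_right _ _) (max_le_max_right 0 h)).trans ?_
  rcases le_total s 0 with h1 | h1 <;> rcases le_total t 0 with h2 | h2 <;> simp [h1, h2] <;> linarith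

theorem ext_ge (t : ℝ) : l 0 ≤ ext l t := hl.mono _ _ le_rfl (le_max_right _ _)

theorem ext_lipschitz : LipschitzWith 1 (ext l) := by
  refine LipschitzWith.of_dist_le_mul fun s t => ?_
  rw [Real.dist_eq, Real.dist_eq]
  simp only [NNReal.coe_one, one_mul]
  rcases le_total s t with h | h
  · rw [abs_sub_comm, abs_sub_comm s t, abs_of_nonneg (by linarith [hl.ext_mono h]),
      abs_of_nonneg (by linarith)]
    exact hl.ext_lip h
  · rw [abs_of_nonneg (by linarith [hl.ext_mono h]), abs_of_nonneg (by linarith)]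
    exact hl.ext_lip h

theorem continuous_ext : Continuous (ext l) := hl.ext_lipschitz.continuous

theorem Omega_eq : Omega l = {p | 0 < p.1 ∧ 0 < p.2 ∧ p.2 < ext l p.1} := by
  ext p
  constructor
  · rintro ⟨h1, h2, h3⟩
    exact ⟨h1, h2, by rwa [ext_of_nonneg h1.le]⟩
  · rintro ⟨h1, h2, h3⟩
    exact ⟨h1, h2, by rwa [ext_of_nonneg h1.le] at h3⟩

theorem isOpen_Omega : IsOpen (Omega l) := by
  rw [hl.Omega_eq]
  have := hl.continuous_ext
  exact (isOpen_lt continuous_const continuous_fst).inter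
    ((isOpen_lt continuous_const continuous_snd).inter
      (isOpen_lt continuous_snd (this.comp continuous_fst)))

theorem isOpen_OmegaT (T : ℝ) : IsOpen (OmegaT l T) :=
  hl.isOpen_Omega.inter (isOpen_lt continuous_fst continuous_const)

theorem rect_subset (T : ℝ) : Ioo 0 T ×ˢ Ioo 0 (l 0) ⊆ OmegaT l T := by
  rintro ⟨t, x⟩ ⟨⟨h1, h2⟩, h3, h4⟩
  exact ⟨⟨h1, h3, h4.trans_le (hl.mono _ _ le_rfl h1.le)⟩, h2⟩

theorem OmegaT_subset_rect (T : ℝ) : OmegaT l T ⊆ Ioo 0 T ×ˢ Ioo 0 (l T) := by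
  rintro ⟨t, x⟩ ⟨⟨h1, h3, h4⟩, h2⟩
  exact ⟨⟨h1, h2⟩, h3, lt_of_lt_of_le h4 (hl.mono _ _ (le_of_lt h1) (le_of_lt h2))⟩

end IsFront

theorem OmegaT_subset (l : ℝ → ℝ) (T : ℝ) : OmegaT l T ⊆ Omega l := fun _ h => h.1

end Front

/-! ### Square integrability of almost every time slice. -/

section Sections

theorem ae_memLp_section {u : ℝ × ℝ → ℝ} {s t : Set ℝ} {U : Set (ℝ × ℝ)}
    (hs : MeasurableSet s) (hst : s ×ˢ t ⊆ U) (hu : MemLp u 2 (volume.restrict U)) :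
    ∀ᵐ y, y ∈ s → MemLp (fun x => u (y, x)) 2 (volume.restrict t) := by
  have h1 : MemLp u 2 ((volume.restrict s).prod (volume.restrict t)) := by
    rw [Measure.prod_restrict]
    exact hu.mono_measure (Measure.restrict_mono hst le_rfl)
  rw [← ae_restrict_iff' hs]
  filter_upwards [h1.1.prodMk_left, h1.integrable_sq.prod_right_ae] with y hy1 hy2
  exact (memLp_two_iff_integrable_sq hy1).2 hy2

end Sections

/-! ### Equivalence of the damped and undamped problems. -/

section Damping

theorem MemLp.bdd_mul_cont {α : Type*} [MeasurableSpace α] {μ : Measure α} {f m : α → ℝ} {p : ℝ≥0∞}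
    (hf : MemLp f p μ) (hm : AEStronglyMeasurable m μ) (C : ℝ) (hC : ∀ᵐ x ∂μ, |m x| ≤ C) :
    MemLp (fun x => m x * f x) p μ := by
  refine MemLp.of_le_mul (c := C) hf (hm.mul hf.1) ?_
  filter_upwards [hC] with x hx
  rw [norm_mul]
  exact mul_le_mul_of_nonneg_right hx (norm_nonneg _)

theorem eLpNorm_bdd_mul_le {α : Type*} [MeasurableSpace α] {μ : Measure α} {f m : α → ℝ}
    {p : ℝ≥0∞} (C : ℝ) (hC : ∀ᵐ x ∂μ, |m x| ≤ C) :
    eLpNorm (fun x => m x * f x) p μ ≤ ENNReal.ofReal C * eLpNorm f p μ := by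
  refine eLpNorm_le_mul_eLpNorm_of_ae_le_mul ?_ p
  filter_upwards [hC] with x hx
  rw [norm_mul]
  exact mul_le_mul_of_nonneg_right hx (norm_nonneg _)

theorem L2LimitAtZero.bdd_mul {c C : ℝ} {f : ℝ → ℝ → ℝ} {g m : ℝ → ℝ} (h : L2LimitAtZero c f g)
    (hC : ∀ x ∈ Ioo 0 c, |m x| ≤ C) :
    L2LimitAtZero c (fun s r => m r * f s r) (fun r => m r * g r) := by
  unfold L2LimitAtZero at h ⊢
  have h2 : Tendsto (fun s => ENNReal.ofReal C *
      eLpNorm (fun r => f s r - g r) 2 (volume.restrict (Ioo 0 c))) zeroRightAE (𝓝 0) := by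
    simpa using ENNReal.Tendsto.const_mul h (Or.inr ENNReal.ofReal_ne_top)
  refine tendsto_of_tendsto_of_tendsto_of_le_of_le tendsto_const_nhds h2 (fun _ => zero_le) ?_
  intro s
  simp_rw [← mul_sub]
  exact eLpNorm_bdd_mul_le C ((ae_restrict_mem measurableSet_Ioo).mono hC)

theorem contDiff_exp_time (μ : ℝ) : ContDiff ℝ ∞ (fun p : ℝ × ℝ => Real.exp (μ * p.1)) := by
  fun_prop

theorem dirDeriv_exp_time (μ : ℝ) (e : ℝ × ℝ) : dirDeriv e (fun p : ℝ × ℝ => Real.exp (μ * p.1))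
    = fun p => e.1 * μ * Real.exp (μ * p.1) := by
  funext p
  have : HasFDerivAt (fun p : ℝ × ℝ => Real.exp (μ * p.1))
      (Real.exp (μ * p.1) • (μ • ContinuousLinearMap.fst ℝ ℝ ℝ)) p :=
    ((hasFDerivAt_fst (p := p)).const_mul μ).exp
  rw [dirDeriv, this.fderiv]
  simp; ring

theorem HasWeakDeriv.exp_mul {U : Set (ℝ × ℝ)} (hU : IsOpen U) {e : ℝ × ℝ} {u g : ℝ × ℝ → ℝ}
    (h : HasWeakDeriv U e u g) (μ : ℝ) :
    HasWeakDeriv U e (fun p => Real.exp (μ * p.1) * u p)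
      (fun p => Real.exp (μ * p.1) * (g p + e.1 * μ * u p)) := by
  have hc : ContinuousOn (fun p : ℝ × ℝ => Real.exp (μ * p.1)) U :=
    (contDiff_exp_time μ).continuous.continuousOn
  refine ⟨h.1.continuousOn_mul hc hU.isLocallyClosed,
    (h.2.1.add (h.1.smul (e.1 * μ))).continuousOn_mul hc hU.isLocallyClosed, fun φ hφ => ?_⟩
  have hψ := hφ.mul_left (contDiff_exp_time μ)
  have e1 := h.2.2 _ hψ
  rw [dirDeriv_mul ((contDiff_exp_time μ).differentiable (by simp)) hφ.differentiable,
    dirDeriv_exp_time] at e1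
  have i1 := (integrable_mul_test h.1 ((hφ.dirDeriv e).mul_left (contDiff_exp_time μ))).integrableOn
    (s := U)
  have i2 := (integrable_mul_test h.1 hψ).integrableOn (s := U)
  have i3 := (integrable_mul_test h.2.1 hψ).integrableOn (s := U)
  have l1 : ∫ p in U, u p * (Real.exp (μ * p.1) * dirDeriv e φ p +
      e.1 * μ * Real.exp (μ * p.1) * φ p) = (∫ p in U, u p * (Real.exp (μ * p.1) * dirDeriv e φ p))
      + e.1 * μ * ∫ p in U, u p * (Real.exp (μ * p.1) * φ p) := by
    rw [← integral_const_mul, ← integral_add i1 (i2.const_mul _)]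
    congr 1; funext p; ring
  have l2 : ∫ p in U, Real.exp (μ * p.1) * (g p + e.1 * μ * u p) * φ p =
      (∫ p in U, g p * (Real.exp (μ * p.1) * φ p))
      + e.1 * μ * ∫ p in U, u p * (Real.exp (μ * p.1) * φ p) := by
    rw [← integral_const_mul, ← integral_add i3 (i2.const_mul _)]
    congr 1; funext p; ring
  rw [l1] at e1
  rw [l2, show (fun p => Real.exp (μ * p.1) * u p * dirDeriv e φ p)
    = fun p => u p * (Real.exp (μ * p.1) * dirDeriv e φ p) by funext p; ring]
  linarith

variable {l : ℝ → ℝ} {a b : ℝ} {g f₀ f₁ : ℝ → ℝ} {u : ℝ × ℝ → ℝ}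

theorem exp_mul_abs_le {μ t T : ℝ} (h0 : 0 < t) (hT : t < T) :
    |Real.exp (μ * t)| ≤ Real.exp (|μ| * T) := by
  rw [abs_of_pos (Real.exp_pos _)]
  apply Real.exp_le_exp.2
  calc μ * t ≤ |μ| * t := mul_le_mul_of_nonneg_right (le_abs_self _) h0.le
    _ ≤ _ := by gcongr

theorem IsSolution.ae_memLp_section (hl : IsFront l) (h : IsSolution a b l g f₀ f₁ u) :
    ∀ᶠ t in zeroRightAE, MemLp (fun x => u (t, x)) 2 (volume.restrict (Ioo 0 (l 0))) :=
  eventually_zeroRightAE one_pos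
    (Debonding.ae_memLp_section measurableSet_Ioo (hl.rect_subset 1) (h.memH1 1 one_pos).1)

theorem IsSolution.memLp_weakDeriv (hl : IsFront l) (h : IsSolution a b l g f₀ f₁ u)
    {e : ℝ × ℝ} {w : ℝ × ℝ → ℝ} (hw : HasWeakDeriv (Omega l) e u w) {T : ℝ} (hT : 0 < T) :
    MemLp w 2 (volume.restrict (OmegaT l T)) := by
  obtain ⟨w', h1, h2⟩ := (h.memH1 T hT).2 e
  exact (memLp_congr_ae ((hw.mono (OmegaT_subset l T)).ae_eq (hl.isOpen_OmegaT T) h2)).2 h1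

/-- With ψ = e^{μt} φ one has ψ_tt = e^{μt}(φ_tt + 2μφ_t + μ²φ) and ψ_t = e^{μt}(φ_t + μφ). Using ψ
as test function for `u` gives the equation with the shifted coefficients, tested against φ. -/
theorem IsSolution.exp_mul (hl : IsFront l) (h : IsSolution a b l g f₀ f₁ u)
    (hf₀ : MemLp f₀ 2 (volume.restrict (Ioo 0 (l 0))))
    (hf₁ : MemLp f₁ 2 (volume.restrict (Ioo 0 (l 0)))) (μ : ℝ) :
    IsSolution (a - 2 * μ) (b + μ ^ 2 - a * μ) l (fun t => Real.exp (μ * t) * g t) f₀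
      (fun x => f₁ x + μ * f₀ x) (fun p => Real.exp (μ * p.1) * u p) := by
  have hexp : Tendsto (fun t => Real.exp (μ * t)) zeroRightAE (𝓝 1) := by
    have : Continuous (fun t => Real.exp (μ * t)) := by fun_prop
    have := (this.tendsto 0).mono_left zeroRightAE_le
    simpa using this
  have hbd : ∀ T, ∀ t ∈ Ioo 0 T, |Real.exp (μ * t)| ≤ Real.exp (|μ| * T) :=
    fun T t ht => exp_mul_abs_le ht.1 ht.2
  have hval : L2LimitAtZero (l 0) (fun t x => Real.exp (μ * t) * u (t, x)) f₀ := by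
    have h1 : Tendsto (fun t => ENNReal.ofReal |Real.exp (μ * t)| *
        eLpNorm (fun x => u (t, x) - f₀ x) 2 (volume.restrict (Ioo 0 (l 0)))
        + ENNReal.ofReal |Real.exp (μ * t) - 1| * eLpNorm f₀ 2 (volume.restrict (Ioo 0 (l 0))))
        zeroRightAE (𝓝 (ENNReal.ofReal |1| * 0 + ENNReal.ofReal |1 - 1| *
          eLpNorm f₀ 2 (volume.restrict (Ioo 0 (l 0))))) := by
      refine Tendsto.add ?_ ?_
      · exact ENNReal.Tendsto.mul (ENNReal.tendsto_ofReal hexp.abs) (Or.inr (by simp))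
          h.initial_value (Or.inr (by simp))
      · exact ENNReal.Tendsto.mul_const (ENNReal.tendsto_ofReal (hexp.sub_const 1).abs)
          (Or.inr hf₀.2.ne)
    simp only [mul_zero, sub_self, abs_zero, ENNReal.ofReal_zero, zero_mul, add_zero] at h1
    refine tendsto_of_tendsto_of_tendsto_of_le_of_le' tendsto_const_nhds h1
      (Eventually.of_forall fun _ => zero_le) ?_
    filter_upwards [h.ae_memLp_section hl] with t ht
    have : (fun x => Real.exp (μ * t) * u (t, x) - f₀ x) =
      (fun x => Real.exp (μ * t) * (u (t, x) - f₀ x)) +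
        (fun x => (Real.exp (μ * t) - 1) * f₀ x) := by funext x; simp; ring
    rw [this]
    refine (eLpNorm_add_le ((ht.sub hf₀).1.const_mul _) (hf₀.1.const_mul _) (by norm_num)).trans ?_
    exact add_le_add (eLpNorm_bdd_mul_le _ (by simp)) (eLpNorm_bdd_mul_le _ (by simp))
  refine ⟨fun T hT => ⟨?_, fun e => ?_⟩, fun φ hφ => ?_, fun T hT => ?_, fun T hT => ?_, hval, ?_⟩
  · refine MemLp.bdd_mul_cont (h.memH1 T hT).1
      (contDiff_exp_time μ).continuous.aestronglyMeasurable (Real.exp (|μ| * T)) ?_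
    filter_upwards [ae_restrict_mem (hl.isOpen_OmegaT T).measurableSet] with p hp
    exact exp_mul_abs_le hp.1.1 hp.2
  · obtain ⟨w, h1, h2⟩ := (h.memH1 T hT).2 e
    refine ⟨_, ?_, h2.exp_mul (hl.isOpen_OmegaT T) μ⟩
    refine MemLp.bdd_mul_cont (f := fun p => w p + e.1 * μ * u p)
      (h1.add ((h.memH1 T hT).1.const_mul _))
      (contDiff_exp_time μ).continuous.aestronglyMeasurable (Real.exp (|μ| * T)) ?_
    filter_upwards [ae_restrict_mem (hl.isOpen_OmegaT T).measurableSet] with p hp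
    exact exp_mul_abs_le hp.1.1 hp.2
  · rw [← h.equation _ (hφ.mul_left (contDiff_exp_time μ))]
    congr 1; funext p
    have hE := (contDiff_exp_time μ).differentiable (n := ∞) (by simp)
    have hφt : Differentiable ℝ (dt φ) := (hφ.dirDeriv _).differentiable
    have hφx : Differentiable ℝ (dx φ) := (hφ.dirDeriv _).differentiable
    have e1 : dt (fun p => Real.exp (μ * p.1) * φ p)
        = fun p => Real.exp (μ * p.1) * (dt φ p + μ * φ p) := by
      rw [dt, dirDeriv_mul hE hφ.differentiable, dirDeriv_exp_time]
      funext p; simp only [dt]; ring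
    have e2 : dt (fun p => Real.exp (μ * p.1) * (dt φ p + μ * φ p))
        = fun p => Real.exp (μ * p.1) * (dt (dt φ) p + 2 * μ * dt φ p + μ ^ 2 * φ p) := by
      have hs : Differentiable ℝ (fun p => dt φ p + μ * φ p) :=
        hφt.add (hφ.differentiable.const_mul μ)
      rw [dt, dirDeriv_mul hE hs, dirDeriv_exp_time,
        dirDeriv_add hφt (hφ.differentiable.const_mul μ), dirDeriv_const_mul _ hφ.differentiable]
      funext p; simp only [dt]; ring
    have e3 : dx (fun p => Real.exp (μ * p.1) * φ p)
        = fun p => Real.exp (μ * p.1) * dx φ p := by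
      rw [dx, dirDeriv_mul hE hφ.differentiable, dirDeriv_exp_time]
      funext p; simp only [dx]; ring
    have e4 : dx (fun p => Real.exp (μ * p.1) * dx φ p)
        = fun p => Real.exp (μ * p.1) * dx (dx φ) p := by
      rw [dx, dirDeriv_mul hE hφx, dirDeriv_exp_time]
      funext p; simp only [dx]; ring
    rw [e1, e2, e3, e4]
    ring
  · exact L2LimitAtZero.bdd_mul (f := fun y t => u (t, y)) (m := fun t => Real.exp (μ * t))
      (h.trace_zero T hT) (hbd T)
  · have := L2LimitAtZero.bdd_mul (f := fun y t => u (t, l t - y))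
      (m := fun t => Real.exp (μ * t)) (h.trace_front T hT) (hbd T)
    simp only [mul_zero] at this
    exact this
  · obtain ⟨w, hw, hlim⟩ := h.initial_velocity
    refine ⟨_, hw.exp_mul hl.isOpen_Omega μ, ?_⟩
    have h1 : Tendsto (fun t => ENNReal.ofReal |Real.exp (μ * t)| *
        hNegOneNorm (l 0) (fun x => w (t, x) - f₁ x)
        + (ENNReal.ofReal |Real.exp (μ * t) - 1| * hNegOneNorm (l 0) f₁ + ENNReal.ofReal |μ| *
          eLpNorm (fun x => Real.exp (μ * t) * u (t, x) - f₀ x) 2 (volume.restrict (Ioo 0 (l 0)))))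
        zeroRightAE (𝓝 (ENNReal.ofReal |1| * 0 + (ENNReal.ofReal |1 - 1| *
          hNegOneNorm (l 0) f₁ + ENNReal.ofReal |μ| * 0))) := by
      refine Tendsto.add ?_ (Tendsto.add ?_ ?_)
      · exact ENNReal.Tendsto.mul (ENNReal.tendsto_ofReal hexp.abs) (Or.inr (by simp))
          hlim (Or.inr (by simp))
      · exact ENNReal.Tendsto.mul_const (ENNReal.tendsto_ofReal (hexp.sub_const 1).abs)
          (Or.inr ((hNegOneNorm_le_eLpNorm hf₁.1).trans_lt hf₁.2).ne)
      · exact ENNReal.Tendsto.const_mul hval (Or.inr ENNReal.ofReal_ne_top)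
    simp only [mul_zero, sub_self, abs_zero, ENNReal.ofReal_zero, zero_mul, add_zero] at h1
    refine tendsto_of_tendsto_of_tendsto_of_le_of_le' tendsto_const_nhds h1
      (Eventually.of_forall fun _ => zero_le) ?_
    filter_upwards [h.ae_memLp_section hl, eventually_zeroRightAE one_pos
      (Debonding.ae_memLp_section measurableSet_Ioo (hl.rect_subset 1)
        (h.memLp_weakDeriv hl hw one_pos))] with t ht1 ht2
    -- The three summands tend to zero in H⁻¹ for different reasons: the initial velocity of `u`, a
    -- scalar factor tending to zero, and the initial value, which converges even in L².
    have e1 : (fun x => Real.exp (μ * t) * (w (t, x) + 1 * μ * u (t, x)) - (f₁ x + μ * f₀ x))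
      = fun x => Real.exp (μ * t) * (w (t, x) - f₁ x) + ((Real.exp (μ * t) - 1) * f₁ x
        + μ * (Real.exp (μ * t) * u (t, x) - f₀ x)) := by funext x; ring
    have m0 : MemLp (fun x => Real.exp (μ * t) * u (t, x) - f₀ x) 2
      (volume.restrict (Ioo 0 (l 0))) := (ht1.const_mul _).sub hf₀
    rw [e1]
    refine (hNegOneNorm_add_le (f := fun x => Real.exp (μ * t) * (w (t, x) - f₁ x))
      (g := fun x => (Real.exp (μ * t) - 1) * f₁ x + μ * (Real.exp (μ * t) * u (t, x) - f₀ x))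
      ((ht2.sub hf₁).const_mul _) ((hf₁.const_mul _).add (m0.const_mul _))).trans ?_
    refine add_le_add (hNegOneNorm_const_mul_le _) ?_
    refine (hNegOneNorm_add_le (f := fun x => (Real.exp (μ * t) - 1) * f₁ x)
      (g := fun x => μ * (Real.exp (μ * t) * u (t, x) - f₀ x)) (hf₁.const_mul _)
      (m0.const_mul _)).trans ?_
    refine add_le_add (hNegOneNorm_const_mul_le _) ((hNegOneNorm_const_mul_le _).trans ?_)
    gcongr
    exact hNegOneNorm_le_eLpNorm m0.1

theorem isSolution_damped_iff (hl : IsFront l) (ν : ℝ) {z v₀ v₁ : ℝ → ℝ}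
    (hv₀ : MemLp v₀ 2 (volume.restrict (Ioo 0 (l 0))))
    (hv₁ : MemLp v₁ 2 (volume.restrict (Ioo 0 (l 0)))) (u : ℝ × ℝ → ℝ) :
    IsSolution ν 0 l (fun t => Real.exp (-(ν * t / 2)) * z t) v₀
        (fun x => v₁ x - ν / 2 * v₀ x) u ↔
      IsSolution 0 (-(ν ^ 2 / 4)) l z v₀ v₁ (fun p => Real.exp (ν * p.1 / 2) * u p) := by
  constructor
  · intro h
    have := h.exp_mul hl hv₀ (hv₁.sub (hv₀.const_mul _)) (ν / 2)
    convert this using 1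
    · ring
    · ring
    · funext t
      rw [← mul_assoc, ← Real.exp_add]
      ring_nf; simp
    · funext x; ring
    · funext p; ring_nf
  · intro h
    have := h.exp_mul hl hv₀ hv₁ (-(ν / 2))
    convert this using 1
    · ring
    · ring
    · funext t; ring_nf
    · funext x; ring
    · funext p
      rw [← mul_assoc, ← Real.exp_add]
      ring_nf; simp

end Damping

/-! ### Extension of the difference of two solutions across t = 0. -/

section ZeroExtension

/-- The domain extended to negative times by a cylinder. -/
def OmegaExt (l : ℝ → ℝ) : Set (ℝ × ℝ) := {p | 0 < p.2 ∧ p.2 < ext l p.1}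

variable {l : ℝ → ℝ}

theorem IsFront.Omega_eq_inter (hl : IsFront l) : Omega l = {p | 0 < p.1} ∩ OmegaExt l :=
  hl.Omega_eq

/-- A smooth cutoff in time, which vanishes for `t ≤ 1 / n` and equals `1` for `t ≥ 2 / n`. -/
noncomputable def cutoff (n : ℝ) (p : ℝ × ℝ) : ℝ := Real.smoothTransition (n * p.1 - 1)

theorem contDiff_cutoff (n : ℝ) : ContDiff ℝ ∞ (cutoff n) := by
  have := Real.smoothTransition.contDiff (n := (⊤ : ℕ∞))
  exact this.comp (by fun_prop)

theorem dirDeriv_cutoff (n : ℝ) (e : ℝ × ℝ) (p : ℝ × ℝ) : dirDeriv e (cutoff n) p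
    = n * e.1 * deriv Real.smoothTransition (n * p.1 - 1) := by
  have h1 : HasDerivAt Real.smoothTransition (deriv Real.smoothTransition (n * p.1 - 1))
      (n * p.1 - 1) := ((Real.smoothTransition.contDiff (n := 1)).differentiable
        (by simp) _).hasDerivAt
  have h2 : HasFDerivAt (fun p : ℝ × ℝ => n * p.1 - 1) (n • ContinuousLinearMap.fst ℝ ℝ ℝ) p :=
    ((hasFDerivAt_fst (p := p)).const_mul n).sub_const 1
  have := h1.comp_hasFDerivAt p h2
  rw [dirDeriv, show cutoff n = Real.smoothTransition ∘ (fun p : ℝ × ℝ => n * p.1 - 1) from rfl,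
    this.fderiv]
  simp; ring

theorem deriv_smoothTransition_eq_zero {s : ℝ} (hs : s ∉ Icc (0 : ℝ) 1) :
    deriv Real.smoothTransition s = 0 := by
  rw [mem_Icc, not_and_or, not_le, not_le] at hs
  rcases hs with h | h
  · have : Real.smoothTransition =ᶠ[𝓝 s] fun _ => 0 := by
      filter_upwards [Iio_mem_nhds h] with x hx
      exact Real.smoothTransition.zero_of_nonpos (le_of_lt hx)
    rw [this.deriv_eq]; simp
  · have : Real.smoothTransition =ᶠ[𝓝 s] fun _ => 1 := by
      filter_upwards [Ioi_mem_nhds h] with x hx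
      exact Real.smoothTransition.one_of_one_le (le_of_lt hx)
    rw [this.deriv_eq]; simp

theorem exists_bound_deriv_smoothTransition :
    ∃ C, 0 ≤ C ∧ ∀ s, |deriv Real.smoothTransition s| ≤ C := by
  have hc : Continuous (deriv Real.smoothTransition) :=
    (Real.smoothTransition.contDiff (n := 1)).continuous_deriv le_rfl
  obtain ⟨C, hC⟩ := isCompact_Icc.exists_bound_of_continuousOn (s := Icc (0:ℝ) 1) hc.continuousOn
  refine ⟨max C 0, le_max_right _ _, fun s => ?_⟩
  by_cases hs : s ∈ Icc (0:ℝ) 1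
  · exact (hC s hs).trans (le_max_left _ _)
  · rw [deriv_smoothTransition_eq_zero hs]; simp

theorem isTest_cutoff_mul (hl : IsFront l) {φ : ℝ × ℝ → ℝ} (hφ : IsTest (OmegaExt l) φ) {n : ℝ}
    (hn : 0 < n) : IsTest (Omega l) (fun p => cutoff n p * φ p) := by
  have h := hφ.mul_left (contDiff_cutoff n)
  refine ⟨h.1, h.2.1, ?_⟩
  rw [hl.Omega_eq_inter]
  refine subset_inter ?_ h.2.2
  have : tsupport (fun p => cutoff n p * φ p) ⊆ {p | 1 ≤ n * p.1} := by
    refine closure_minimal ?_ (isClosed_le continuous_const (by fun_prop))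
    intro p hp
    by_contra h'
    apply hp
    have : cutoff n p = 0 := Real.smoothTransition.zero_of_nonpos (by simp at h'; linarith)
    simp [this]
  intro p hp
  have h1 := this hp
  simp only [mem_ofPred_eq] at h1 ⊢
  by_contra h2
  push Not at h2
  nlinarith

variable {b : ℝ} {g f₀ f₁ : ℝ → ℝ} {v : ℝ × ℝ → ℝ}

theorem IsTest.exists_bound {E : Type*} [NormedAddCommGroup E] [NormedSpace ℝ E]
    {U : Set E} {φ : E → ℝ} (h : IsTest U φ) : ∃ C, 0 ≤ C ∧ ∀ p, |φ p| ≤ C := by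
  obtain ⟨C, hC⟩ := h.continuous.bounded_above_of_compact_support h.2.1
  exact ⟨max C 0, le_max_right _ _, fun p => (hC p).trans (le_max_left _ _)⟩

/-- Testing with χφ produces the term v χ_tt φ, of order n² and out of control. The weak time
derivative, tested with χ_t φ, trades it for v_t χ_t φ, so only first derivatives of the cutoff
remain. -/
theorem IsSolution.cutoff_identity (hl : IsFront l) (h : IsSolution 0 b l g f₀ f₁ v)
    {vt : ℝ × ℝ → ℝ} (hvt : HasWeakDeriv (Omega l) (1, 0) v vt)
    {φ : ℝ × ℝ → ℝ} (hφ : IsTest (OmegaExt l) φ) {n : ℝ} (hn : 0 < n) :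
    ∫ p in Omega l, v p * (cutoff n p * (dt (dt φ) p - dx (dx φ) p + b * φ p))
      = -(∫ p in Omega l, v p * (dt (cutoff n) p * dt φ p))
        + ∫ p in Omega l, vt p * (dt (cutoff n) p * φ p) := by
  have hχ := (contDiff_cutoff n).differentiable (by simp)
  have hχt : ContDiff ℝ ∞ (dt (cutoff n)) :=
    ((contDiff_cutoff n).fderiv_right (m := ∞) (by simp)).clm_apply contDiff_const
  have hχt' := hχt.differentiable (by simp)
  have hφd := hφ.differentiable
  have hφt := hφ.dirDeriv ((1:ℝ), (0:ℝ))
  have hφx := hφ.dirDeriv ((0:ℝ), (1:ℝ))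
  have hT := isTest_cutoff_mul hl hφ hn
  have hdx0 : dx (cutoff n) = fun _ => 0 := by
    funext p; rw [dx, dirDeriv_cutoff]; simp
  have e1 : dt (fun p => cutoff n p * φ p)
      = fun p => cutoff n p * dt φ p + dt (cutoff n) p * φ p := dirDeriv_mul hχ hφd _
  have t1 : IsTest (Omega l) (fun p => cutoff n p * dt φ p) := isTest_cutoff_mul hl hφt hn
  -- Written as a combination of test functions on Ω, so that no support computation for the
  -- derivative of the cutoff is needed.
  have t2 : IsTest (Omega l) (fun p => dt (cutoff n) p * φ p) := by
    have : (fun p => dt (cutoff n) p * φ p)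
        = fun p => dt (fun p => cutoff n p * φ p) p + (-1) * (cutoff n p * dt φ p) := by
      rw [e1]; funext p; ring
    rw [this]
    have hA := hT.dirDeriv ((1:ℝ), (0:ℝ))
    have hB := t1.mul_left (ψ := fun _ => (-1 : ℝ)) contDiff_const
    exact ⟨hA.1.add hB.1, hA.2.1.add hB.2.1,
      (tsupport_add _ _).trans (union_subset hA.2.2 hB.2.2)⟩
  have t3 : IsTest (Omega l) (fun p => dt (cutoff n) p * dt φ p) := by
    have e := dirDeriv_mul hχ hφt.differentiable ((1:ℝ), (0:ℝ))
    have : (fun p => dt (cutoff n) p * dt φ p)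
        = fun p => dt (fun p => cutoff n p * dt φ p) p + (-1) * (cutoff n p * dt (dt φ) p) := by
      unfold dt at e ⊢
      rw [e]; funext p; ring
    rw [this]
    have hA := t1.dirDeriv ((1:ℝ), (0:ℝ))
    have hB := (isTest_cutoff_mul hl (hφt.dirDeriv ((1:ℝ), (0:ℝ))) hn).mul_left
      (ψ := fun _ => (-1 : ℝ)) contDiff_const
    exact ⟨hA.1.add hB.1, hA.2.1.add hB.2.1,
      (tsupport_add _ _).trans (union_subset hA.2.2 hB.2.2)⟩
  have e2 : dt (fun p => dt (cutoff n) p * φ p)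
      = fun p => dt (cutoff n) p * dt φ p + dt (dt (cutoff n)) p * φ p := dirDeriv_mul hχt' hφd _
  have e3 : dt (fun p => cutoff n p * dt φ p)
      = fun p => cutoff n p * dt (dt φ) p + dt (cutoff n) p * dt φ p :=
    dirDeriv_mul hχ hφt.differentiable _
  have e4 : dt (dt (fun p => cutoff n p * φ p)) = fun p => cutoff n p * dt (dt φ) p
      + dt (cutoff n) p * dt φ p + dt (fun p => dt (cutoff n) p * φ p) p := by
    rw [e1]
    have := dirDeriv_add t1.differentiable t2.differentiable ((1:ℝ), (0:ℝ))
    unfold dt at this e3 ⊢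
    rw [this, e3]
  have e5 : dx (fun p => cutoff n p * φ p) = fun p => cutoff n p * dx φ p := by
    rw [dx, dirDeriv_mul hχ hφd]
    have : dirDeriv ((0:ℝ), (1:ℝ)) (cutoff n) = fun _ => 0 := hdx0
    rw [this]; funext p; simp [dx]
  have e6 : dx (fun p => cutoff n p * dx φ p) = fun p => cutoff n p * dx (dx φ) p := by
    unfold dx
    rw [dirDeriv_mul hχ hφx.differentiable]
    have : dirDeriv ((0:ℝ), (1:ℝ)) (cutoff n) = fun _ => 0 := hdx0
    rw [this]; funext p; simp
  have h1 := h.equation _ hT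
  have h2 := hvt.2.2 _ t2
  rw [e4, e5, e6] at h1
  have hloc := hvt.1
  have i1 := (integrable_mul_test hloc (isTest_cutoff_mul hl (hφt.dirDeriv ((1:ℝ), (0:ℝ))) hn))
  have i2 := (integrable_mul_test hloc (isTest_cutoff_mul hl (hφx.dirDeriv ((0:ℝ), (1:ℝ))) hn))
  have i3 := (integrable_mul_test hloc hT)
  have i4 := (integrable_mul_test hloc t3).integrableOn (s := Omega l)
  have i5 := (integrable_mul_test hloc (t2.dirDeriv ((1:ℝ), (0:ℝ)))).integrableOn (s := Omega l)
  have i6 : IntegrableOn (fun p => v p * (cutoff n p * (dt (dt φ) p - dx (dx φ) p + b * φ p)))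
      (Omega l) := by
    refine (((i1.sub i2).add (i3.const_mul b)).integrableOn (s := Omega l)).congr_fun_ae
      (Eventually.of_forall fun p => ?_)
    simp only [Pi.add_apply, Pi.sub_apply, dt, dx]; ring
  have e7 : (∫ p in Omega l, v p * (cutoff n p * dt (dt φ) p + dt (cutoff n) p * dt φ p +
      dt (fun p => dt (cutoff n) p * φ p) p - cutoff n p * dx (dx φ) p
      - 0 * dt (fun p => cutoff n p * φ p) p + b * (cutoff n p * φ p)))
      = (∫ p in Omega l, v p * (cutoff n p * (dt (dt φ) p - dx (dx φ) p + b * φ p)))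
      + (∫ p in Omega l, v p * (dt (cutoff n) p * dt φ p))
      + ∫ p in Omega l, v p * dt (fun p => dt (cutoff n) p * φ p) p := by
    have A := integral_add (i6.add i4) i5
    simp only [Pi.add_apply] at A
    rw [integral_add i6 i4] at A
    refine Eq.trans ?_ A
    congr 1; funext p
    simp only [dt]; ring
  rw [e7] at h1
  unfold dt at h1 h2 ⊢
  rw [h2] at h1
  linarith

/-- The compact support keeps a distance `m` below the front, and the front moves by less than `m`
before time `m`. Hence the early slices of φ are admissible in the H⁻¹ norm on (0, ℓ(0)). -/
theorem IsTest.exists_time_bound (hl : IsFront l) {φ : ℝ × ℝ → ℝ} (hφ : IsTest (OmegaExt l) φ) :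
    ∃ m > 0, (∀ p ∈ tsupport φ, p.1 < m → p.2 ∈ Ioo 0 (l 0)) ∧
      ∀ t < m, IsTest (Ioo 0 (l 0)) (fun x => φ (t, x)) := by
  have hK : IsCompact (tsupport φ) := hφ.2.1
  have hm : ∃ m > 0, ∀ p ∈ tsupport φ, p.2 ≤ ext l p.1 - m := by
    rcases (tsupport φ).eq_empty_or_nonempty with h0 | h0
    · exact ⟨1, one_pos, by simp [h0]⟩
    · obtain ⟨q, hq, hmin⟩ := hK.exists_isMinOn h0
        (f := fun p : ℝ × ℝ => ext l p.1 - p.2)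
        ((hl.continuous_ext.comp continuous_fst).sub continuous_snd).continuousOn
      refine ⟨ext l q.1 - q.2, by have := (hφ.2.2 hq).2; linarith, fun p hp => ?_⟩
      have := hmin hp
      simp only [mem_ofPred_eq] at this
      linarith
  obtain ⟨m, hm0, hm⟩ := hm
  have key : ∀ p ∈ tsupport φ, p.1 < m → p.2 ∈ Ioo 0 (l 0) := by
    intro p hp ht
    refine ⟨(hφ.2.2 hp).1, ?_⟩
    have h1 := hm _ hp
    rcases le_total p.1 0 with h | h
    · rw [ext_of_nonpos h] at h1; linarith
    · have := hl.ext_lip h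
      rw [ext_of_nonpos le_rfl] at this
      linarith
  refine ⟨m, hm0, key, fun t ht => ⟨hφ.1.comp (contDiff_prodMk_right t), ?_, ?_⟩⟩
  · refine HasCompactSupport.intro (hK.image continuous_snd) fun x hx => ?_
    exact image_eq_zero_of_notMem_tsupport fun h => hx ⟨_, h, rfl⟩
  · exact fun x hx =>
      key (t, x) (tsupport_comp_subset_preimage φ (f := fun x : ℝ => (t, x)) (by fun_prop) hx) ht

theorem ofReal_abs_integral_le_mul_hNegOneNorm {c N : ℝ} {f φ : ℝ → ℝ} (hN : 0 < N)
    (hφ : IsTest (Ioo 0 c) φ) (h : ∫ x in Ioo 0 c, (φ x ^ 2 + deriv φ x ^ 2) ≤ N ^ 2) :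
    ENNReal.ofReal |∫ x in Ioo 0 c, f x * φ x| ≤ ENNReal.ofReal N * hNegOneNorm c f := by
  have hψ := hφ.mul_left (ψ := fun _ => N⁻¹) contDiff_const
  have h1 : ∫ x in Ioo 0 c, ((N⁻¹ * φ x) ^ 2 + deriv (fun x => N⁻¹ * φ x) x ^ 2) ≤ 1 := by
    have : ∀ x, (N⁻¹ * φ x) ^ 2 + deriv (fun x => N⁻¹ * φ x) x ^ 2
        = (N⁻¹) ^ 2 * (φ x ^ 2 + deriv φ x ^ 2) := by
      intro x; rw [deriv_const_mul_field]; ring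
    simp_rw [this]
    rw [integral_const_mul]
    calc _ ≤ (N⁻¹) ^ 2 * N ^ 2 := by gcongr
      _ = 1 := by field_simp
  have h2 := ofReal_abs_integral_le_hNegOneNorm (f := f) hψ h1
  have h3 : ∫ x in Ioo 0 c, f x * φ x = N * ∫ x in Ioo 0 c, f x * (N⁻¹ * φ x) := by
    rw [← integral_const_mul]
    congr 1; funext x; field_simp
  rw [h3, abs_mul, ENNReal.ofReal_mul (abs_nonneg _), abs_of_pos hN]
  gcongr

/-- The derivative of the cutoff has size at most `n * C` and lives on a time interval of length at
most 2 / n, so the bound does not depend on `n`. -/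
theorem integral_cutoff_le {F : ℝ × ℝ → ℝ} (hF : Integrable F) {C n η : ℝ} (hn : 0 < n)
    (hC : ∀ s, |deriv Real.smoothTransition s| ≤ C) (hη : 0 ≤ η)
    (h : ∀ᵐ t, t ∈ Ioo 0 (2 / n) → |∫ x, F (t, x)| ≤ η) :
    |∫ p, F p * dt (cutoff n) p| ≤ 2 * C * η := by
  have hdt : ∀ p : ℝ × ℝ, dt (cutoff n) p = n * deriv Real.smoothTransition (n * p.1 - 1) := by
    intro p; rw [dt, dirDeriv_cutoff]; simp
  have hb : ∀ s, |n * deriv Real.smoothTransition (n * s - 1)| ≤ n * C := by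
    intro s; rw [abs_mul, abs_of_pos hn]; exact mul_le_mul_of_nonneg_left (hC _) hn.le
  have hcont : Continuous (deriv Real.smoothTransition) :=
    (Real.smoothTransition.contDiff (n := 1)).continuous_deriv le_rfl
  have hint : Integrable (fun p : ℝ × ℝ => F p * dt (cutoff n) p) := by
    refine hF.mul_bdd (c := n * C) ?_ (Eventually.of_forall fun p => ?_)
    · rw [show dt (cutoff n) = fun p => _ from funext hdt]
      exact (Continuous.aestronglyMeasurable (by fun_prop))
    · rw [hdt]; exact hb _
  rw [show (volume : Measure (ℝ × ℝ)) = (volume : Measure ℝ).prod volume from rfl] at hint ⊢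
  rw [integral_prod _ hint]
  have e1 : ∀ t : ℝ, ∫ x, F (t, x) * dt (cutoff n) (t, x)
      = (∫ x, F (t, x)) * (n * deriv Real.smoothTransition (n * t - 1)) := by
    intro t; simp_rw [hdt]; rw [integral_mul_const]
  simp_rw [e1]
  have e2 : ∀ t : ℝ, t ∉ Ioo 0 (2 / n) → t ≠ 2 / n →
      (∫ x, F (t, x)) * (n * deriv Real.smoothTransition (n * t - 1)) = 0 := by
    intro t ht ht'
    rw [deriv_smoothTransition_eq_zero]
    · simp
    · rintro ⟨h1, h2⟩
      apply ht
      have h3 : t ≤ 2 / n := by rw [le_div_iff₀ hn]; linarith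
      refine ⟨?_, lt_of_le_of_ne h3 ht'⟩
      by_contra h4
      push Not at h4
      nlinarith
  have e3 : ∫ t, (∫ x, F (t, x)) * (n * deriv Real.smoothTransition (n * t - 1))
      = ∫ t in Ioo 0 (2 / n), (∫ x, F (t, x)) * (n * deriv Real.smoothTransition (n * t - 1)) := by
    symm
    rw [setIntegral_eq_integral_of_ae_compl_eq_zero]
    have : ∀ᵐ t : ℝ, t ≠ 2 / n := by simp [ae_iff, measure_singleton]
    filter_upwards [this] with t ht ht'
    exact e2 t ht' ht
  rw [e3, ← Real.norm_eq_abs]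
  calc _ ≤ (η * (n * C)) * volume.real (Ioo 0 (2 / n)) := by
        refine norm_setIntegral_le_of_norm_le_const_ae (by simp) ?_
        rw [ae_restrict_iff' measurableSet_Ioo]
        filter_upwards [h] with t ht hmem
        rw [norm_mul]
        exact mul_le_mul (ht hmem) (hb t) (norm_nonneg _) hη
    _ = 2 * C * η := by
        rw [Real.volume_real_Ioo_of_le (by positivity)]
        field_simp
        ring

/-- The test function need not vanish at t = 0. The terms created by the time cutoff are averages
over times in (0, 2 / n) of slices of v - v' and v_t - v'_t, which are small in L² and in H⁻¹
because the initial data coincide. -/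
theorem IsSolution.weak_form_sub (hl : IsFront l) {g' : ℝ → ℝ} {v' : ℝ × ℝ → ℝ}
    (hf₀ : MemLp f₀ 2 (volume.restrict (Ioo 0 (l 0))))
    (hf₁ : MemLp f₁ 2 (volume.restrict (Ioo 0 (l 0))))
    (h : IsSolution 0 b l g f₀ f₁ v) (h' : IsSolution 0 b l g' f₀ f₁ v')
    {φ : ℝ × ℝ → ℝ} (hφ : IsTest (OmegaExt l) φ) :
    ∫ p in Omega l, (v p - v' p) * (dt (dt φ) p - dx (dx φ) p + b * φ p) = 0 := by
  obtain ⟨vt, hvt, hlim⟩ := h.initial_velocity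
  obtain ⟨vt', hvt', hlim'⟩ := h'.initial_velocity
  obtain ⟨m, hm0, hmK, hm⟩ := hφ.exists_time_bound hl
  obtain ⟨Cθ, hCθ0, hCθ⟩ := exists_bound_deriv_smoothTransition
  have hφt : IsTest (OmegaExt l) (dt φ) := hφ.dirDeriv ((1:ℝ), (0:ℝ))
  have hφx : IsTest (OmegaExt l) (dx φ) := hφ.dirDeriv ((0:ℝ), (1:ℝ))
  have hOm := hl.isOpen_Omega.measurableSet
  -- a time after which the test function vanishes
  obtain ⟨T, hT0, hT⟩ : ∃ T > 0, ∀ p ∈ tsupport φ, p.1 < T := by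
    obtain ⟨T, hT⟩ := (hφ.2.1.image continuous_fst).bddAbove
    exact ⟨max T 0 + 1, by positivity, fun p hp =>
      lt_of_le_of_lt ((hT ⟨p, hp, rfl⟩).trans (le_max_left _ _)) (lt_add_one _)⟩
  have hint : ∀ {w ψ : ℝ × ℝ → ℝ}, MemLp w 2 (volume.restrict (OmegaT l T)) →
      IsTest (OmegaExt l) ψ → tsupport ψ ⊆ tsupport φ →
      IntegrableOn (fun p => w p * ψ p) (Omega l) := by
    intro w ψ hw hψ hsub
    have : IntegrableOn (fun p => w p * ψ p) (OmegaT l T) := hw.integrable_mul (hψ.memLp 2 _)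
    refine this.of_forall_sdiff_eq_zero hOm fun p hp => ?_
    have : ψ p = 0 := by
      apply image_eq_zero_of_notMem_tsupport
      exact fun hp' => hp.2 ⟨hp.1, hT p (hsub hp')⟩
    simp [this]
  have hv2 := (h.memH1 T hT0).1
  have hv2' := (h'.memH1 T hT0).1
  have hsubt : tsupport (dt φ) ⊆ tsupport φ := tsupport_fderiv_apply_subset ℝ _
  have hsubx : tsupport (dx φ) ⊆ tsupport φ := tsupport_fderiv_apply_subset ℝ _
  have hsubtt : tsupport (dt (dt φ)) ⊆ tsupport φ := (tsupport_fderiv_apply_subset ℝ _).trans hsubt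
  have hsubxx : tsupport (dx (dx φ)) ⊆ tsupport φ := (tsupport_fderiv_apply_subset ℝ _).trans hsubx
  set P : ℝ × ℝ → ℝ := fun p => dt (dt φ) p - dx (dx φ) p + b * φ p with hP
  have hPint : ∀ {w : ℝ × ℝ → ℝ}, MemLp w 2 (volume.restrict (OmegaT l T)) →
      IntegrableOn (fun p => w p * P p) (Omega l) := by
    intro w hw
    refine (((hint hw (hφt.dirDeriv (1, 0)) hsubtt).sub
      (hint hw (hφx.dirDeriv (0, 1)) hsubxx)).add
        ((hint hw hφ le_rfl).const_mul b)).congr_fun_ae (Eventually.of_forall fun p => ?_)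
    simp only [Pi.add_apply, Pi.sub_apply, hP, dt, dx]; ring
  -- the integrands extended by zero
  set F : ℝ × ℝ → ℝ := (Omega l).indicator (fun p => (v p - v' p) * dt φ p) with hF
  set G : ℝ × ℝ → ℝ := (Omega l).indicator (fun p => (vt p - vt' p) * φ p) with hG
  have hFint : Integrable F :=
    (integrable_indicator_iff hOm).2 (hint (hv2.sub hv2') hφt hsubt)
  have hGint : Integrable G :=
    (integrable_indicator_iff hOm).2 (hint ((h.memLp_weakDeriv hl hvt hT0).sub
      (h'.memLp_weakDeriv hl hvt' hT0)) hφ le_rfl)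
  have hident : ∀ n : ℝ, 0 < n → ∫ p in Omega l, (v p - v' p) * P p * cutoff n p
      = -(∫ p, F p * dt (cutoff n) p) + ∫ p, G p * dt (cutoff n) p := by
    intro n hn
    have hcb : ∀ p, ‖cutoff n p‖ ≤ 1 := fun p => by
      rw [Real.norm_eq_abs, cutoff, abs_of_nonneg (Real.smoothTransition.nonneg _)]
      exact Real.smoothTransition.le_one _
    have hdc : Continuous (dt (cutoff n)) :=
      ((contDiff_cutoff n).continuous_fderiv (by simp)).clm_apply continuous_const
    have hdb : ∀ p, ‖dt (cutoff n) p‖ ≤ n * Cθ := by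
      intro p; rw [dt, dirDeriv_cutoff]; simp only [mul_one, norm_mul, Real.norm_eq_abs,
        abs_of_pos hn]
      exact mul_le_mul_of_nonneg_left (hCθ _) hn.le
    have i1 : ∀ {w : ℝ × ℝ → ℝ}, MemLp w 2 (volume.restrict (OmegaT l T)) →
        IntegrableOn (fun p => w p * (cutoff n p * P p)) (Omega l) := fun hw => by
      refine ((hPint hw).mul_bdd (c := 1) (contDiff_cutoff n).continuous.aestronglyMeasurable
        (Eventually.of_forall hcb)).congr (Eventually.of_forall fun p => by dsimp; ring)
    have i2 : ∀ {w ψ : ℝ × ℝ → ℝ}, MemLp w 2 (volume.restrict (OmegaT l T)) →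
        IsTest (OmegaExt l) ψ → tsupport ψ ⊆ tsupport φ →
        IntegrableOn (fun p => w p * (dt (cutoff n) p * ψ p)) (Omega l) := fun hw hψ hs => by
      refine ((hint hw hψ hs).mul_bdd (c := n * Cθ) hdc.aestronglyMeasurable
        (Eventually.of_forall hdb)).congr (Eventually.of_forall fun p => by dsimp; ring)
    have e1 := h.cutoff_identity hl hvt hφ hn
    have e2 := h'.cutoff_identity hl hvt' hφ hn
    have a1 : ∫ p in Omega l, (v p - v' p) * P p * cutoff n p
        = (∫ p in Omega l, v p * (cutoff n p * P p)) - ∫ p in Omega l, v' p * (cutoff n p * P p) := by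
      rw [← integral_sub (i1 hv2) (i1 hv2')]
      congr 1; funext p; ring
    have a2 : ∫ p, F p * dt (cutoff n) p = (∫ p in Omega l, v p * (dt (cutoff n) p * dt φ p))
        - ∫ p in Omega l, v' p * (dt (cutoff n) p * dt φ p) := by
      rw [← integral_sub (i2 hv2 hφt hsubt) (i2 hv2' hφt hsubt), ← integral_indicator hOm]
      congr 1; funext p
      by_cases hp : p ∈ Omega l <;> simp [hF, hp, dt]; ring
    have a3 : ∫ p, G p * dt (cutoff n) p = (∫ p in Omega l, vt p * (dt (cutoff n) p * φ p))
        - ∫ p in Omega l, vt' p * (dt (cutoff n) p * φ p) := by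
      rw [← integral_sub (i2 (h.memLp_weakDeriv hl hvt hT0) hφ le_rfl)
        (i2 (h'.memLp_weakDeriv hl hvt' hT0) hφ le_rfl), ← integral_indicator hOm]
      congr 1; funext p
      by_cases hp : p ∈ Omega l <;> simp [hG, hp]; ring
    rw [a1, a2, a3, e1, e2]; ring
  have hsec : ∀ {t : ℝ}, t ∈ Ioo 0 m → ∀ {w ψ : ℝ × ℝ → ℝ}, tsupport ψ ⊆ tsupport φ →
      ∫ x, (Omega l).indicator (fun p => w p * ψ p) (t, x)
        = ∫ x in Ioo 0 (l 0), w (t, x) * ψ (t, x) := by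
    intro t ht w ψ hs
    rw [← integral_indicator measurableSet_Ioo]
    congr 1; funext x
    by_cases hx : (t, x) ∈ tsupport φ
    · have hx1 : x ∈ Ioo 0 (l 0) := hmK _ hx ht.2
      have hx2 : (t, x) ∈ Omega l := ⟨ht.1, hx1.1, hx1.2.trans_le (hl.mono _ _ le_rfl ht.1.le)⟩
      simp [hx1, hx2]
    · have : ψ (t, x) = 0 := image_eq_zero_of_notMem_tsupport fun h => hx (hs h)
      simp [indicator, this]
  obtain ⟨C0, hC00, hC0⟩ := hφ.exists_bound
  obtain ⟨C1, hC10, hC1⟩ := hφx.exists_bound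
  obtain ⟨C2, hC20, hC2⟩ := hφt.exists_bound
  -- smallness of the error terms
  have hsmall : ∀ η : ℝ, 0 < η → ∃ δ > 0, ∀ᵐ t, t ∈ Ioo 0 δ →
      |∫ x, F (t, x)| ≤ η ∧ |∫ x, G (t, x)| ≤ η := by
    intro η hη
    rw [← eventually_zeroRightAE_iff]
    set ρ := volume.restrict (Ioo 0 (l 0)) with hρ
    -- Bounds the H¹ norm of every slice of φ: the squared norm is at most `N - 1`, hence at most `N
    -- ^ 2`.
    set N := l 0 * (C0 ^ 2 + C1 ^ 2) + 1 with hN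
    have hN0 : 1 ≤ N := by
      have := hl.pos
      rw [hN]; nlinarith [mul_nonneg this.le (by positivity : 0 ≤ C0 ^ 2 + C1 ^ 2)]
    set A := (ρ univ) ^ (2 : ℝ≥0∞).toReal⁻¹ * ENNReal.ofReal C2 with hA
    have hAtop : A ≠ ⊤ := by
      refine ENNReal.mul_ne_top (ENNReal.rpow_ne_top_of_nonneg (by positivity) ?_) ENNReal.ofReal_ne_top
      simp [hρ]
    have hF0 : Tendsto (fun t => (eLpNorm (fun x => v (t, x) - f₀ x) 2 ρ
        + eLpNorm (fun x => v' (t, x) - f₀ x) 2 ρ) * A) zeroRightAE (𝓝 0) := by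
      have := ENNReal.Tendsto.mul_const (h.initial_value.add h'.initial_value) (Or.inr hAtop)
      simpa using this
    have hG0 : Tendsto (fun t => ENNReal.ofReal N * hNegOneNorm (l 0) (fun x => vt (t, x) - f₁ x)
        + ENNReal.ofReal N * hNegOneNorm (l 0) (fun x => vt' (t, x) - f₁ x))
        zeroRightAE (𝓝 0) := by
      have := (ENNReal.Tendsto.const_mul (a := ENNReal.ofReal N) hlim (Or.inr ENNReal.ofReal_ne_top)).add
        (ENNReal.Tendsto.const_mul (a := ENNReal.ofReal N) hlim' (Or.inr ENNReal.ofReal_ne_top))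
      simpa using this
    have hη' : (0 : ℝ≥0∞) < ENNReal.ofReal η := ENNReal.ofReal_pos.2 hη
    have hsecvt := fun {u : ℝ × ℝ → ℝ} (hu : MemLp u 2 (volume.restrict (OmegaT l T))) =>
      eventually_zeroRightAE hT0 (Debonding.ae_memLp_section measurableSet_Ioo (hl.rect_subset T) hu)
    filter_upwards [hF0.eventually_lt_const hη', hG0.eventually_lt_const hη',
      h.ae_memLp_section hl, h'.ae_memLp_section hl, hsecvt (h.memLp_weakDeriv hl hvt hT0),
      hsecvt (h'.memLp_weakDeriv hl hvt' hT0),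
      eventually_zeroRightAE hm0 (Eventually.of_forall fun t ht => ht)] with t h1 h2 h3 h4 h5 h6 h7
    constructor
    · rw [hF, hsec (w := fun p => v p - v' p) h7 hsubt, ← ENNReal.ofReal_le_ofReal_iff hη.le]
      refine le_trans (ofReal_abs_integral_mul_le_eLpNorm (h3.sub h4).1
        (hφt.continuous.comp (by fun_prop : Continuous fun x : ℝ => (t, x))).aestronglyMeasurable)
        (le_trans ?_ h1.le)
      refine mul_le_mul' ?_ ?_
      · have : (fun x => v (t, x) - v' (t, x))
            = (fun x => v (t, x) - f₀ x) - fun x => v' (t, x) - f₀ x := by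
          funext x; simp
        rw [this]
        exact eLpNorm_sub_le (h3.sub hf₀).1 (h4.sub hf₀).1 (by norm_num)
      · exact eLpNorm_le_of_ae_bound (Eventually.of_forall fun x => hC2 _)
    · rw [hG, hsec (w := fun p => vt p - vt' p) h7 le_rfl, ← ENNReal.ofReal_le_ofReal_iff hη.le]
      have hφs := hm t h7.2
      have hφL : MemLp (fun x => φ (t, x)) 2 ρ := hφs.memLp _ _
      have e1 : ∫ x in Ioo 0 (l 0), (vt (t, x) - vt' (t, x)) * φ (t, x)
          = (∫ x in Ioo 0 (l 0), (vt (t, x) - f₁ x) * φ (t, x))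
            - ∫ x in Ioo 0 (l 0), (vt' (t, x) - f₁ x) * φ (t, x) := by
        have := integral_sub ((h5.sub hf₁).integrable_mul hφL) ((h6.sub hf₁).integrable_mul hφL)
        refine Eq.trans ?_ this
        congr 1; funext x; simp; ring
      have hder : ∀ x, deriv (fun x => φ (t, x)) x = dx φ (t, x) := by
        intro x
        have hd := (hφ.differentiable (t, x)).hasFDerivAt
        have hd2 : HasDerivAt (fun x : ℝ => (t, x)) ((0 : ℝ), (1 : ℝ)) x :=
          (hasDerivAt_const x t).prodMk (hasDerivAt_id x)
        exact (hd.comp_hasDerivAt x hd2).deriv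
      have hNb : ∫ x in Ioo 0 (l 0), (φ (t, x) ^ 2 + deriv (fun x => φ (t, x)) x ^ 2) ≤ N ^ 2 := by
        calc _ ≤ ∫ x in Ioo 0 (l 0), (C0 ^ 2 + C1 ^ 2) := by
              refine integral_mono_of_nonneg (Eventually.of_forall fun x => by positivity)
                (integrable_const _) (Eventually.of_forall fun x => ?_)
              simp only [hder]
              exact add_le_add (sq_le_sq.2 ((hC0 _).trans (le_abs_self _)))
                (sq_le_sq.2 ((hC1 _).trans (le_abs_self _)))
          _ = l 0 * (C0 ^ 2 + C1 ^ 2) := by simp [hl.pos.le]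
          _ ≤ N ^ 2 := by rw [hN] at hN0 ⊢; nlinarith
      rw [e1]
      calc _ ≤ ENNReal.ofReal (|∫ x in Ioo 0 (l 0), (vt (t, x) - f₁ x) * φ (t, x)|
            + |∫ x in Ioo 0 (l 0), (vt' (t, x) - f₁ x) * φ (t, x)|) :=
            ENNReal.ofReal_le_ofReal (abs_sub _ _)
        _ ≤ _ := ENNReal.ofReal_add_le
        _ ≤ _ := add_le_add
            (ofReal_abs_integral_le_mul_hNegOneNorm (by linarith) hφs hNb)
            (ofReal_abs_integral_le_mul_hNegOneNorm (by linarith) hφs hNb)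
        _ ≤ _ := h2.le
  have hlim1 : Tendsto (fun n : ℕ => ∫ p in Omega l, (v p - v' p) * P p * cutoff n p) atTop
      (𝓝 (∫ p in Omega l, (v p - v' p) * P p)) := by
    have hI := hPint (hv2.sub hv2')
    refine tendsto_integral_of_dominated_convergence (fun p => ‖(v p - v' p) * P p‖)
      (fun n => ?_) hI.norm (fun n => ?_) ?_
    · exact hI.1.mul (contDiff_cutoff n).continuous.aestronglyMeasurable
    · refine Eventually.of_forall fun p => ?_
      rw [norm_mul]
      refine mul_le_of_le_one_right (norm_nonneg _) ?_
      rw [Real.norm_eq_abs, cutoff, abs_of_nonneg (Real.smoothTransition.nonneg _)]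
      exact Real.smoothTransition.le_one _
    · filter_upwards [ae_restrict_mem hOm] with p hp
      refine tendsto_const_nhds.congr' ?_
      obtain ⟨N, hN⟩ := exists_nat_gt (2 / p.1)
      filter_upwards [eventually_ge_atTop N] with n hn
      have hp1 : 0 < p.1 := hp.1
      have : (N : ℝ) ≤ n := by exact_mod_cast hn
      rw [cutoff, Real.smoothTransition.one_of_one_le, mul_one]
      rw [div_lt_iff₀ hp1] at hN
      nlinarith
  have hlim2 : Tendsto (fun n : ℕ => ∫ p in Omega l, (v p - v' p) * P p * cutoff n p) atTop
      (𝓝 0) := by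
    rw [Metric.tendsto_atTop]
    intro ε hε
    -- Two error terms of size at most `2 * Cθ * η` each have to add up to less than ε; the `+ 1`
    -- allows `Cθ = 0`.
    obtain ⟨δ, hδ, hsm⟩ := hsmall (ε / (4 * Cθ + 1) / 2) (by positivity)
    obtain ⟨N, hN⟩ := exists_nat_gt (2 / δ)
    refine ⟨max N 1, fun n hn => ?_⟩
    have hn1 : (N : ℝ) ≤ n := by exact_mod_cast (le_max_left _ _).trans hn
    have hn0 : (0 : ℝ) < n := by
      exact_mod_cast lt_of_lt_of_le one_pos ((le_max_right N 1).trans hn)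
    have hn2 : 2 / (n : ℝ) ≤ δ := by
      rw [div_lt_iff₀ hδ] at hN
      rw [div_le_iff₀ hn0]; nlinarith
    rw [hident n hn0, dist_zero_right, Real.norm_eq_abs]
    have b1 := integral_cutoff_le hFint (η := ε / (4 * Cθ + 1) / 2) hn0 hCθ (by positivity)
      (by filter_upwards [hsm] with t ht ht' using (ht ⟨ht'.1, ht'.2.trans_le hn2⟩).1)
    have b2 := integral_cutoff_le hGint (η := ε / (4 * Cθ + 1) / 2) hn0 hCθ (by positivity)
      (by filter_upwards [hsm] with t ht ht' using (ht ⟨ht'.1, ht'.2.trans_le hn2⟩).2)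
    calc _ ≤ |∫ p, F p * dt (cutoff n) p| + |∫ p, G p * dt (cutoff n) p| := by
          rw [neg_add_eq_sub, abs_sub_comm]; exact abs_sub _ _
      _ ≤ 2 * (2 * Cθ * (ε / (4 * Cθ + 1) / 2)) := by linarith
      _ < ε := by
          have : (0:ℝ) < 4 * Cθ + 1 := by positivity
          rw [show 2 * (2 * Cθ * (ε / (4 * Cθ + 1) / 2)) = ε * (2 * Cθ / (4 * Cθ + 1)) by
            field_simp]
          refine mul_lt_of_lt_one_right hε ?_
          rw [div_lt_one this]; linarith
  exact tendsto_nhds_unique hlim1 hlim2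

end ZeroExtension

/-! ### The parallelogram identity for mixed derivatives. -/

section DoubleTranslation

variable {u φ : ℝ × ℝ → ℝ} {U V : Set (ℝ × ℝ)} {e e' : ℝ × ℝ} {h k κ : ℝ}

theorem integral_mixed_deriv (hφ : IsTest U φ) (hh : 0 ≤ h) (hk : 0 ≤ k) (p : ℝ × ℝ) :
    ∫ c in Ioc 0 h ×ˢ Ioc 0 k, dirDeriv e' (dirDeriv e φ) (p - (c.1 • e + c.2 • e'))
      = φ (p - (h • e + k • e')) - φ (p - h • e) - φ (p - k • e') + φ p := by
  have hφe := hφ.dirDeriv e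
  have hline : ∀ {ψ : ℝ × ℝ → ℝ} (_ : IsTest U ψ) (q f : ℝ × ℝ) (s : ℝ),
      HasDerivAt (fun s : ℝ => ψ (q - s • f)) (-(dirDeriv f ψ (q - s • f))) s := by
    intro ψ hψ q f s
    have h1 : HasDerivAt (fun s : ℝ => q - s • f) (-f) s := by
      simpa using ((hasDerivAt_id s).smul_const f).const_sub q
    have := (hψ.differentiable (q - s • f)).hasFDerivAt.comp_hasDerivAt s h1
    simp only [map_neg] at this
    exact this
  have hcont : Continuous (fun c : ℝ × ℝ => dirDeriv e' (dirDeriv e φ)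
      (p - (c.1 • e + c.2 • e'))) := (hφe.dirDeriv e').continuous.comp (by fun_prop)
  have hint : IntegrableOn (fun c : ℝ × ℝ => dirDeriv e' (dirDeriv e φ)
      (p - (c.1 • e + c.2 • e'))) (Ioc 0 h ×ˢ Ioc 0 k) (volume.prod volume) :=
    (hcont.continuousOn.integrableOn_compact (isCompact_Icc.prod isCompact_Icc)).mono_set
      (prod_mono Ioc_subset_Icc_self Ioc_subset_Icc_self)
  rw [show (volume : Measure (ℝ × ℝ)) = (volume : Measure ℝ).prod volume from rfl,
    setIntegral_prod _ hint]
  have inner : ∀ a : ℝ, ∫ b in Ioc 0 k, dirDeriv e' (dirDeriv e φ) (p - (a • e + b • e'))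
      = dirDeriv e φ (p - a • e) - dirDeriv e φ (p - k • e' - a • e) := by
    intro a
    rw [← intervalIntegral.integral_of_le hk]
    have := intervalIntegral.integral_eq_sub_of_hasDerivAt
      (fun b _ => hline hφe (p - a • e) e' b) (a := 0) (b := k)
      (Continuous.intervalIntegrable (((hφe.dirDeriv e').continuous.comp (by fun_prop)).neg) _ _)
    rw [intervalIntegral.integral_neg] at this
    simp only [zero_smul, sub_zero] at this
    rw [sub_right_comm p (k • e')]
    rw [← neg_sub, ← this, neg_neg]
    congr 1; funext b; rw [sub_sub]
  simp only [inner]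
  rw [← intervalIntegral.integral_of_le hh]
  have J : ∀ q : ℝ × ℝ, ∫ a in (0:ℝ)..h, dirDeriv e φ (q - a • e) = φ q - φ (q - h • e) := by
    intro q
    have := intervalIntegral.integral_eq_sub_of_hasDerivAt
      (fun b _ => hline hφ q e b) (a := 0) (b := h)
      (Continuous.intervalIntegrable ((hφe.continuous.comp (by fun_prop)).neg) _ _)
    rw [intervalIntegral.integral_neg] at this
    simp only [zero_smul, sub_zero] at this
    linarith
  rw [intervalIntegral.integral_sub, J, J]
  · rw [sub_sub p (k • e'), add_comm (k • e')]; ring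
  · exact Continuous.intervalIntegrable (hφe.continuous.comp (by fun_prop)) _ _
  · exact Continuous.intervalIntegrable (hφe.continuous.comp (by fun_prop)) _ _

theorem IsTest.comp_sub (hφ : IsTest V φ) (c : ℝ × ℝ) (hVU : ∀ p ∈ V, p + c ∈ U) :
    IsTest U (fun p => φ (p - c)) := by
  have hsupp : tsupport (fun p => φ (p - c)) ⊆ (fun p => p - c) ⁻¹' tsupport φ :=
    tsupport_comp_subset_preimage φ (f := fun p => p - c) (by fun_prop)
  refine ⟨hφ.1.comp (by fun_prop), ?_, fun p hp => ?_⟩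
  · exact hφ.2.1.comp_homeomorph (Homeomorph.subRight c)
  · have := hVU _ (hφ.2.2 (hsupp hp))
    simpa using this

theorem dirDeriv_comp_sub (f : ℝ × ℝ) (c : ℝ × ℝ) :
    dirDeriv f (fun p => φ (p - c)) = fun p => dirDeriv f φ (p - c) := by
  funext p
  simp only [dirDeriv]
  rw [fderiv_comp_sub]

/-- Justifies Fubini below: for all shifts in the rectangle, the supports of the shifted test
functions stay in one compact set. -/
theorem integrable_shift_mul (hum : Measurable u) (hu : LocallyIntegrable u)
    {ψ : ℝ × ℝ → ℝ} (hψ : IsTest U ψ) (h k : ℝ) (e e' : ℝ × ℝ) :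
    Integrable (fun q : (ℝ × ℝ) × (ℝ × ℝ) => u q.1 * ψ (q.1 - (q.2.1 • e + q.2.2 • e')))
      (volume.prod (volume.restrict (Ioc 0 h ×ˢ Ioc 0 k))) := by
  set K : Set (ℝ × ℝ) := (fun q : (ℝ × ℝ) × (ℝ × ℝ) => q.1 + (q.2.1 • e + q.2.2 • e')) ''
    (tsupport ψ ×ˢ (Icc 0 h ×ˢ Icc 0 k)) with hK
  have hKc : IsCompact K :=
    (IsCompact.prod hψ.2.1 (isCompact_Icc.prod isCompact_Icc)).image (by fun_prop)
  obtain ⟨C, hC0, hC⟩ := hψ.exists_bound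
  have hdom : Integrable (fun q : (ℝ × ℝ) × (ℝ × ℝ) => K.indicator (fun p => ‖u p‖) q.1 * C)
      (volume.prod (volume.restrict (Ioc 0 h ×ˢ Ioc 0 k))) := by
    have h1 : Integrable (K.indicator (fun p => ‖u p‖)) :=
      (integrable_indicator_iff hKc.measurableSet).2 (hu.integrableOn_isCompact hKc).norm
    have : IsFiniteMeasure ((volume : Measure (ℝ × ℝ)).restrict (Ioc 0 h ×ˢ Ioc 0 k)) := by
      refine isFiniteMeasure_restrict.2 (ne_top_of_le_ne_top ?_ (measure_mono
        (prod_mono Ioc_subset_Icc_self Ioc_subset_Icc_self)))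
      exact (isCompact_Icc.prod isCompact_Icc).measure_lt_top.ne
    exact h1.mul_prod (integrable_const C)
  refine hdom.mono' ?_ ?_
  · have : Measurable (fun q : (ℝ × ℝ) × (ℝ × ℝ) => u q.1 * ψ (q.1 - (q.2.1 • e + q.2.2 • e'))) :=
      (hum.comp measurable_fst).mul (hψ.continuous.comp (by fun_prop)).measurable
    exact this.aestronglyMeasurable
  · have hS : MeasurableSet (Ioc (0:ℝ) h ×ˢ Ioc (0:ℝ) k) := measurableSet_Ioc.prod measurableSet_Ioc
    filter_upwards [Measure.quasiMeasurePreserving_snd.ae (ae_restrict_mem hS)] with q hq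
    by_cases hq1 : q.1 - (q.2.1 • e + q.2.2 • e') ∈ tsupport ψ
    · have : q.1 ∈ K := ⟨(q.1 - (q.2.1 • e + q.2.2 • e'), q.2),
        ⟨hq1, prod_mono Ioc_subset_Icc_self Ioc_subset_Icc_self hq⟩, by simp⟩
      rw [norm_mul, indicator_of_mem this]
      exact mul_le_mul_of_nonneg_left (hC _) (norm_nonneg _)
    · rw [image_eq_zero_of_notMem_tsupport hq1, mul_zero, norm_zero]
      exact mul_nonneg (indicator_nonneg (fun _ _ => norm_nonneg _) _) hC0

theorem integral_sub_sub_add {α : Type*} [MeasurableSpace α] {μ : Measure α} {A B C D : α → ℝ}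
    (hA : Integrable A μ) (hB : Integrable B μ) (hC : Integrable C μ) (hD : Integrable D μ) :
    ∫ p, (A p - B p - C p + D p) ∂μ
      = (∫ p, A p ∂μ) - (∫ p, B p ∂μ) - (∫ p, C p ∂μ) + ∫ p, D p ∂μ := by
  rw [integral_add (f := fun p => A p - B p - C p) ((hA.sub hB).sub hC) hD,
    integral_sub (f := fun p => A p - B p) (hA.sub hB) hC, integral_sub hA hB]

/-- The mixed derivative is integrated on the side of the test function: averaging the equation over
all shifts of φ in the rectangle, the fundamental theorem of calculus turns the mixed derivative of
φ into its four-corner sum. Translations are then moved back to `u` and φ is removed. The points of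
`V` are those whose whole parallelogram lies in `U`. -/
theorem ae_double_translation (hum : Measurable u) (hu : LocallyIntegrable u)
    (hU : ∀ φ, IsTest U φ → ∫ p, u p * dirDeriv e' (dirDeriv e φ) p = κ * ∫ p, u p * φ p)
    (hh : 0 ≤ h) (hk : 0 ≤ k) (hV : IsOpen V)
    (hVU : ∀ p ∈ V, ∀ a ∈ Icc 0 h, ∀ b ∈ Icc 0 k, p + (a • e + b • e') ∈ U) :
    ∀ᵐ p, p ∈ V → u (p + (h • e + k • e')) - u (p + h • e) - u (p + k • e') + u p
      = κ * ∫ c in Ioc 0 h ×ˢ Ioc 0 k, u (p + (c.1 • e + c.2 • e')) := by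
  set ν := (volume : Measure (ℝ × ℝ)).restrict (Ioc 0 h ×ˢ Ioc 0 k) with hν
  have hS : MeasurableSet (Ioc (0:ℝ) h ×ˢ Ioc (0:ℝ) k) := measurableSet_Ioc.prod measurableSet_Ioc
  have : IsFiniteMeasure ν := by
    refine isFiniteMeasure_restrict.2 (ne_top_of_le_ne_top ?_ (measure_mono
      (prod_mono Ioc_subset_Icc_self Ioc_subset_Icc_self)))
    exact (isCompact_Icc.prod isCompact_Icc).measure_lt_top.ne
  have hsh : ∀ c : ℝ × ℝ, LocallyIntegrable (fun p => u (p + c)) := fun c =>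
    (locallyIntegrable_map_homeomorph (Homeomorph.addRight c) (f := u) (μ := volume)).1 (by
      rw [Homeomorph.coe_addRight, map_add_right_eq_self]; exact hu)
  -- local integrability of the averaged function
  have hprodK : ∀ K : Set (ℝ × ℝ), IsCompact K → Integrable
      (fun q : (ℝ × ℝ) × (ℝ × ℝ) => u (q.1 + (q.2.1 • e + q.2.2 • e')))
      ((volume.restrict K).prod ν) := by
    intro K hK
    have hKc : IsCompact ((fun q : (ℝ × ℝ) × (ℝ × ℝ) => q.1 + (q.2.1 • e + q.2.2 • e')) ''
      (K ×ˢ (Icc 0 h ×ˢ Icc 0 k))) :=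
      (IsCompact.prod hK (isCompact_Icc.prod isCompact_Icc)).image (by fun_prop)
    set K' := ((fun q : (ℝ × ℝ) × (ℝ × ℝ) => q.1 + (q.2.1 • e + q.2.2 • e')) ''
      (K ×ˢ (Icc 0 h ×ˢ Icc 0 k))) with hK'
    have hmeas : Measurable (fun q : (ℝ × ℝ) × (ℝ × ℝ) => u (q.1 + (q.2.1 • e + q.2.2 • e'))) :=
      hum.comp (by fun_prop)
    refine ⟨hmeas.aestronglyMeasurable, ?_⟩
    rw [HasFiniteIntegral, lintegral_prod_symm' _ hmeas.enorm]
    calc _ ≤ ∫⁻ _, (∫⁻ p in K', ‖u p‖ₑ) ∂ν := by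
          refine lintegral_mono_ae ?_
          filter_upwards [ae_restrict_mem hS] with c hc
          rw [← lintegral_indicator hK.measurableSet, ← lintegral_indicator hKc.measurableSet,
            ← lintegral_add_right_eq_self (K'.indicator _) (c.1 • e + c.2 • e')]
          refine lintegral_mono fun p => ?_
          by_cases hp : p ∈ K
          · have : p + (c.1 • e + c.2 • e') ∈ K' := ⟨(p, c), ⟨hp,
              prod_mono Ioc_subset_Icc_self Ioc_subset_Icc_self hc⟩, rfl⟩
            simp [hp, this]
          · simp [hp]
      _ < ⊤ := by
          rw [lintegral_const]
          exact ENNReal.mul_lt_top (hu.integrableOn_isCompact hKc).2 (measure_lt_top _ _)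
  have hSloc : LocallyIntegrable (fun p => ∫ c, u (p + (c.1 • e + c.2 • e')) ∂ν) := by
    rw [locallyIntegrable_iff]
    exact fun K hK => (hprodK K hK).integral_prod_left
  have hDloc : LocallyIntegrable (fun p => u (p + (h • e + k • e')) - u (p + h • e) - u (p + k • e')
      + u p - κ * ∫ c, u (p + (c.1 • e + c.2 • e')) ∂ν) :=
    ((((hsh _).sub (hsh _)).sub (hsh _)).add hu).sub (hSloc.smul κ)
  have hkey := hV.ae_eq_zero_of_integral_contDiff_smul_eq_zero (μ := volume)
    (hDloc.locallyIntegrableOn V) (fun φ h1 h2 h3 => ?_)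
  · filter_upwards [hkey] with p hp hpV
    exact sub_eq_zero.1 (hp hpV)
  have hφ : IsTest V φ := ⟨h1, h2, h3⟩
  have shiftInt : ∀ (c : ℝ × ℝ), ∫ p, u (p + c) * φ p = ∫ p, u p * φ (p - c) := by
    intro c
    rw [← integral_add_right_eq_self (fun p => u p * φ (p - c)) c]
    simp
  have intu : ∀ c : ℝ × ℝ, Integrable (fun p => u (p + c) * φ p) := fun c =>
    integrable_mul_test ((hsh c).locallyIntegrableOn V) hφ
  have intu' : ∀ c : ℝ × ℝ, Integrable (fun p => u p * φ (p - c)) := fun c =>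
    integrable_mul_test (U := univ) (hu.locallyIntegrableOn _) (hφ.comp_sub c (by simp))
  have intS : Integrable (fun p => (∫ c, u (p + (c.1 • e + c.2 • e')) ∂ν) * φ p) :=
    integrable_mul_test (hSloc.locallyIntegrableOn V) hφ
  have e1 : ∫ p, φ p • (u (p + (h • e + k • e')) - u (p + h • e) - u (p + k • e')
      + u p - κ * ∫ c, u (p + (c.1 • e + c.2 • e')) ∂ν)
      = (∫ p, u p * (φ (p - (h • e + k • e')) - φ (p - h • e) - φ (p - k • e') + φ p))
        - κ * ∫ p, (∫ c, u (p + (c.1 • e + c.2 • e')) ∂ν) * φ p := by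
    have i0 : Integrable (fun p => u p * φ p) := by simpa using intu' 0
    have l1 : ∫ p, u p * (φ (p - (h • e + k • e')) - φ (p - h • e) - φ (p - k • e') + φ p)
        = (∫ p, u p * φ (p - (h • e + k • e'))) - (∫ p, u p * φ (p - h • e))
          - (∫ p, u p * φ (p - k • e')) + ∫ p, u p * φ p := by
      rw [← integral_sub_sub_add (intu' _) (intu' _) (intu' _) i0]
      congr 1; funext p; ring
    rw [l1, ← shiftInt, ← shiftInt, ← shiftInt, ← integral_const_mul,
      ← integral_sub_sub_add (intu _) (intu _) (intu _) i0]
    refine Eq.trans ?_ (integral_sub (((((intu (h • e + k • e')).sub (intu (h • e))).sub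
      (intu (k • e'))).add i0)) (intS.const_mul κ))
    congr 1; funext p; simp only [smul_eq_mul]; ring
  rw [e1, sub_eq_zero]
  have hφU : IsTest univ φ := hφ.mono (subset_univ _)
  calc ∫ p, u p * (φ (p - (h • e + k • e')) - φ (p - h • e) - φ (p - k • e') + φ p)
      = ∫ p, ∫ c : ℝ × ℝ, u p * dirDeriv e' (dirDeriv e φ) (p - (c.1 • e + c.2 • e')) ∂ν := by
        congr 1; funext p
        rw [integral_const_mul, integral_mixed_deriv hφ hh hk]
    _ = ∫ c : ℝ × ℝ, (∫ p, u p * dirDeriv e' (dirDeriv e φ) (p - (c.1 • e + c.2 • e'))) ∂ν :=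
        integral_integral_swap
          (integrable_shift_mul hum hu ((hφU.dirDeriv e).dirDeriv e') h k e e')
    _ = ∫ c : ℝ × ℝ, κ * (∫ p, u p * φ (p - (c.1 • e + c.2 • e'))) ∂ν := by
        refine integral_congr_ae ?_
        filter_upwards [ae_restrict_mem hS] with c hc
        have ht : IsTest U (fun p => φ (p - (c.1 • e + c.2 • e'))) :=
          hφ.comp_sub _ fun p hp => hVU p hp _ (Ioc_subset_Icc_self hc.1) _
            (Ioc_subset_Icc_self hc.2)
        rw [← hU _ ht, dirDeriv_comp_sub, dirDeriv_comp_sub]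
    _ = κ * ∫ p, ∫ c : ℝ × ℝ, u p * φ (p - (c.1 • e + c.2 • e')) ∂ν := by
        rw [integral_const_mul, ← integral_integral_swap (integrable_shift_mul hum hu hφU h k e e')]
    _ = κ * ∫ c : ℝ × ℝ, (∫ p, u (p + (c.1 • e + c.2 • e')) * φ p) ∂ν := by
        rw [integral_integral_swap (integrable_shift_mul hum hu hφU h k e e')]
        simp_rw [shiftInt]
    _ = κ * ∫ p, (∫ c, u (p + (c.1 • e + c.2 • e')) ∂ν) * φ p := by
        congr 1
        have : Integrable (fun q : (ℝ × ℝ) × (ℝ × ℝ) => u (q.1 + (q.2.1 • e + q.2.2 • e')) * φ q.1)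
            (volume.prod ν) := by
          have h0 := hprodK (tsupport φ) h2
          rw [← Measure.restrict_univ (μ := ν), Measure.prod_restrict] at h0
          obtain ⟨C, -, hC⟩ := hφ.exists_bound
          refine (integrableOn_iff_integrable_of_support_subset (s := tsupport φ ×ˢ univ) ?_).1
            (Integrable.mul_bdd (c := C) h0 ?_ (Eventually.of_forall fun q => hC q.1))
          · intro q hq
            refine ⟨?_, mem_univ _⟩
            by_contra hq'
            exact hq (by simp [image_eq_zero_of_notMem_tsupport hq'])
          · exact (hφ.continuous.comp continuous_fst).aestronglyMeasurable
        rw [← integral_integral_swap this]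
        simp_rw [integral_mul_const]

theorem lintegral_double_translation (hum : Measurable u) (hu : LocallyIntegrable u)
    (hU : ∀ φ, IsTest U φ → ∫ p, u p * dirDeriv e' (dirDeriv e φ) p = κ * ∫ p, u p * φ p)
    (hh : 0 ≤ h) (hk : 0 ≤ k) (hV : IsOpen V)
    (hVU : ∀ p ∈ V, ∀ a ∈ Icc 0 h, ∀ b ∈ Icc 0 k, p + (a • e + b • e') ∈ U) :
    ∫⁻ p in V, ‖u (p + h • e)‖ₑ ≤ (∫⁻ p in V, ‖u p‖ₑ) + (∫⁻ p in V, ‖u (p + k • e')‖ₑ)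
      + (∫⁻ p in V, ‖u (p + (h • e + k • e'))‖ₑ)
      + ‖κ‖ₑ * ∫⁻ c in Ioc 0 h ×ˢ Ioc 0 k, ∫⁻ p in V, ‖u (p + (c.1 • e + c.2 • e'))‖ₑ := by
  have hm : ∀ c : ℝ × ℝ, Measurable (fun p => ‖u (p + c)‖ₑ) := fun c =>
    (hum.comp (measurable_add_const c)).enorm
  have hmp : Measurable (fun q : (ℝ × ℝ) × (ℝ × ℝ) => ‖u (q.2 + (q.1.1 • e + q.1.2 • e'))‖ₑ) :=
    (hum.comp (by fun_prop)).enorm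
  have hsw : ∫⁻ c in Ioc 0 h ×ˢ Ioc 0 k, ∫⁻ p in V, ‖u (p + (c.1 • e + c.2 • e'))‖ₑ
      = ∫⁻ p in V, ∫⁻ c in Ioc 0 h ×ˢ Ioc 0 k, ‖u (p + (c.1 • e + c.2 • e'))‖ₑ :=
    lintegral_lintegral_swap hmp.aemeasurable
  have hmi : Measurable (fun p : ℝ × ℝ => ∫⁻ c in Ioc (0:ℝ) h ×ˢ Ioc (0:ℝ) k,
      ‖u (p + (c.1 • e + c.2 • e'))‖ₑ) :=
    Measurable.lintegral_prod_right' (f := fun q : (ℝ × ℝ) × (ℝ × ℝ) =>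
      ‖u (q.1 + (q.2.1 • e + q.2.2 • e'))‖ₑ) (hum.comp (by fun_prop)).enorm
  have hA : Measurable (fun p => ‖u p‖ₑ + ‖u (p + k • e')‖ₑ) := hum.enorm.add (hm _)
  have hB : Measurable (fun p => ‖u p‖ₑ + ‖u (p + k • e')‖ₑ + ‖u (p + (h • e + k • e'))‖ₑ) :=
    hA.add (hm _)
  rw [hsw, ← lintegral_const_mul _ hmi, ← lintegral_add_left hum.enorm,
    ← lintegral_add_left hA, ← lintegral_add_left hB]
  refine lintegral_mono_ae ?_
  rw [ae_restrict_iff' hV.measurableSet]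
  filter_upwards [ae_double_translation hum hu hU hh hk hV hVU] with p hp hpV
  have e1 : u (p + h • e) = u p - u (p + k • e') + u (p + (h • e + k • e'))
      - κ * ∫ c in Ioc 0 h ×ˢ Ioc 0 k, u (p + (c.1 • e + c.2 • e')) := by
    rw [← hp hpV]; ring
  rw [e1]
  refine (enorm_sub_le).trans (add_le_add ((enorm_add_le _ _).trans
    (add_le_add enorm_sub_le le_rfl)) ?_)
  rw [enorm_mul]
  gcongr
  exact enorm_integral_le_lintegral_enorm _

/-- By Tonelli, a point `q` is counted for the length of the part of its backward line along `e`
that lies in `S`. -/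
theorem lintegral_strip_swap {F : ℝ × ℝ → ℝ≥0∞} (hF : Measurable F) {S : Set (ℝ × ℝ)}
    (hS : MeasurableSet S) (H : ℝ) (e : ℝ × ℝ) :
    ∫⁻ a in Ioc 0 H, ∫⁻ p in S, F (p + a • e)
      = ∫⁻ q, F q * volume {a | a ∈ Ioc 0 H ∧ q - a • e ∈ S} := by
  have h1 : ∀ a : ℝ, ∫⁻ p in S, F (p + a • e) = ∫⁻ q, S.indicator 1 (q - a • e) * F q := by
    intro a
    rw [← lintegral_add_right_eq_self (fun q => S.indicator 1 (q - a • e) * F q) (a • e),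
      ← lintegral_indicator hS]
    refine lintegral_congr fun p => ?_
    by_cases hp : p ∈ S <;> simp [hp]
  simp_rw [h1]
  have hind : Measurable (S.indicator (1 : ℝ × ℝ → ℝ≥0∞)) := measurable_one.indicator hS
  rw [lintegral_lintegral_swap]
  · refine lintegral_congr fun q => ?_
    have hq : Measurable (fun a : ℝ => S.indicator (1 : ℝ × ℝ → ℝ≥0∞) (q - a • e)) :=
      hind.comp (by fun_prop)
    rw [lintegral_mul_const _ hq, mul_comm]
    congr 1
    have hms : MeasurableSet {a : ℝ | q - a • e ∈ S} :=
      (by fun_prop : Measurable (fun a : ℝ => q - a • e)) hS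
    have : ∀ a : ℝ, S.indicator (1 : ℝ × ℝ → ℝ≥0∞) (q - a • e)
        = {a : ℝ | q - a • e ∈ S}.indicator 1 a := by
      intro a; by_cases ha : q - a • e ∈ S <;> simp [ha]
    simp_rw [this]
    rw [lintegral_indicator_one hms, Measure.restrict_apply hms, inter_comm]
    rfl
  · have : Measurable (fun q : ℝ × (ℝ × ℝ) => S.indicator (1 : ℝ × ℝ → ℝ≥0∞) (q.2 - q.1 • e)) :=
      hind.comp (by fun_prop)
    exact (this.mul (hF.comp measurable_snd)).aemeasurable

end DoubleTranslation

/-! ### Transport of smallness from a strip along characteristics. -/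

section StripEstimates

variable {u φ : ℝ × ℝ → ℝ} {U V S R : Set (ℝ × ℝ)} {e e' : ℝ × ℝ} {H δ T₀ t₁ ε η κ : ℝ}

/-- `|u|` truncated at time `t₁`. -/
noncomputable def truncEnorm (u : ℝ × ℝ → ℝ) (t₁ : ℝ) : ℝ × ℝ → ℝ≥0∞ :=
  {p : ℝ × ℝ | p.1 < t₁}.indicator fun p => ‖u p‖ₑ

theorem measurable_truncEnorm (hum : Measurable u) (t₁ : ℝ) : Measurable (truncEnorm u t₁) :=
  hum.enorm.indicator (measurableSet_lt measurable_fst measurable_const)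

theorem lintegral_shift_eq_zero {μ : Measure (ℝ × ℝ)} (hμ : μ ≪ volume)
    (h0 : ∀ᵐ p : ℝ × ℝ, p.1 < T₀ → u p = 0) (c : ℝ × ℝ)
    (h : ∀ᵐ p ∂μ, p.1 + c.1 < T₀) : ∫⁻ p, ‖u (p + c)‖ₑ ∂μ = 0 := by
  rw [← lintegral_zero (μ := μ)]
  refine lintegral_congr_ae ?_
  have h1 : ∀ᵐ p : ℝ × ℝ, (p + c).1 < T₀ → u (p + c) = 0 :=
    (measurePreserving_add_right volume c).quasiMeasurePreserving.ae h0
  filter_upwards [h, hμ.ae_le h1] with p hp hp1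
  simp [hp1 hp]

/-- Since `e` advances and `e'` goes back in time at unit rate, the corners `p + δ • e'` and `p + (h
• e + δ • e')` lie before `T₀` as soon as `p.1 + h < T₀ + δ`. Only the starting corner `p` and the
double integral survive. -/
theorem restricted_translation_le (hum : Measurable u) (hu : LocallyIntegrable u)
    (hU : ∀ φ, IsTest U φ → ∫ p, u p * dirDeriv e' (dirDeriv e φ) p = κ * ∫ p, u p * φ p)
    (he : e.1 = 1) (he' : e'.1 = -1) (hδ : 0 ≤ δ)
    (h0 : ∀ᵐ p : ℝ × ℝ, p.1 < T₀ → u p = 0) (hS : IsOpen S) {h : ℝ} (hh : 0 ≤ h)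
    (hSU : ∀ p ∈ S, ∀ a ∈ Icc 0 h, ∀ b ∈ Icc 0 δ, p + (a • e + b • e') ∈ U) :
    ∫⁻ p in S, truncEnorm u (T₀ + δ) (p + h • e) ≤
      (∫⁻ p in S ∩ {p | p.1 + h < T₀ + δ}, ‖u p‖ₑ) + ‖κ‖ₑ * ∫⁻ c in Ioc 0 h ×ˢ Ioc 0 δ,
        ∫⁻ p in S, truncEnorm u (T₀ + δ) (p + (c.1 • e + c.2 • e')) := by
  have hVm : IsOpen {p : ℝ × ℝ | p.1 + h < T₀ + δ} :=
    isOpen_lt (continuous_fst.add continuous_const) continuous_const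
  have hV : IsOpen (S ∩ {p : ℝ × ℝ | p.1 + h < T₀ + δ}) := hS.inter hVm
  have e1 : ∫⁻ p in S, truncEnorm u (T₀ + δ) (p + h • e)
      = ∫⁻ p in S ∩ {p | p.1 + h < T₀ + δ}, ‖u (p + h • e)‖ₑ := by
    rw [inter_comm, ← Measure.restrict_restrict hVm.measurableSet,
      ← lintegral_indicator hVm.measurableSet]
    refine lintegral_congr fun p => ?_
    by_cases hp : p.1 + h < T₀ + δ
    · rw [truncEnorm, indicator_of_mem (by simpa [he] using hp),
        indicator_of_mem (show p ∈ {p : ℝ × ℝ | p.1 + h < T₀ + δ} from hp)]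
    · rw [truncEnorm, indicator_of_notMem (by simpa [he] using hp),
        indicator_of_notMem (show p ∉ {p : ℝ × ℝ | p.1 + h < T₀ + δ} from hp)]
  rw [e1]
  have hae : ∀ᵐ p ∂(volume.restrict (S ∩ {p : ℝ × ℝ | p.1 + h < T₀ + δ})),
      p.1 + h < T₀ + δ := by
    filter_upwards [ae_restrict_mem hV.measurableSet] with p hp using hp.2
  refine (lintegral_double_translation hum hu hU hh hδ hV
    fun p hp a ha b hb => hSU p hp.1 a ha b hb).trans ?_
  rw [lintegral_shift_eq_zero (u := u) Measure.absolutelyContinuous_restrict h0 (δ • e'),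
    lintegral_shift_eq_zero (u := u) Measure.absolutelyContinuous_restrict h0 (h • e + δ • e'),
    add_zero, add_zero]
  · refine add_le_add le_rfl ?_
    gcongr ‖κ‖ₑ * ?_
    refine setLIntegral_mono_ae' (measurableSet_Ioc.prod measurableSet_Ioc)
      (Eventually.of_forall fun c hc => ?_)
    rw [inter_comm, ← Measure.restrict_restrict hVm.measurableSet,
      ← lintegral_indicator hVm.measurableSet]
    refine lintegral_mono fun p => ?_
    refine indicator_apply_le' (fun hp => ?_) (fun _ => zero_le)
    have : p + (c.1 • e + c.2 • e') ∈ {p : ℝ × ℝ | p.1 < T₀ + δ} := by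
      have h1 := hc.1.2
      have h2 := hc.2.1
      simp only [mem_ofPred_eq] at hp
      simp [he, he']; linarith
    rw [truncEnorm, indicator_of_mem this]
  · filter_upwards [hae] with p hp
    simp [he, he']; linarith
  · filter_upwards [hae] with p hp
    simp [he']; linarith

/-- The transport inequality is averaged over `h ∈ (0, H]`. A backward characteristic spends at most
ε in the strip, and at least ε / 2 if it starts in `R`. The width ε therefore cancels, at the price
of the factor 2, and the bound is uniform in ε. -/
theorem strip_estimate (hum : Measurable u) (hu : LocallyIntegrable u)
    (hU : ∀ φ, IsTest U φ → ∫ p, u p * dirDeriv e' (dirDeriv e φ) p = κ * ∫ p, u p * φ p)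
    (he : e.1 = 1) (he' : e'.1 = -1) (hδ : 0 ≤ δ) (hε : 0 < ε)
    (h0 : ∀ᵐ p : ℝ × ℝ, p.1 < T₀ → u p = 0) (hS : IsOpen S)
    (hSU : ∀ p ∈ S, ∀ a ∈ Icc 0 H, ∀ b ∈ Icc 0 δ, p + (a • e + b • e') ∈ U)
    (hle : ∀ q, volume {a | a ∈ Ioc 0 H ∧ q - a • e ∈ S} ≤ ENNReal.ofReal ε)
    (hR : MeasurableSet R)
    (hge : ∀ q ∈ R, ENNReal.ofReal (ε / 2) ≤ volume {a | a ∈ Ioc 0 H ∧ q - a • e ∈ S})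
    (hη : ∫⁻ p in S, truncEnorm u (T₀ + δ) p ≤ ENNReal.ofReal ε * ENNReal.ofReal η) :
    ∫⁻ p in R, truncEnorm u (T₀ + δ) p ≤ 2 * (ENNReal.ofReal H * (ENNReal.ofReal η
      + ‖κ‖ₑ * (ENNReal.ofReal δ * ∫⁻ p, truncEnorm u (T₀ + δ) p))) := by
  set w := truncEnorm u (T₀ + δ) with hw
  have hwm : Measurable w := measurable_truncEnorm hum _
  set N := ∫⁻ p, w p with hN
  set Z := ∫⁻ c in Ioc 0 H ×ˢ Ioc 0 δ, ∫⁻ p in S, w (p + (c.1 • e + c.2 • e')) with hZ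
  -- The double integral is itself of order ε: for fixed `b`, every point is counted with weight at
  -- most ε.
  have hZle : Z ≤ ENNReal.ofReal δ * (ENNReal.ofReal ε * N) := by
    have hm : Measurable (fun c : ℝ × ℝ => ∫⁻ p in S, w (p + (c.1 • e + c.2 • e'))) :=
      Measurable.lintegral_prod_right' (f := fun q : (ℝ × ℝ) × (ℝ × ℝ) =>
        w (q.2 + (q.1.1 • e + q.1.2 • e'))) (hwm.comp (by fun_prop))
    have hpr : (volume : Measure (ℝ × ℝ)).restrict (Ioc 0 H ×ˢ Ioc 0 δ)
        = (volume.restrict (Ioc 0 H)).prod (volume.restrict (Ioc 0 δ)) := by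
      rw [Measure.prod_restrict]; rfl
    rw [hZ, hpr, lintegral_prod_symm' _ hm]
    have hb : ∀ b : ℝ, ∫⁻ a in Ioc 0 H, ∫⁻ p in S, w (p + (a • e + b • e'))
        ≤ ENNReal.ofReal ε * N := by
      intro b
      have h1 := lintegral_strip_swap (F := fun q => w (q + b • e'))
        (hwm.comp (measurable_add_const _)) hS.measurableSet H e
      simp only [add_assoc] at h1
      rw [h1]
      calc _ ≤ ∫⁻ q, ENNReal.ofReal ε * w (q + b • e') := by
            refine lintegral_mono fun q => ?_
            rw [mul_comm]
            exact mul_le_mul_left (hle q) _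
        _ = _ := by
            have hwb : Measurable (fun q => w (q + b • e')) := hwm.comp (measurable_add_const _)
            rw [lintegral_const_mul _ hwb, lintegral_add_right_eq_self]
    calc _ ≤ ∫⁻ b in Ioc 0 δ, ENNReal.ofReal ε * N := lintegral_mono fun b => hb b
      _ = _ := by rw [setLIntegral_const, Real.volume_Ioc, sub_zero, mul_comm]
  have hstep : ∀ h ∈ Ioc 0 H, ∫⁻ p in S, w (p + h • e)
      ≤ ENNReal.ofReal ε * ENNReal.ofReal η + ‖κ‖ₑ * Z := by
    intro h hh
    refine (restricted_translation_le hum hu hU he he' hδ h0 hS hh.1.le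
      fun p hp a ha b hb => hSU p hp a ⟨ha.1, ha.2.trans hh.2⟩ b hb).trans ?_
    refine add_le_add (le_trans ?_ hη) ?_
    · have hVm : MeasurableSet {p : ℝ × ℝ | p.1 + h < T₀ + δ} :=
        measurableSet_lt (measurable_fst.add_const h) measurable_const
      rw [inter_comm, ← Measure.restrict_restrict hVm, ← lintegral_indicator hVm]
      refine lintegral_mono fun p => indicator_apply_le' (fun hp => ?_) (fun _ => zero_le)
      have : p ∈ {p : ℝ × ℝ | p.1 < T₀ + δ} := by
        simp only [mem_ofPred_eq] at hp ⊢; linarith [hh.1]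
      rw [hw, truncEnorm, indicator_of_mem this]
    · gcongr ‖κ‖ₑ * ?_
      exact lintegral_mono_set (prod_mono (Ioc_subset_Ioc_right hh.2) le_rfl)
  have hA : ∫⁻ h in Ioc 0 H, ∫⁻ p in S, w (p + h • e)
      ≤ ENNReal.ofReal H * (ENNReal.ofReal ε * ENNReal.ofReal η + ‖κ‖ₑ * Z) := by
    calc _ ≤ ∫⁻ _ in Ioc 0 H, (ENNReal.ofReal ε * ENNReal.ofReal η + ‖κ‖ₑ * Z) :=
          setLIntegral_mono' measurableSet_Ioc hstep
      _ = _ := by rw [setLIntegral_const, Real.volume_Ioc, sub_zero, mul_comm]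
  rw [lintegral_strip_swap hwm hS.measurableSet] at hA
  have hB : ENNReal.ofReal (ε / 2) * ∫⁻ p in R, w p
      ≤ ∫⁻ q, w q * volume {a | a ∈ Ioc 0 H ∧ q - a • e ∈ S} := by
    rw [← lintegral_const_mul _ hwm, ← lintegral_indicator hR]
    refine lintegral_mono fun q => indicator_apply_le' (fun hq => ?_) (fun _ => zero_le)
    rw [mul_comm]
    exact mul_le_mul_right (hge q hq) _
  have hC : ENNReal.ofReal (ε / 2) * ∫⁻ p in R, w p ≤ ENNReal.ofReal (ε / 2) *
      (2 * (ENNReal.ofReal H * (ENNReal.ofReal η + ‖κ‖ₑ * (ENNReal.ofReal δ * N)))) := by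
    refine hB.trans (hA.trans ?_)
    have h2 : ENNReal.ofReal ε = ENNReal.ofReal (ε / 2) * 2 := by
      rw [show (2 : ℝ≥0∞) = ENNReal.ofReal 2 by simp, ← ENNReal.ofReal_mul (by positivity)]
      congr 1; ring
    calc _ ≤ ENNReal.ofReal H * (ENNReal.ofReal ε * ENNReal.ofReal η
          + ‖κ‖ₑ * (ENNReal.ofReal δ * (ENNReal.ofReal ε * N))) := by gcongr
      _ = _ := by rw [h2]; ring
  exact (ENNReal.mul_le_mul_iff_right (by simp; linarith) ENNReal.ofReal_ne_top).1 hC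

theorem dirDeriv_eq (φ : ℝ × ℝ → ℝ) (a b : ℝ) (p : ℝ × ℝ) :
    dirDeriv (a, b) φ p = a * dt φ p + b * dx φ p := by
  have : ((a, b) : ℝ × ℝ) = a • ((1 : ℝ), (0 : ℝ)) + b • ((0 : ℝ), (1 : ℝ)) := by simp
  simp only [dt, dx, dirDeriv]
  rw [this, map_add, map_smul, map_smul]; simp

theorem dirDeriv_comm {φ : ℝ × ℝ → ℝ} (hφ : ContDiff ℝ ∞ φ) (e f : ℝ × ℝ) (p : ℝ × ℝ) :
    dirDeriv e (dirDeriv f φ) p = dirDeriv f (dirDeriv e φ) p := by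
  have hd : DifferentiableAt ℝ (fderiv ℝ φ) p :=
    (hφ.fderiv_right (m := ∞) (by simp)).differentiable (by simp) p
  have key : ∀ e f : ℝ × ℝ, dirDeriv e (dirDeriv f φ) p = fderiv ℝ (fderiv ℝ φ) p e f := by
    intro e f
    unfold dirDeriv
    rw [fderiv_clm_apply hd (differentiableAt_const _)]
    simp
  rw [key, key]
  have hs : IsSymmSndFDerivAt ℝ φ p := by
    apply ContDiffAt.isSymmSndFDerivAt (n := ∞) hφ.contDiffAt
    rw [minSmoothness_of_isRCLikeNormedField]
    exact WithTop.coe_le_coe.2 le_top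
  exact hs e f

theorem dirDeriv_dirDeriv_eq (hφ : IsTest U φ) (a b c d : ℝ) (p : ℝ × ℝ) :
    dirDeriv (a, b) (dirDeriv (c, d) φ) p
      = a * c * dt (dt φ) p + (a * d + b * c) * dt (dx φ) p + b * d * dx (dx φ) p := by
  have h1 : dirDeriv (c, d) φ = fun p => c * dt φ p + d * dx φ p :=
    funext fun p => dirDeriv_eq φ c d p
  have hφt : Differentiable ℝ (dt φ) := (hφ.dirDeriv _).differentiable
  have hφx : Differentiable ℝ (dx φ) := (hφ.dirDeriv _).differentiable
  have h2 : dx (dt φ) p = dt (dx φ) p := dirDeriv_comm hφ.1 _ _ p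
  rw [h1, dirDeriv_add (hφt.const_mul c) (hφx.const_mul d), dirDeriv_const_mul c hφt,
    dirDeriv_const_mul d hφx]
  simp only [dirDeriv_eq]
  rw [h2]; ring

end StripEstimates

/-! ### Strips along the two lateral boundaries. -/

section Uniqueness

variable {l : ℝ → ℝ} {u : ℝ × ℝ → ℝ} {κ : ℝ}

/-- Going back along (1, -1), the distance `ext l p.1 - p.2` to the front decreases at a rate
between 1 and 2, since the front has slope in [0, 1]. The lower rate bounds the length spent in a
strip of width ε. -/
theorem IsFront.front_strip_le (hl : IsFront l) {ε : ℝ} (H : ℝ) (q : ℝ × ℝ) :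
    volume {a | a ∈ Ioc 0 H ∧ q - a • ((1 : ℝ), (-1 : ℝ)) ∈
      {p : ℝ × ℝ | ext l p.1 - ε < p.2 ∧ p.2 < ext l p.1}} ≤ ENNReal.ofReal ε := by
  refine (Real.volume_le_diam _).trans (Metric.ediam_le fun a ha b hb => ?_)
  rw [edist_dist]
  apply ENNReal.ofReal_le_ofReal
  have key : ∀ a b : ℝ, a ≤ b → (q - a • ((1 : ℝ), (-1 : ℝ)) ∈
      {p : ℝ × ℝ | ext l p.1 - ε < p.2 ∧ p.2 < ext l p.1}) → (q - b • ((1 : ℝ), (-1 : ℝ)) ∈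
      {p : ℝ × ℝ | ext l p.1 - ε < p.2 ∧ p.2 < ext l p.1}) → b - a ≤ ε := by
    intro a b hab ha hb
    simp only [mem_ofPred_eq, Prod.fst_sub, Prod.snd_sub, Prod.smul_fst, Prod.smul_snd,
      smul_eq_mul, mul_one, mul_neg] at ha hb
    have := hl.ext_mono (show q.1 - b ≤ q.1 - a by linarith)
    linarith [ha.1, hb.2]
  rw [Real.dist_eq]
  rcases le_total a b with h | h
  · rw [abs_sub_comm, abs_of_nonneg (by linarith)]; exact key a b h ha.2 hb.2
  · rw [abs_of_nonneg (by linarith)]; exact key b a h hb.2 ha.2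

/-- There is a parameter `a₀` at which the distance to the front equals ε. As this distance
decreases at a rate at most 2, the line stays in the strip for all parameters in (a₀, a₀ + ε / 2).
-/
theorem IsFront.le_front_strip (hl : IsFront l) {ε H : ℝ} (hε : 0 < ε) (hH : 0 ≤ H) {q : ℝ × ℝ}
    (h1 : ext l q.1 - H < q.2) (h2 : q.2 < ext l q.1 - ε) :
    ENNReal.ofReal (ε / 2) ≤ volume {a | a ∈ Ioc 0 H ∧ q - a • ((1 : ℝ), (-1 : ℝ)) ∈
      {p : ℝ × ℝ | ext l p.1 - ε < p.2 ∧ p.2 < ext l p.1}} := by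
  have hc : Continuous (fun a => ext l (q.1 - a) - q.2 - a) := by
    have := hl.continuous_ext; fun_prop
  have hH' : ext l (q.1 - H) - q.2 - H < 0 := by
    have := hl.ext_mono (show q.1 - H ≤ q.1 by linarith); linarith
  obtain ⟨a₀, ha₀, heq⟩ := intermediate_value_Icc' hH hc.continuousOn
    (show ε ∈ Icc (ext l (q.1 - H) - q.2 - H) (ext l (q.1 - 0) - q.2 - 0) by
      constructor <;> [linarith; (simp; linarith)])
  simp only at heq
  calc ENNReal.ofReal (ε / 2) = volume (Ioo a₀ (a₀ + ε / 2)) := by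
        rw [Real.volume_Ioo]; congr 1; ring
    _ ≤ _ := by
        refine measure_mono fun a ha => ?_
        have h3 := hl.ext_lip (show q.1 - a ≤ q.1 - a₀ by linarith [ha.1])
        have h4 := hl.ext_mono (show q.1 - a ≤ q.1 - a₀ by linarith [ha.1])
        have h5 := ha.1
        have h6 := ha.2
        refine ⟨⟨by linarith [ha₀.1], ?_⟩, ?_⟩
        · by_contra h7
          push Not at h7
          have := hl.ext_mono (show q.1 - a ≤ q.1 - H by linarith)
          linarith
        · simp only [mem_ofPred_eq, Prod.fst_sub, Prod.snd_sub, Prod.smul_fst, Prod.smul_snd,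
            smul_eq_mul, mul_one, mul_neg]
          constructor <;> linarith

theorem left_strip_le {ε : ℝ} (H : ℝ) (q : ℝ × ℝ) :
    volume {a | a ∈ Ioc 0 H ∧ q - a • ((1 : ℝ), (1 : ℝ)) ∈
      {p : ℝ × ℝ | 0 < p.2 ∧ p.2 < ε}} ≤ ENNReal.ofReal ε := by
  calc _ ≤ volume (Ioo (q.2 - ε) q.2) := by
        refine measure_mono fun a ha => ?_
        have := ha.2
        simp only [mem_ofPred_eq, Prod.fst_sub, Prod.snd_sub, Prod.smul_fst, Prod.smul_snd,
          smul_eq_mul, mul_one] at this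
        constructor <;> linarith
    _ = _ := by rw [Real.volume_Ioo]; congr 1; ring

theorem le_left_strip {ε H : ℝ} (hε : 0 < ε) {q : ℝ × ℝ} (h1 : ε < q.2) (h2 : q.2 < H) :
    ENNReal.ofReal (ε / 2) ≤ volume {a | a ∈ Ioc 0 H ∧ q - a • ((1 : ℝ), (1 : ℝ)) ∈
      {p : ℝ × ℝ | 0 < p.2 ∧ p.2 < ε}} := by
  calc ENNReal.ofReal (ε / 2) ≤ volume (Ioo (q.2 - ε) q.2) := by
        rw [Real.volume_Ioo]; apply ENNReal.ofReal_le_ofReal; linarith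
    _ ≤ _ := by
        refine measure_mono fun a ha => ?_
        have h3 := ha.1
        have h4 := ha.2
        refine ⟨⟨by linarith, by linarith⟩, ?_⟩
        simp only [mem_ofPred_eq, Prod.fst_sub, Prod.snd_sub, Prod.smul_fst, Prod.smul_snd,
          smul_eq_mul, mul_one]
        constructor <;> linarith

/-- The properties of the difference of two solutions that force it to vanish. -/
structure IsNull (l : ℝ → ℝ) (κ : ℝ) (u : ℝ × ℝ → ℝ) : Prop where
  meas : Measurable u
  loc : LocallyIntegrable u
  eqn : ∀ φ, IsTest (OmegaExt l) φ →
    ∫ p, u p * (dt (dt φ) p - dx (dx φ) p) = κ * ∫ p, u p * φ p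
  out : ∀ᵐ p, p ∉ Omega l → u p = 0
  fin : ∀ T, ∫⁻ p, truncEnorm u T p ≠ ⊤
  left : ∀ T η, 0 < η → ∃ ε₀ > 0, ∀ ε, 0 < ε → ε ≤ ε₀ →
    ∫⁻ p in {p : ℝ × ℝ | 0 < p.2 ∧ p.2 < ε}, truncEnorm u T p
      ≤ ENNReal.ofReal ε * ENNReal.ofReal η
  front : ∀ T η, 0 < η → ∃ ε₀ > 0, ∀ ε, 0 < ε → ε ≤ ε₀ →
    ∫⁻ p in {p : ℝ × ℝ | ext l p.1 - ε < p.2 ∧ p.2 < ext l p.1}, truncEnorm u T p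
      ≤ ENNReal.ofReal ε * ENNReal.ofReal η

/-- The second direction points backward in time, as `restricted_translation_le` requires; this is
the origin of the sign of `-κ`. -/
theorem IsNull.eqn_left (h : IsNull l κ u) : ∀ φ, IsTest (OmegaExt l) φ →
    ∫ p, u p * dirDeriv ((-1 : ℝ), (1 : ℝ)) (dirDeriv ((1 : ℝ), (1 : ℝ)) φ) p
      = -κ * ∫ p, u p * φ p := by
  intro φ hφ
  rw [neg_mul, ← h.eqn φ hφ, ← integral_neg]
  congr 1; funext p
  rw [dirDeriv_dirDeriv_eq hφ]; ring

theorem IsNull.eqn_front (h : IsNull l κ u) : ∀ φ, IsTest (OmegaExt l) φ →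
    ∫ p, u p * dirDeriv ((-1 : ℝ), (-1 : ℝ)) (dirDeriv ((1 : ℝ), (-1 : ℝ)) φ) p
      = -κ * ∫ p, u p * φ p := by
  intro φ hφ
  rw [neg_mul, ← h.eqn φ hφ, ← integral_neg]
  congr 1; funext p
  rw [dirDeriv_dirDeriv_eq hφ]; ring

end Uniqueness

/-! ### Vanishing of the difference, one time step after the other. -/

section Vanishing

variable {l : ℝ → ℝ} {u : ℝ × ℝ → ℝ} {κ T₀ δ : ℝ}

/-- Away from both boundaries no strip is needed. Characteristics are followed for a time δ only, so
the starting corner also lies before `T₀` and the double integral over a square of side δ is all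
that is left. The margins δ and 3δ keep the parallelograms inside the domain. -/
theorem IsNull.mid_estimate (hl : IsFront l) (h : IsNull l κ u)
    (h0 : ∀ᵐ p : ℝ × ℝ, p.1 < T₀ → u p = 0) (hδ : 0 < δ) :
    ∫⁻ p in {p : ℝ × ℝ | δ < p.2 ∧ p.2 < ext l p.1 - 3 * δ}, truncEnorm u (T₀ + δ) p ≤
      ‖-κ‖ₑ * (ENNReal.ofReal δ * ENNReal.ofReal δ * ∫⁻ p, truncEnorm u (T₀ + δ) p) := by
  have hc := hl.continuous_ext
  set w := truncEnorm u (T₀ + δ) with hw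
  have hwm : Measurable w := measurable_truncEnorm h.meas _
  set M : Set (ℝ × ℝ) := {p | δ < p.2 ∧ p.2 < ext l p.1 - 3 * δ} with hM
  have hMo : IsOpen M := by
    refine (isOpen_lt continuous_const continuous_snd).inter
      (isOpen_lt continuous_snd ?_)
    fun_prop
  set S : Set (ℝ × ℝ) := (fun p => p + δ • ((1 : ℝ), (1 : ℝ))) ⁻¹' M with hS
  have hSo : IsOpen S := hMo.preimage (by fun_prop)
  have e1 : ∫⁻ p in M, w p = ∫⁻ p in S, w (p + δ • ((1 : ℝ), (1 : ℝ))) := by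
    rw [← lintegral_indicator hMo.measurableSet, ← lintegral_indicator hSo.measurableSet,
      ← lintegral_add_right_eq_self _ (δ • ((1 : ℝ), (1 : ℝ)))]
    rfl
  rw [e1]
  refine (restricted_translation_le h.meas h.loc h.eqn_left rfl rfl hδ.le h0 hSo hδ.le ?_).trans ?_
  · intro p hp a ha b hb
    have h1 : δ < p.2 + δ ∧ p.2 + δ < ext l (p.1 + δ) - 3 * δ := by simpa [hS, hM] using hp
    have h2 := hl.ext_lip (show p.1 + (a - b) ≤ p.1 + δ by linarith [ha.2, hb.1])
    have h3 := ha.1; have h4 := ha.2; have h5 := hb.1; have h6 := hb.2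
    have e2 : p + (a • ((1 : ℝ), (1 : ℝ)) + b • ((-1 : ℝ), (1 : ℝ)))
        = (p.1 + (a - b), p.2 + (a + b)) := by ext <;> simp <;> ring
    rw [e2]
    constructor <;> dsimp only <;> linarith [h1.1, h1.2]
  · have hz : ∫⁻ p in S ∩ {p | p.1 + δ < T₀ + δ}, ‖u p‖ₑ = 0 := by
      have := lintegral_shift_eq_zero (u := u)
        (μ := volume.restrict (S ∩ {p | p.1 + δ < T₀ + δ}))
        Measure.absolutelyContinuous_restrict h0 0 ?_
      · simpa using this
      · have hVm : MeasurableSet {p : ℝ × ℝ | p.1 + δ < T₀ + δ} :=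
          measurableSet_lt (measurable_fst.add_const _) measurable_const
        filter_upwards [ae_restrict_mem (hSo.measurableSet.inter hVm)] with p hp
        have := hp.2
        simp only [mem_ofPred_eq] at this
        simp; linarith
    rw [hz, zero_add]
    gcongr ‖-κ‖ₑ * ?_
    calc _ ≤ ∫⁻ _ in Ioc 0 δ ×ˢ Ioc 0 δ, ∫⁻ p, w p := by
          refine lintegral_mono fun c => ?_
          refine (setLIntegral_le_lintegral _ _).trans ?_
          rw [lintegral_add_right_eq_self w]
      _ = _ := by
          rw [setLIntegral_const, Measure.volume_eq_prod, Measure.prod_prod, Real.volume_Ioc,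
            sub_zero, mul_comm]

theorem IsNull.left_estimate (hl : IsFront l) (h : IsNull l κ u)
    (h0 : ∀ᵐ p : ℝ × ℝ, p.1 < T₀ → u p = 0) (hδ : 0 < δ) {H ε η : ℝ} (hε : 0 < ε)
    (hsum : H + ε + δ ≤ l 0)
    (hη : ∫⁻ p in {p : ℝ × ℝ | 0 < p.2 ∧ p.2 < ε}, truncEnorm u (T₀ + δ) p
      ≤ ENNReal.ofReal ε * ENNReal.ofReal η) :
    ∫⁻ p in {p : ℝ × ℝ | ε < p.2 ∧ p.2 < H}, truncEnorm u (T₀ + δ) p ≤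
      2 * (ENNReal.ofReal H * (ENNReal.ofReal η
        + ‖-κ‖ₑ * (ENNReal.ofReal δ * ∫⁻ p, truncEnorm u (T₀ + δ) p))) := by
  refine strip_estimate h.meas h.loc h.eqn_left rfl rfl hδ.le hε h0
    ((isOpen_lt continuous_const continuous_snd).inter (isOpen_lt continuous_snd continuous_const))
    ?_ (left_strip_le H) ((measurableSet_lt measurable_const measurable_snd).inter
      (measurableSet_lt measurable_snd measurable_const))
    (fun q hq => le_left_strip hε hq.1 hq.2) hη
  intro p hp a ha b hb
  have h3 := ha.1; have h4 := ha.2; have h5 := hb.1; have h6 := hb.2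
  have h7 : 0 < p.2 := hp.1
  have h8 : p.2 < ε := hp.2
  have e2 : p + (a • ((1 : ℝ), (1 : ℝ)) + b • ((-1 : ℝ), (1 : ℝ)))
      = (p.1 + (a - b), p.2 + (a + b)) := by ext <;> simp <;> ring
  rw [e2]
  have := hl.ext_ge (p.1 + (a - b))
  constructor <;> dsimp only <;> linarith

theorem IsNull.front_estimate (hl : IsFront l) (h : IsNull l κ u)
    (h0 : ∀ᵐ p : ℝ × ℝ, p.1 < T₀ → u p = 0) (hδ : 0 < δ) {H ε η : ℝ} (hε : 0 < ε) (hH : 0 ≤ H)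
    (hsum : H + ε + δ ≤ l 0)
    (hη : ∫⁻ p in {p : ℝ × ℝ | ext l p.1 - ε < p.2 ∧ p.2 < ext l p.1}, truncEnorm u (T₀ + δ) p
      ≤ ENNReal.ofReal ε * ENNReal.ofReal η) :
    ∫⁻ p in {p : ℝ × ℝ | ext l p.1 - H < p.2 ∧ p.2 < ext l p.1 - ε}, truncEnorm u (T₀ + δ) p ≤
      2 * (ENNReal.ofReal H * (ENNReal.ofReal η
        + ‖-κ‖ₑ * (ENNReal.ofReal δ * ∫⁻ p, truncEnorm u (T₀ + δ) p))) := by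
  have hc := hl.continuous_ext
  refine strip_estimate h.meas h.loc h.eqn_front rfl rfl hδ.le hε h0
    ((isOpen_lt (by fun_prop) continuous_snd).inter (isOpen_lt continuous_snd (by fun_prop)))
    ?_ (hl.front_strip_le H)
    ((isOpen_lt (by fun_prop) continuous_snd).inter
      (isOpen_lt continuous_snd (by fun_prop))).measurableSet
    (fun q hq => hl.le_front_strip hε hH hq.1 hq.2) hη
  intro p hp a ha b hb
  have h3 := ha.1; have h4 := ha.2; have h5 := hb.1; have h6 := hb.2
  have h7 : ext l p.1 - ε < p.2 := hp.1
  have h8 : p.2 < ext l p.1 := hp.2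
  have e2 : p + (a • ((1 : ℝ), (-1 : ℝ)) + b • ((-1 : ℝ), (-1 : ℝ)))
      = (p.1 + (a - b), p.2 - (a + b)) := by ext <;> simp <;> ring
  rw [e2]
  have h9 := hl.ext_ge p.1
  constructor <;> dsimp only
  · linarith
  · rcases le_total a b with hab | hab
    · linarith [hl.ext_lip (show p.1 + (a - b) ≤ p.1 by linarith)]
    · linarith [hl.ext_mono (show p.1 ≤ p.1 + (a - b) by linarith)]

/-- The domain is covered by two boundary strips, the two bands swept from them and the middle
region. Summing the five bounds gives N ≤ (4 + ℓ(0)) η + N / 2 for every η > 0, where the smallness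
of δ involves `l 0` and `κ` but not `T₀`. -/
theorem IsNull.step (hl : IsFront l) (h : IsNull l κ u)
    (h0 : ∀ᵐ p : ℝ × ℝ, p.1 < T₀ → u p = 0) (hδ : 0 < δ) (hδ1 : δ ≤ 1) (hδl : δ ≤ l 0 / 16)
    (hδκ : δ * ((l 0 + 1) * (|κ| + 1)) ≤ 1 / 2) :
    ∀ᵐ p : ℝ × ℝ, p.1 < T₀ + δ → u p = 0 := by
  have hl0 := hl.pos
  set w := truncEnorm u (T₀ + δ) with hw
  have hwm : Measurable w := measurable_truncEnorm h.meas _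
  set N := ∫⁻ p, w p with hN
  have hNtop : N ≠ ⊤ := h.fin _
  have hκ : ‖-κ‖ₑ = ENNReal.ofReal |κ| := by rw [enorm_neg, Real.enorm_eq_ofReal_abs]
  have key : ∀ η : ℝ, 0 < η → N.toReal ≤ (8 + 2 * l 0) * η := by
    intro η hη
    obtain ⟨ε₁, hε₁, hleft⟩ := h.left (T₀ + δ) η hη
    obtain ⟨ε₂, hε₂, hfront⟩ := h.front (T₀ + δ) η hη
    -- The covering strips have width `2 * ε` and the bands start at `ε`, so the open regions
    -- overlap and leave no gap.
    obtain ⟨ε, hε, hεl, hε1, h2ε1, h2ε2⟩ :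
        ∃ ε : ℝ, 0 < ε ∧ ε ≤ l 0 / 4 ∧ ε ≤ 1 ∧ 2 * ε ≤ ε₁ ∧ 2 * ε ≤ ε₂ := by
      refine ⟨min (min (l 0 / 4) 1) (min (ε₁ / 2) (ε₂ / 2)), by positivity, ?_, ?_, ?_, ?_⟩
      · exact (min_le_left _ _).trans (min_le_left _ _)
      · exact (min_le_left _ _).trans (min_le_right _ _)
      · have := (min_le_right (min (l 0 / 4) 1) (min (ε₁ / 2) (ε₂ / 2))).trans (min_le_left _ _)
        linarith
      · have := (min_le_right (min (l 0 / 4) 1) (min (ε₁ / 2) (ε₂ / 2))).trans (min_le_right _ _)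
        linarith
    have hR1 := h.left_estimate hl h0 hδ (H := l 0 / 4) hε (by linarith)
      (hleft ε hε (by linarith))
    have hR2 := h.front_estimate hl h0 hδ (H := l 0 / 4) hε (by linarith) (by linarith)
      (hfront ε hε (by linarith))
    have hR3 := h.mid_estimate hl h0 hδ
    have hR4 := hleft (2 * ε) (by linarith) h2ε1
    have hR5 := hfront (2 * ε) (by linarith) h2ε2
    set A₁ := {p : ℝ × ℝ | 0 < p.2 ∧ p.2 < 2 * ε}
    set A₂ := {p : ℝ × ℝ | ε < p.2 ∧ p.2 < l 0 / 4}
    set A₃ := {p : ℝ × ℝ | δ < p.2 ∧ p.2 < ext l p.1 - 3 * δ}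
    set A₄ := {p : ℝ × ℝ | ext l p.1 - l 0 / 4 < p.2 ∧ p.2 < ext l p.1 - ε}
    set A₅ := {p : ℝ × ℝ | ext l p.1 - 2 * ε < p.2 ∧ p.2 < ext l p.1}
    have hcov : N ≤ ∫⁻ p in A₁ ∪ (A₂ ∪ (A₃ ∪ (A₄ ∪ A₅))), w p := by
      have hc := hl.continuous_ext
      rw [← lintegral_indicator]
      · refine lintegral_mono_ae ?_
        filter_upwards [h.out] with p hp
        by_cases hpo : p ∈ Omega l
        · rw [hl.Omega_eq] at hpo
          rw [indicator_of_mem]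
          have h1 := hpo.2.1
          have h2 := hpo.2.2
          by_cases c1 : p.2 < 2 * ε
          · exact Or.inl ⟨h1, c1⟩
          by_cases c2 : p.2 < l 0 / 4
          · exact Or.inr (Or.inl ⟨by linarith, c2⟩)
          by_cases c3 : p.2 < ext l p.1 - 3 * δ
          · exact Or.inr (Or.inr (Or.inl ⟨by linarith, c3⟩))
          by_cases c4 : p.2 < ext l p.1 - ε
          · exact Or.inr (Or.inr (Or.inr (Or.inl ⟨by linarith, c4⟩)))
          · exact Or.inr (Or.inr (Or.inr (Or.inr ⟨by linarith, h2⟩)))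
        · have : w p = 0 := by simp [hw, truncEnorm, hp hpo]
          rw [this]; exact zero_le
      · have hm : ∀ f g : ℝ × ℝ → ℝ, Continuous f → Continuous g →
            MeasurableSet {p : ℝ × ℝ | f p < p.2 ∧ p.2 < g p} := fun f g hf hg =>
          ((isOpen_lt hf continuous_snd).inter (isOpen_lt continuous_snd hg)).measurableSet
        exact (hm _ _ (by fun_prop) (by fun_prop)).union ((hm _ _ (by fun_prop) (by fun_prop)).union
          ((hm _ _ (by fun_prop) (by fun_prop)).union ((hm _ _ (by fun_prop) (by fun_prop)).union
            (hm _ _ (by fun_prop) (by fun_prop)))))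
    have hsum : N ≤ ENNReal.ofReal (2 * ε) * ENNReal.ofReal η + (
        2 * (ENNReal.ofReal (l 0 / 4) * (ENNReal.ofReal η
          + ‖-κ‖ₑ * (ENNReal.ofReal δ * N))) + (
        ‖-κ‖ₑ * (ENNReal.ofReal δ * ENNReal.ofReal δ * N) + (
        2 * (ENNReal.ofReal (l 0 / 4) * (ENNReal.ofReal η
          + ‖-κ‖ₑ * (ENNReal.ofReal δ * N))) +
        ENNReal.ofReal (2 * ε) * ENNReal.ofReal η))) := by
      refine hcov.trans ?_
      refine (lintegral_union_le _ _ _).trans (add_le_add hR4 ?_)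
      refine (lintegral_union_le _ _ _).trans (add_le_add hR1 ?_)
      refine (lintegral_union_le _ _ _).trans (add_le_add hR3 ?_)
      exact (lintegral_union_le _ _ _).trans (add_le_add hR2 hR5)
    have hreal : N.toReal ≤ 2 * ε * η + (2 * (l 0 / 4 * (η + |κ| * (δ * N.toReal))) + (
        |κ| * (δ * δ * N.toReal) + (2 * (l 0 / 4 * (η + |κ| * (δ * N.toReal))) + 2 * ε * η))) := by
      have hN0 : 0 ≤ N.toReal := ENNReal.toReal_nonneg
      have h2 : (2 : ℝ≥0∞) = ENNReal.ofReal 2 := by simp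
      rw [hκ, h2] at hsum
      nth_rewrite 2 3 4 [← ENNReal.ofReal_toReal hNtop] at hsum
      simp (disch := positivity) only [← ENNReal.ofReal_mul, ← ENNReal.ofReal_add] at hsum
      exact ENNReal.toReal_le_of_le_ofReal (by positivity) hsum
    have hN0 : 0 ≤ N.toReal := ENNReal.toReal_nonneg
    have hk := abs_nonneg κ
    have h3 : (δ * ((l 0 + 1) * (|κ| + 1))) * N.toReal ≤ 1 / 2 * N.toReal := by gcongr
    have h4 : |κ| * (δ * δ * N.toReal) ≤ |κ| * (1 * δ * N.toReal) := by gcongr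
    have h5 : 0 ≤ δ * (l 0 + 1) * N.toReal := by positivity
    have h6 : ε * η ≤ 1 * η := by gcongr
    nlinarith
  have hN0 : N = 0 := by
    have h1 : N.toReal ≤ 0 := by
      refine le_of_forall_pos_le_add fun η hη => ?_
      have := key (η / (8 + 2 * l 0)) (by positivity)
      rw [mul_div_cancel₀ _ (by positivity)] at this
      linarith
    rcases (ENNReal.toReal_eq_zero_iff _).1 (le_antisymm h1 ENNReal.toReal_nonneg) with h2 | h2
    · exact h2
    · exact absurd h2 hNtop
  rw [hN, lintegral_eq_zero_iff hwm] at hN0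
  filter_upwards [hN0] with p hp hpT
  have hp' : w p = 0 := hp
  rw [hw, truncEnorm, indicator_of_mem (show p ∈ {p : ℝ × ℝ | p.1 < T₀ + δ} from hpT)] at hp'
  simpa using hp'

/-- The induction starts from the extension by zero to negative times, and the step length is the
same at every stage. -/
theorem IsNull.ae_eq_zero (hl : IsFront l) (h : IsNull l κ u) : ∀ᵐ p : ℝ × ℝ, u p = 0 := by
  have hl0 := hl.pos
  have hC : 0 < (l 0 + 1) * (|κ| + 1) := by positivity
  obtain ⟨δ, hδ, hδ1, hδl, hδκ⟩ : ∃ δ : ℝ, 0 < δ ∧ δ ≤ 1 ∧ δ ≤ l 0 / 16 ∧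
      δ * ((l 0 + 1) * (|κ| + 1)) ≤ 1 / 2 := by
    refine ⟨min (min 1 (l 0 / 16)) (1 / 2 / ((l 0 + 1) * (|κ| + 1))), by positivity,
      (min_le_left _ _).trans (min_le_left _ _), (min_le_left _ _).trans (min_le_right _ _), ?_⟩
    rw [← le_div_iff₀ hC]
    exact min_le_right _ _
  have hn : ∀ n : ℕ, ∀ᵐ p : ℝ × ℝ, p.1 < n * δ → u p = 0 := by
    intro n
    induction n with
    | zero =>
      filter_upwards [h.out] with p hp hp1
      refine hp fun hp2 => ?_
      have := hp2.1
      simp at hp1; linarith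
    | succ n ih =>
      have := h.step hl ih hδ hδ1 hδl hδκ
      push_cast
      rwa [add_mul, one_mul]
  filter_upwards [ae_all_iff.2 hn] with p hp
  obtain ⟨n, hn⟩ := exists_nat_gt (p.1 / δ)
  exact hp n ((div_lt_iff₀ hδ).1 hn)

end Vanishing

/-! ### Traces in L² as smallness in thin strips. -/

section Traces

/-- The map `Φ` flattens the boundary to `y = 0`. For almost every small `y`, both slices lie within
`c` of the common trace in L²(0, T), hence within `2 * c` of each other; Cauchy–Schwarz in `t` costs
a factor `T ^ (1 / 2)`, which explains the choice of `c`. Integration in `y` gives the factor ε. The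
measurable representatives agree with the given functions on almost every slice. -/
theorem strip_small {Φ : ℝ × ℝ → ℝ × ℝ} {Ω : Set (ℝ × ℝ)} {v v' w w' : ℝ × ℝ → ℝ} {g : ℝ → ℝ}
    {T y₀ : ℝ} (hΩ : MeasurableSet Ω)
    (hΦ : MeasurePreserving Φ) (hT : 0 < T) (hy₀ : 0 < y₀)
    (hΦΩ : ∀ t ∈ Ioo 0 T, ∀ y ∈ Ioo 0 y₀, Φ (t, y) ∈ Ω)
    (hw : Measurable w) (hw' : Measurable w') (hvw : v =ᵐ[volume.restrict Ω] w)
    (hvw' : v' =ᵐ[volume.restrict Ω] w') (hg : AEStronglyMeasurable g (volume.restrict (Ioo 0 T)))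
    (h : L2LimitAtZero T (fun y t => v (Φ (t, y))) g)
    (h' : L2LimitAtZero T (fun y t => v' (Φ (t, y))) g) {η : ℝ} (hη : 0 < η) :
    ∃ ε₀ > 0, ∀ ε, 0 < ε → ε ≤ ε₀ →
      ∫⁻ p in Ioo 0 T ×ˢ Ioo 0 ε, ‖w (Φ p) - w' (Φ p)‖ₑ
        ≤ ENNReal.ofReal ε * ENNReal.ofReal η := by
  set s := T ^ (1 / 2 : ℝ) with hs
  have hs0 : 0 < s := by positivity
  set c := η / (2 * s) with hc
  have hc0 : 0 < c := by positivity
  have hsw : MeasurePreserving (fun q : ℝ × ℝ => Φ (q.2, q.1)) := hΦ.comp Measure.measurePreserving_swap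
  have hae : ∀ {v w : ℝ × ℝ → ℝ}, v =ᵐ[volume.restrict Ω] w →
      ∀ᵐ y : ℝ, ∀ᵐ t : ℝ, Φ (t, y) ∈ Ω → v (Φ (t, y)) = w (Φ (t, y)) := by
    intro v w hvw
    exact Measure.ae_ae_of_ae_prod
      (hsw.quasiMeasurePreserving.ae ((ae_restrict_iff' hΩ).1 hvw))
  obtain ⟨ε₁, hε₁, h1⟩ := eventually_zeroRightAE_iff.1
    ((h.eventually (gt_mem_nhds (ENNReal.ofReal_pos.2 hc0))).and
      (h'.eventually (gt_mem_nhds (ENNReal.ofReal_pos.2 hc0))))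
  have hmeas : ∀ w : ℝ × ℝ → ℝ, Measurable w → ∀ y, Measurable fun t => w (Φ (t, y)) :=
    fun w hw y => hw.comp (hΦ.measurable.comp (by fun_prop))
  refine ⟨min ε₁ y₀, by positivity, fun ε hε hε' => ?_⟩
  have hm : Measurable fun p => ‖w (Φ p) - w' (Φ p)‖ₑ :=
    ((hw.comp hΦ.measurable).sub (hw'.comp hΦ.measurable)).enorm
  have hpr : (volume : Measure (ℝ × ℝ)).restrict (Ioo 0 T ×ˢ Ioo 0 ε)
      = (volume.restrict (Ioo 0 T)).prod (volume.restrict (Ioo 0 ε)) := by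
    rw [Measure.prod_restrict]; rfl
  rw [hpr, lintegral_prod_symm' _ hm]
  calc _ ≤ ∫⁻ y in Ioo 0 ε, ENNReal.ofReal η := by
        refine lintegral_mono_ae ?_
        rw [ae_restrict_iff' measurableSet_Ioo]
        filter_upwards [h1, hae hvw, hae hvw'] with y hy1 hy2 hy3 hy
        obtain ⟨ha, hb⟩ := hy1 ⟨hy.1, hy.2.trans_le (hε'.trans (min_le_left _ _))⟩
        have hyy : y ∈ Ioo 0 y₀ := ⟨hy.1, hy.2.trans_le (hε'.trans (min_le_right _ _))⟩
        have e1 : ∀ {v w : ℝ × ℝ → ℝ}, (∀ᵐ t : ℝ, Φ (t, y) ∈ Ω → v (Φ (t, y)) = w (Φ (t, y))) →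
            (fun t => v (Φ (t, y)) - g t) =ᵐ[volume.restrict (Ioo 0 T)]
              fun t => w (Φ (t, y)) - g t := by
          intro v w hvw
          filter_upwards [ae_restrict_of_ae hvw, ae_restrict_mem measurableSet_Ioo] with t h1 ht
          rw [h1 (hΦΩ t ht y hyy)]
        rw [eLpNorm_congr_ae (e1 hy2)] at ha
        rw [eLpNorm_congr_ae (e1 hy3)] at hb
        have m1 : AEStronglyMeasurable (fun t => w (Φ (t, y)) - g t) (volume.restrict (Ioo 0 T)) :=
          (hmeas w hw y).aestronglyMeasurable.sub hg
        have m2 : AEStronglyMeasurable (fun t => w' (Φ (t, y)) - g t)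
            (volume.restrict (Ioo 0 T)) := (hmeas w' hw' y).aestronglyMeasurable.sub hg
        have h2 := eLpNorm_sub_le m1 m2 (p := 2) (by norm_num)
        have e2 : ((fun t => w (Φ (t, y)) - g t) - fun t => w' (Φ (t, y)) - g t)
            = fun t => w (Φ (t, y)) - w' (Φ (t, y)) := by funext t; simp
        rw [e2] at h2
        have h3 := eLpNorm_le_eLpNorm_mul_rpow_measure_univ (p := 1) (q := 2) (by norm_num)
          (f := fun t => w (Φ (t, y)) - w' (Φ (t, y))) (μ := volume.restrict (Ioo 0 T))
          ((hmeas w hw y).sub (hmeas w' hw' y)).aestronglyMeasurable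
        rw [eLpNorm_one_eq_lintegral_enorm] at h3
        refine h3.trans ?_
        have e3 : (volume.restrict (Ioo 0 T)) univ ^ (1 / (1 : ℝ≥0∞).toReal - 1 / (2 : ℝ≥0∞).toReal)
            = ENNReal.ofReal s := by
          rw [Measure.restrict_apply_univ, Real.volume_Ioo, sub_zero,
            ENNReal.ofReal_rpow_of_pos hT]
          congr 2; norm_num
        rw [e3]
        calc _ ≤ (ENNReal.ofReal c + ENNReal.ofReal c) * ENNReal.ofReal s := by
              gcongr
              exact h2.trans (add_le_add ha.le hb.le)
          _ = _ := by
              rw [← ENNReal.ofReal_add hc0.le hc0.le, ← ENNReal.ofReal_mul (by positivity)]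
              congr 1; rw [hc]; field_simp; ring
    _ = _ := by rw [setLIntegral_const, Real.volume_Ioo, sub_zero, mul_comm]

variable {l : ℝ → ℝ}

theorem IsFront.measurePreserving_front (hl : IsFront l) :
    MeasurePreserving fun p : ℝ × ℝ => (p.1, ext l p.1 - p.2) :=
  (MeasurePreserving.id volume).skew_product (g := fun t x => ext l t - x)
    ((hl.continuous_ext.measurable.comp measurable_fst).sub measurable_snd)
    (Eventually.of_forall fun t => (Measure.measurePreserving_sub_left volume (ext l t)).map_eq)

end Traces

/-! ### Uniqueness of the solution. -/

section Uniqueness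

variable {l g f₀ f₁ : ℝ → ℝ} {a b : ℝ} {v v' : ℝ × ℝ → ℝ}

theorem iUnion_OmegaT (l : ℝ → ℝ) : ⋃ n : ℕ, OmegaT l (n + 1) = Omega l := by
  ext p
  simp only [mem_iUnion]
  refine ⟨fun ⟨n, hn⟩ => hn.1, fun hp => ?_⟩
  obtain ⟨n, hn⟩ := exists_nat_gt p.1
  exact ⟨n, hp, by linarith⟩

theorem IsSolution.aestronglyMeasurable (h : IsSolution a b l g f₀ f₁ v) :
    AEStronglyMeasurable v (volume.restrict (Omega l)) := by
  rw [← iUnion_OmegaT, aestronglyMeasurable_iUnion_iff]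
  exact fun n => (h.memH1 _ (by positivity)).1.1

theorem IsFront.volume_OmegaT_ne_top (hl : IsFront l) (T : ℝ) : volume (OmegaT l T) ≠ ⊤ :=
  ((measure_mono (hl.OmegaT_subset_rect T)).trans_lt
    (((Metric.isBounded_Ioo 0 T).prod (Metric.isBounded_Ioo 0 (l T))).measure_lt_top)).ne

theorem IsSolution.isNull (hl : IsFront l)
    (hg : ∀ T, AEStronglyMeasurable g (volume.restrict (Ioo 0 T)))
    (hf₀ : MemLp f₀ 2 (volume.restrict (Ioo 0 (l 0))))
    (hf₁ : MemLp f₁ 2 (volume.restrict (Ioo 0 (l 0))))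
    (h : IsSolution 0 b l g f₀ f₁ v) (h' : IsSolution 0 b l g f₀ f₁ v')
    {w w' : ℝ × ℝ → ℝ} (hw : Measurable w) (hw' : Measurable w')
    (hvw : v =ᵐ[volume.restrict (Omega l)] w) (hvw' : v' =ᵐ[volume.restrict (Omega l)] w') :
    IsNull l (-b) ((Omega l).indicator fun p => w p - w' p) := by
  have hΩ : MeasurableSet (Omega l) := hl.isOpen_Omega.measurableSet
  set u := (Omega l).indicator fun p => w p - w' p with hu
  have hum : Measurable u := (hw.sub hw').indicator hΩ
  have hout : ∀ p ∉ Omega l, u p = 0 := fun p hp => indicator_of_notMem hp _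
  have hpt : ∀ T p, truncEnorm u T p =
      (OmegaT l T).indicator (fun p => ‖w p - w' p‖ₑ) p := by
    intro T p
    by_cases hp : p ∈ Omega l
    · by_cases hT : p.1 < T
      · rw [truncEnorm, indicator_of_mem (show p ∈ {p : ℝ × ℝ | p.1 < T} from hT),
          indicator_of_mem (show p ∈ OmegaT l T from ⟨hp, hT⟩), hu, indicator_of_mem hp]
      · rw [truncEnorm, indicator_of_notMem (show p ∉ {p : ℝ × ℝ | p.1 < T} from hT),
          indicator_of_notMem (show p ∉ OmegaT l T from fun h => hT h.2)]
    · rw [truncEnorm, indicator_of_notMem (show p ∉ OmegaT l T from fun h => hp h.1)]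
      simp [hout p hp]
  have hfin : ∀ T, ∫⁻ p, truncEnorm u T p ≠ ⊤ := by
    intro T
    have hmono : ∫⁻ p, truncEnorm u T p ≤ ∫⁻ p in OmegaT l (max T 1), ‖v p - v' p‖ₑ := by
      have e1 : ∫⁻ p in OmegaT l (max T 1), ‖v p - v' p‖ₑ
          = ∫⁻ p in OmegaT l (max T 1), ‖w p - w' p‖ₑ := by
        refine lintegral_congr_ae ?_
        have hsub := OmegaT_subset l (max T 1)
        filter_upwards [ae_restrict_of_ae_restrict_of_subset hsub hvw,
          ae_restrict_of_ae_restrict_of_subset hsub hvw'] with p h1 h2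
        rw [h1, h2]
      rw [e1, ← lintegral_indicator (hl.isOpen_OmegaT _).measurableSet]
      refine lintegral_mono fun p => ?_
      rw [hpt]
      exact indicator_le_indicator_of_subset (s := OmegaT l T) (t := OmegaT l (max T 1))
        (fun q hq => ⟨hq.1, hq.2.trans_le (le_max_left _ _)⟩)
        (fun _ => zero_le) p
    have hpos : 0 < max T 1 := by positivity
    have : IsFiniteMeasure (volume.restrict (OmegaT l (max T 1))) :=
      ⟨by rw [Measure.restrict_apply_univ]; exact (hl.volume_OmegaT_ne_top _).lt_top⟩
    have := ((h.memH1 _ hpos).1.sub (h'.memH1 _ hpos).1).integrable (by norm_num)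
    exact (hmono.trans_lt this.2).ne
  have hloc : LocallyIntegrable u := by
    intro p
    refine ⟨{q | q.1 < p.1 + 1}, (isOpen_lt continuous_fst continuous_const).mem_nhds
      (by simp), hum.aestronglyMeasurable, ?_⟩
    have : MeasurableSet {q : ℝ × ℝ | q.1 < p.1 + 1} :=
      measurableSet_lt measurable_fst measurable_const
    rw [hasFiniteIntegral_iff_enorm, ← lintegral_indicator this]
    exact (hfin (p.1 + 1)).lt_top
  -- Treats both lateral boundaries at once; `Φ` is the identity at the left end and the reflection
  -- `(t, ext l t - y)` at the front.
  have hstrip : ∀ T η (g : ℝ → ℝ) (Φ : ℝ × ℝ → ℝ × ℝ) (S : ℝ → Set (ℝ × ℝ)), 0 < η →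
      (∀ T, AEStronglyMeasurable g (volume.restrict (Ioo 0 T))) → MeasurePreserving Φ →
      (∀ t y, 0 < t → 0 < y → y < l 0 → Φ (t, y) ∈ Omega l) →
      (∀ p, Φ p ∈ Omega l → 0 < p.2) → (∀ p, (Φ p).1 = p.1) →
      (∀ ε, MeasurableSet (S ε)) → (∀ ε p, Φ p ∈ S ε → p.2 < ε) →
      (∀ T, 0 < T → L2LimitAtZero T (fun y t => v (Φ (t, y))) g) →
      (∀ T, 0 < T → L2LimitAtZero T (fun y t => v' (Φ (t, y))) g) → ∃ ε₀ > 0, ∀ ε, 0 < ε → ε ≤ ε₀ →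
      ∫⁻ p in S ε, truncEnorm u T p ≤ ENNReal.ofReal ε * ENNReal.ofReal η := by
    intro T η g Φ S hη hg hΦ h1 h2 h3 hS h4 h5 h6
    have hpos : 0 < max T 1 := by positivity
    obtain ⟨ε₀, hε₀, hε⟩ := strip_small hΩ hΦ hpos hl.pos
      (fun t ht y hy => h1 t y ht.1 hy.1 hy.2) hw hw' hvw hvw' (hg _) (h5 _ hpos) (h6 _ hpos) hη
    refine ⟨ε₀, hε₀, fun ε h0 hle => le_trans ?_ (hε ε h0 hle)⟩
    rw [← lintegral_indicator (hS ε), ← hΦ.lintegral_comp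
      ((measurable_truncEnorm hum T).indicator (hS ε)),
      ← lintegral_indicator (measurableSet_Ioo.prod measurableSet_Ioo)]
    refine lintegral_mono fun p => indicator_apply_le' (fun hp => ?_) (fun _ => zero_le)
    rw [hpt]
    refine indicator_apply_le' (fun hq => ?_) (fun _ => zero_le)
    have hq1 := hq.1.1
    have hq2 := hq.2
    rw [h3] at hq1 hq2
    rw [indicator_of_mem (show p ∈ Ioo 0 (max T 1) ×ˢ Ioo 0 ε from
      ⟨⟨hq1, hq2.trans_le (le_max_left _ _)⟩, h2 p hq.1, h4 ε p hp⟩)]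
  refine ⟨hum, hloc, ?_, Eventually.of_forall hout, hfin, ?_, ?_⟩
  · intro φ hφ
    have hφt := (hφ.dirDeriv (1, 0)).dirDeriv (1, 0)
    have hφx := (hφ.dirDeriv (0, 1)).dirDeriv (0, 1)
    have hloc' : LocallyIntegrableOn u (OmegaExt l) := hloc.locallyIntegrableOn _
    have key := h.weak_form_sub hl hf₀ hf₁ h' hφ
    have e1 : ∫ p in Omega l, (v p - v' p) * (dt (dt φ) p - dx (dx φ) p + b * φ p)
        = ∫ p, u p * (dt (dt φ) p - dx (dx φ) p + b * φ p) := by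
      rw [← integral_indicator hΩ]
      refine integral_congr_ae ?_
      filter_upwards [(ae_restrict_iff' hΩ).1 hvw, (ae_restrict_iff' hΩ).1 hvw'] with p h1 h2
      by_cases hp : p ∈ Omega l
      · rw [indicator_of_mem hp, hu, indicator_of_mem hp, h1 hp, h2 hp]
      · rw [indicator_of_notMem hp, hout p hp, zero_mul]
    rw [e1] at key
    have i1 : Integrable fun p => u p * (dt (dt φ) p - dx (dx φ) p) := by
      have := (integrable_mul_test hloc' hφt).sub (integrable_mul_test hloc' hφx)
      refine this.congr (Eventually.of_forall fun p => ?_)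
      simp only [dt, dx, Pi.sub_apply]; ring
    have i2 : Integrable fun p => b * (u p * φ p) := (integrable_mul_test hloc' hφ).const_mul b
    have e2 : ∀ p, u p * (dt (dt φ) p - dx (dx φ) p + b * φ p)
        = u p * (dt (dt φ) p - dx (dx φ) p) + b * (u p * φ p) := fun p => by ring
    simp_rw [e2] at key
    rw [integral_add i1 i2, integral_const_mul] at key
    linarith
  · intro T η hη
    refine hstrip T η g id (fun ε => {p | 0 < p.2 ∧ p.2 < ε}) hη hg (MeasurePreserving.id _) ?_ ?_ ?_
      ?_ ?_ h.trace_zero h'.trace_zero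
    · exact fun t y ht hy hyl => ⟨ht, hy, hyl.trans_le (hl.mono _ _ le_rfl ht.le)⟩
    · exact fun p hp => hp.2.1
    · exact fun p => rfl
    · exact fun ε => (measurableSet_lt measurable_const measurable_snd).inter
        (measurableSet_lt measurable_snd measurable_const)
    · exact fun ε p hp => hp.2
  · intro T η hη
    have hc := hl.continuous_ext
    have htr : ∀ {v : ℝ × ℝ → ℝ}, (∀ T, 0 < T → L2LimitAtZero T (fun y t => v (t, l t - y)) fun _ => 0) →
        ∀ T, 0 < T → L2LimitAtZero T (fun y t => v (t, ext l t - y)) fun _ => 0 := by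
      intro v hv T hT
      refine (hv T hT).congr fun y => eLpNorm_congr_ae ?_
      filter_upwards [ae_restrict_mem measurableSet_Ioo] with t ht
      rw [ext_of_nonneg ht.1.le]
    refine hstrip T η (fun _ => 0) (fun p => (p.1, ext l p.1 - p.2))
      (fun ε => {p | ext l p.1 - ε < p.2 ∧ p.2 < ext l p.1}) hη
      (fun _ => aestronglyMeasurable_const) hl.measurePreserving_front ?_ ?_ ?_ ?_
      ?_ (htr h.trace_front) (htr h'.trace_front)
    · intro t y ht hy hyl
      rw [hl.Omega_eq]
      have := hl.ext_ge t
      exact ⟨ht, by dsimp only; linarith, by dsimp only; linarith⟩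
    · intro p hp
      rw [hl.Omega_eq] at hp
      have := hp.2.2
      dsimp only at this; linarith
    · exact fun p => rfl
    · exact fun ε => ((isOpen_lt (by fun_prop) continuous_snd).inter
        (isOpen_lt continuous_snd (by fun_prop))).measurableSet
    · intro ε p hp
      have := hp.1
      dsimp only at this; linarith

theorem IsSolution.ae_eq (hl : IsFront l)
    (hg : ∀ T, AEStronglyMeasurable g (volume.restrict (Ioo 0 T)))
    (hf₀ : MemLp f₀ 2 (volume.restrict (Ioo 0 (l 0))))
    (hf₁ : MemLp f₁ 2 (volume.restrict (Ioo 0 (l 0))))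
    (h : IsSolution 0 b l g f₀ f₁ v) (h' : IsSolution 0 b l g f₀ f₁ v') :
    v =ᵐ[volume.restrict (Omega l)] v' := by
  have hv := h.aestronglyMeasurable.aemeasurable
  have hv' := h'.aestronglyMeasurable.aemeasurable
  have hn := (h.isNull hl hg hf₀ hf₁ h' hv.measurable_mk hv'.measurable_mk hv.ae_eq_mk
    hv'.ae_eq_mk).ae_eq_zero hl
  filter_upwards [hv.ae_eq_mk, hv'.ae_eq_mk, ae_restrict_of_ae hn,
    ae_restrict_mem hl.isOpen_Omega.measurableSet] with p h1 h2 h3 hp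
  rw [indicator_of_mem hp] at h3
  rw [h1, h2]; linarith

end Uniqueness

/-! ### The Duhamel term and its derivatives. -/

section Duhamel

/-- The primitive of `G` in the space variable. -/
noncomputable def prim (G : ℝ × ℝ → ℝ) : ℝ × ℝ → ℝ := fun p => ∫ y in (0 : ℝ)..p.2, G (p.1, y)

/-- The integral of `G` over the backward characteristic of speed `-σ` through a point. -/
noncomputable def charInt (σ : ℝ) (G : ℝ × ℝ → ℝ) : ℝ × ℝ → ℝ :=
  fun p => ∫ s in (0 : ℝ)..p.1, G (s, p.2 + σ * (p.1 - s))

/-- The integral of `G` over the backward cone with vertex at a point. -/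
noncomputable def duhamel (G : ℝ × ℝ → ℝ) : ℝ × ℝ → ℝ :=
  fun p => charInt 1 (prim G) p - charInt (-1) (prim G) p

variable {G : ℝ × ℝ → ℝ}

theorem continuous_prim (hG : Continuous G) : Continuous (prim G) := by
  refine intervalIntegral.continuous_parametric_intervalIntegral_of_continuous
    (f := fun (p : ℝ × ℝ) y => G (p.1, y)) ?_ continuous_snd
  exact hG.comp (by fun_prop)

theorem continuous_charInt (hG : Continuous G) (σ : ℝ) : Continuous (charInt σ G) := by
  refine intervalIntegral.continuous_parametric_intervalIntegral_of_continuous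
    (f := fun (p : ℝ × ℝ) s => G (s, p.2 + σ * (p.1 - s))) ?_ continuous_fst
  exact hG.comp (by fun_prop)

theorem continuous_duhamel (hG : Continuous G) : Continuous (duhamel G) :=
  (continuous_charInt (continuous_prim hG) 1).sub (continuous_charInt (continuous_prim hG) (-1))

theorem prim_sub_prim (hG : Continuous G) (s y z : ℝ) :
    prim G (s, z) - prim G (s, y) = ∫ r in y..z, G (s, r) := by
  have hc : Continuous fun r => G (s, r) := hG.comp (by fun_prop)
  exact intervalIntegral.integral_interval_sub_left (hc.intervalIntegrable _ _)
    (hc.intervalIntegrable _ _)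

theorem duhamel_eq (hG : Continuous G) (t x : ℝ) : duhamel G (t, x) =
    ∫ s in (0 : ℝ)..t, ∫ r in (x - (t - s))..(x + (t - s)), G (s, r) := by
  have hp := continuous_prim hG
  have h1 : Continuous fun s => prim G (s, x + 1 * (t - s)) := hp.comp (by fun_prop)
  have h2 : Continuous fun s => prim G (s, x + -1 * (t - s)) := hp.comp (by fun_prop)
  simp only [duhamel, charInt]
  rw [← intervalIntegral.integral_sub (h1.intervalIntegrable _ _) (h2.intervalIntegrable _ _)]
  refine intervalIntegral.integral_congr fun s _ => ?_
  rw [prim_sub_prim hG]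
  congr 1 <;> ring

/-- A displacement along (1, -σ) stays on the same characteristic and only moves the upper endpoint
of the integral. -/
theorem charInt_line (σ : ℝ) (p : ℝ × ℝ) (h : ℝ) :
    charInt σ G (p + h • ((1 : ℝ), -σ)) =
      ∫ s in (0 : ℝ)..(p.1 + h), G (s, p.2 + σ * (p.1 - s)) := by
  simp only [charInt, Prod.fst_add, Prod.snd_add, Prod.smul_fst, Prod.smul_snd, smul_eq_mul]
  rw [mul_one]
  congr 1; funext s; congr 2; ring

/-- In the coordinates (t, y) with y = x + σt the characteristic is fixed. The t-derivative is then
the fundamental theorem of calculus, and the y-derivative follows from Fubini, because `prim G` is a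
primitive in space. Continuity of `G` is enough. -/
theorem charInt_prim_hasFDerivAt (hG : Continuous G) (σ : ℝ) (p : ℝ × ℝ) :
    HasFDerivAt (charInt σ (prim G))
      ((prim G p + σ * charInt σ G p) • ContinuousLinearMap.fst ℝ ℝ ℝ
        + charInt σ G p • ContinuousLinearMap.snd ℝ ℝ ℝ) p := by
  have hp := continuous_prim hG
  set Q : ℝ → ℝ → ℝ := fun t y => ∫ s in (0 : ℝ)..t, prim G (s, y - σ * s) with hQ
  set R : ℝ → ℝ → ℝ := fun t y => ∫ s in (0 : ℝ)..t, G (s, y - σ * s) with hR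
  have hRc : Continuous (Function.uncurry R) := by
    refine intervalIntegral.continuous_parametric_intervalIntegral_of_continuous
      (f := fun (p : ℝ × ℝ) s => G (s, p.2 - σ * s)) ?_ continuous_fst
    exact hG.comp (by fun_prop)
  have h1 : ∀ v : ℝ × ℝ, HasDerivAt (fun t => Q t v.2) (prim G (v.1, v.2 - σ * v.1)) v.1 := by
    intro v
    have hc : Continuous fun s => prim G (s, v.2 - σ * s) := hp.comp (by fun_prop)
    exact hc.integral_hasStrictDerivAt 0 v.1 |>.hasDerivAt
  have h2 : ∀ v : ℝ × ℝ, HasDerivAt (fun y => Q v.1 y) (R v.1 v.2) v.2 := by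
    intro v
    have hc : Continuous fun y => R v.1 y := hRc.comp (by fun_prop : Continuous fun y => (v.1, y))
    have e1 : ∀ y, Q v.1 y = Q v.1 0 + ∫ r in (0 : ℝ)..y, R v.1 r := by
      intro y
      have e2 : ∫ r in (0 : ℝ)..y, R v.1 r
          = ∫ s in (0 : ℝ)..v.1, ∫ r in (0 : ℝ)..y, G (s, r - σ * s) := by
        refine intervalIntegral_intervalIntegral_swap ?_
        have hc : Continuous (Function.uncurry fun r s => G (s, r - σ * s)) :=
          hG.comp (by fun_prop)
        exact (hc.locallyIntegrable.integrableOn_isCompact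
          (isCompact_uIcc.prod isCompact_uIcc)).mono_set (prod_mono uIoc_subset_uIcc uIoc_subset_uIcc)
      rw [e2, ← sub_eq_iff_eq_add']
      have c1 : Continuous fun s => prim G (s, y - σ * s) := hp.comp (by fun_prop)
      have c2 : Continuous fun s => prim G (s, 0 - σ * s) := hp.comp (by fun_prop)
      simp only [hQ]
      rw [← intervalIntegral.integral_sub (c1.intervalIntegrable _ _) (c2.intervalIntegrable _ _)]
      refine intervalIntegral.integral_congr fun s _ => ?_
      rw [prim_sub_prim hG, intervalIntegral.integral_comp_sub_right (fun r => G (s, r))]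
    have : (fun y => Q v.1 y) = fun y => Q v.1 0 + ∫ r in (0 : ℝ)..y, R v.1 r := funext e1
    rw [this]
    exact ((hc.integral_hasStrictDerivAt 0 v.2).hasDerivAt).const_add _
  have hfd := (hasStrictFDerivAt_uncurry_coprod (u := (p.1, p.2 + σ * p.1)) (f := Q)
    (f₁ := fun t y => ContinuousLinearMap.toSpanSingleton ℝ (prim G (t, y - σ * t)))
    (f₂ := fun t y => ContinuousLinearMap.toSpanSingleton ℝ (R t y))
    (Eventually.of_forall fun v => (h1 v).hasFDerivAt)
    (Eventually.of_forall fun v => (h2 v).hasFDerivAt) ?_ ?_).hasFDerivAt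
  · have hlin : HasFDerivAt (fun p : ℝ × ℝ => (p.1, p.2 + σ * p.1))
        ((ContinuousLinearMap.fst ℝ ℝ ℝ).prod (ContinuousLinearMap.snd ℝ ℝ ℝ
          + σ • ContinuousLinearMap.fst ℝ ℝ ℝ)) p :=
      hasFDerivAt_fst.prodMk (hasFDerivAt_snd.add (hasFDerivAt_fst.const_smul σ))
    have e1 : charInt σ (prim G) = (Function.uncurry Q) ∘ fun p : ℝ × ℝ => (p.1, p.2 + σ * p.1) := by
      funext p
      simp only [charInt, hQ, Function.comp, Function.uncurry]
      congr 1; funext s; congr 2; ring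
    rw [e1]
    have := HasFDerivAt.comp p hfd hlin
    refine this.congr_fderiv ?_
    have e2 : R p.1 (p.2 + σ * p.1) = charInt σ G p := by
      simp only [charInt, hR]
      congr 1; funext s; congr 2; ring
    ext <;> simp [e2, Function.HasUncurry.uncurry]
  · exact (ContinuousLinearMap.toSpanSingletonCLE (𝕜 := ℝ) (E := ℝ)).continuous.comp
      (hp.comp (by fun_prop : Continuous fun v : ℝ × ℝ => (v.1, v.2 - σ * v.1))) |>.continuousAt
  · exact ((ContinuousLinearMap.toSpanSingletonCLE (𝕜 := ℝ) (E := ℝ)).continuous.comp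
      hRc).continuousAt

/-- The two endpoint terms `prim G p` cancel, so only integrals of `G` along characteristics remain.
-/
theorem duhamel_hasFDerivAt (hG : Continuous G) (p : ℝ × ℝ) :
    HasFDerivAt (duhamel G)
      ((charInt 1 G p + charInt (-1) G p) • ContinuousLinearMap.fst ℝ ℝ ℝ
        + (charInt 1 G p - charInt (-1) G p) • ContinuousLinearMap.snd ℝ ℝ ℝ) p := by
  refine ((charInt_prim_hasFDerivAt hG 1 p).sub (charInt_prim_hasFDerivAt hG (-1) p)).congr_fderiv ?_
  ext <;> simp

/-- The slice of the cone at time `s` has length 2(t - s), and the integral of (t - s) e^{λs} over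
[0, t] is at most e^{λt} / λ². A large `lam` thus makes the Duhamel operator small in the weighted
norm. -/
theorem abs_duhamel_le (hG : Continuous G) {lam A : ℝ} {M : ℝ → ℝ} (hlam : 0 < lam)
    (hM : Monotone M) (hM0 : ∀ t, 0 ≤ M t) (hA : 0 ≤ A)
    (h : ∀ s x, 0 ≤ s → |G (s, x)| ≤ A * (Real.exp (lam * s) * M s)) {t : ℝ} (ht : 0 ≤ t) (x : ℝ) :
    |duhamel G (t, x)| ≤ 2 / lam ^ 2 * (A * (Real.exp (lam * t) * M t)) := by
  rw [duhamel_eq hG]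
  have hc1 : Continuous fun s => 2 * A * M t * ((t - s) * Real.exp (lam * s)) := by fun_prop
  have hb : ∀ s ∈ Icc 0 t, |∫ r in (x - (t - s))..(x + (t - s)), G (s, r)|
      ≤ 2 * A * M t * ((t - s) * Real.exp (lam * s)) := by
    intro s hs
    have := intervalIntegral.norm_integral_le_of_norm_le_const (a := x - (t - s))
      (b := x + (t - s)) (f := fun r => G (s, r)) (C := A * (Real.exp (lam * s) * M s))
      (fun r _ => h s r hs.1)
    rw [Real.norm_eq_abs] at this
    refine this.trans ?_
    have e1 : x + (t - s) - (x - (t - s)) = 2 * (t - s) := by ring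
    rw [e1, abs_of_nonneg (by linarith [hs.2])]
    have : A * (Real.exp (lam * s) * M s) ≤ A * (Real.exp (lam * s) * M t) := by
      gcongr; exact hM hs.2
    have h3 : 0 ≤ 2 * (t - s) := by linarith [hs.2]
    nlinarith [mul_le_mul_of_nonneg_right this h3]
  have hint : ∫ s in (0 : ℝ)..t, (t - s) * Real.exp (lam * s)
      = Real.exp (lam * t) / lam ^ 2 - (t / lam + 1 / lam ^ 2) := by
    have hd : ∀ s ∈ uIcc 0 t, HasDerivAt (fun s => ((t - s) / lam + 1 / lam ^ 2) * Real.exp (lam * s))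
        ((t - s) * Real.exp (lam * s)) s := by
      intro s _
      have h1 : HasDerivAt (fun s => (t - s) / lam + 1 / lam ^ 2) (-1 / lam) s :=
        (((hasDerivAt_id s).const_sub t).div_const lam).add_const _
      have h2 : HasDerivAt (fun s => Real.exp (lam * s)) (Real.exp (lam * s) * lam) s := by
        simpa using ((hasDerivAt_id s).const_mul lam).exp
      refine (h1.mul h2).congr_deriv ?_
      field_simp
      ring
    rw [intervalIntegral.integral_eq_sub_of_hasDerivAt hd
      (Continuous.intervalIntegrable (by fun_prop) _ _)]
    simp
    ring
  calc |∫ s in (0 : ℝ)..t, ∫ r in (x - (t - s))..(x + (t - s)), G (s, r)|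
      ≤ ∫ s in (0 : ℝ)..t, 2 * A * M t * ((t - s) * Real.exp (lam * s)) :=
        by
          rw [← Real.norm_eq_abs]
          exact intervalIntegral.norm_integral_le_of_norm_le ht
            (Eventually.of_forall fun s hs => hb s ⟨hs.1.le, hs.2⟩) (hc1.intervalIntegrable _ _)
    _ = 2 * A * M t * (Real.exp (lam * t) / lam ^ 2 - (t / lam + 1 / lam ^ 2)) := by
        rw [intervalIntegral.integral_const_mul, hint]
    _ ≤ 2 * A * M t * (Real.exp (lam * t) / lam ^ 2) := by
        have := hM0 t
        have : 0 ≤ t / lam + 1 / lam ^ 2 := by positivity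
        gcongr; linarith
    _ = _ := by ring

theorem duhamel_sub {G' : ℝ × ℝ → ℝ} (hG : Continuous G) (hG' : Continuous G') (p : ℝ × ℝ) :
    duhamel (fun q => G q - G' q) p = duhamel G p - duhamel G' p := by
  have h1 : ∀ q, prim (fun q => G q - G' q) q = prim G q - prim G' q := by
    intro q
    exact intervalIntegral.integral_sub
      ((hG.comp (by fun_prop : Continuous fun y => (q.1, y))).intervalIntegrable _ _)
      ((hG'.comp (by fun_prop : Continuous fun y => (q.1, y))).intervalIntegrable _ _)
  have h2 : ∀ σ, charInt σ (prim fun q => G q - G' q) p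
      = charInt σ (prim G) p - charInt σ (prim G') p := by
    intro σ
    simp only [charInt, h1]
    exact intervalIntegral.integral_sub
      (((continuous_prim hG).comp (by fun_prop :
        Continuous fun s => (s, p.2 + σ * (p.1 - s)))).intervalIntegrable _ _)
      (((continuous_prim hG').comp (by fun_prop :
        Continuous fun s => (s, p.2 + σ * (p.1 - s)))).intervalIntegrable _ _)
  simp only [duhamel, h2]; ring

theorem charInt_zero_left (σ x : ℝ) : charInt σ G (0, x) = 0 := by simp [charInt]

theorem duhamel_zero_left (x : ℝ) : duhamel G (0, x) = 0 := by
  simp [duhamel, charInt_zero_left]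

end Duhamel

/-! ### Reflection of characteristics by the front. -/

section Characteristics

variable {l : ℝ → ℝ}

theorem IsFront.exists_tau (hl : IsFront l) (s : ℝ) : ∃ t, t + ext l t = s := by
  have hc : Continuous fun t => t + ext l t := by
    have := hl.continuous_ext; fun_prop
  have h0 := hl.pos
  have h1 : ext l (min s 0 - l 0) = l 0 := ext_of_nonpos (by linarith [min_le_right s 0])
  have h2 := hl.ext_ge s
  obtain ⟨t, -, ht⟩ := intermediate_value_Icc (a := min s 0 - l 0) (b := s)
    (by linarith [min_le_left s 0]) hc.continuousOn
    (show s ∈ Icc _ _ from ⟨by simp only [h1]; linarith [min_le_left s 0], by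
      linarith⟩)
  exact ⟨t, ht⟩

/-- The time at which the characteristic `t + x = s` meets the front. -/
noncomputable def IsFront.tau (hl : IsFront l) (s : ℝ) : ℝ := (hl.exists_tau s).choose

/-- The label `t - x` of the characteristic reflected by the front from `t + x = s`. -/
noncomputable def IsFront.omega (hl : IsFront l) (s : ℝ) : ℝ := 2 * hl.tau s - s

namespace IsFront

variable (hl : IsFront l)
include hl

theorem tau_add (s : ℝ) : hl.tau s + ext l (hl.tau s) = s := (hl.exists_tau s).choose_spec

theorem tau_mono : Monotone hl.tau := by
  intro s s' h
  by_contra! hlt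
  have := hl.ext_mono hlt.le
  linarith [hl.tau_add s, hl.tau_add s']

/-- The map t ↦ t + ext l t has slopes in [1, 2]. Its inverse τ therefore has slopes in [1/2, 1],
and ω = 2τ - s has slopes in [0, 1]. -/
theorem tau_sub_le {s s' : ℝ} (h : s ≤ s') : hl.tau s' - hl.tau s ≤ s' - s := by
  linarith [hl.tau_add s, hl.tau_add s', hl.ext_mono (hl.tau_mono h)]

theorem sub_le_two_mul_tau_sub {s s' : ℝ} (h : s ≤ s') :
    s' - s ≤ 2 * (hl.tau s' - hl.tau s) := by
  linarith [hl.tau_add s, hl.tau_add s', hl.ext_lip (hl.tau_mono h)]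

theorem tau_apply (t : ℝ) : hl.tau (t + ext l t) = t := by
  have h := hl.tau_add (t + ext l t)
  rcases le_total (hl.tau (t + ext l t)) t with h1 | h1
  · linarith [hl.ext_mono h1]
  · linarith [hl.ext_mono h1]

theorem omega_mono : Monotone hl.omega := by
  intro s s' h
  have := hl.sub_le_two_mul_tau_sub h
  unfold omega; linarith

theorem omega_sub_le {s s' : ℝ} (h : s ≤ s') : hl.omega s' - hl.omega s ≤ s' - s := by
  have := hl.tau_sub_le h
  unfold omega; linarith

theorem omega_eq (s : ℝ) : hl.omega s = hl.tau s - ext l (hl.tau s) := by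
  have := hl.tau_add s
  unfold omega; linarith

theorem omega_apply (t : ℝ) : hl.omega (t + ext l t) = t - ext l t := by
  rw [omega_eq, tau_apply]

theorem omega_le (s : ℝ) : hl.omega s ≤ s - 2 * l 0 := by
  have := hl.tau_add s
  have := hl.ext_ge (hl.tau s)
  unfold omega; linarith

theorem omega_le_tau (s : ℝ) : hl.omega s ≤ hl.tau s - l 0 := by
  rw [omega_eq]; linarith [hl.ext_ge (hl.tau s)]

/-- Between two reflections the label drops by at least `2 * l 0`, and τ has slope at least 1/2.
This time lag produces the contraction factor e^{-λℓ₀}. -/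
theorem tau_omega_le (s : ℝ) : hl.tau (hl.omega s) ≤ hl.tau s - l 0 := by
  have h1 := hl.omega_le s
  have h2 := hl.sub_le_two_mul_tau_sub (show hl.omega s ≤ s by linarith [hl.pos])
  linarith

theorem tau_nonpos {s : ℝ} (hs : s ≤ l 0) : hl.tau s ≤ 0 := by
  have h1 : hl.tau (0 + ext l 0) = 0 := hl.tau_apply 0
  rw [ext_of_nonneg le_rfl, zero_add] at h1
  rw [← h1]; exact hl.tau_mono hs

theorem neg_le_tau {s : ℝ} (hs : 0 ≤ s) : -l 0 ≤ hl.tau s := by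
  have h1 := hl.tau_apply (-l 0)
  rw [ext_of_nonpos (by linarith [hl.pos]), neg_add_cancel] at h1
  rw [← h1]; exact hl.tau_mono hs

theorem tau_le {t s : ℝ} (h : s ≤ t + ext l t) : hl.tau s ≤ t := by
  rw [← hl.tau_apply t]; exact hl.tau_mono h

end IsFront

theorem continuous_of_sub_le {σ : ℝ → ℝ} (hσ : Monotone σ)
    (h : ∀ s s', s ≤ s' → σ s' - σ s ≤ s' - s) : Continuous σ := by
  have : LipschitzWith 1 σ := by
    refine LipschitzWith.of_dist_le_mul fun s t => ?_
    rw [Real.dist_eq, Real.dist_eq, NNReal.coe_one, one_mul]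
    rcases le_total s t with h1 | h1
    · rw [abs_sub_comm, abs_sub_comm s, abs_of_nonneg (by linarith [hσ h1]),
        abs_of_nonneg (by linarith)]
      exact h _ _ h1
    · rw [abs_of_nonneg (by linarith [hσ h1]), abs_of_nonneg (by linarith)]
      exact h _ _ h1
  exact this.continuous

theorem IsFront.continuous_tau (hl : IsFront l) : Continuous hl.tau :=
  continuous_of_sub_le hl.tau_mono fun _ _ => hl.tau_sub_le

theorem IsFront.continuous_omega (hl : IsFront l) : Continuous hl.omega :=
  continuous_of_sub_le hl.omega_mono fun _ _ => hl.omega_sub_le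

end Characteristics

/-! ### Weighted estimates for the coupled equations of f and v. -/

section FixedPoint

variable {l : ℝ → ℝ}

/-- The outgoing wave produced at the front by the incoming data. -/
noncomputable def IsFront.reflect (hl : IsFront l) (k : ℝ) (f : ℝ → ℝ) (v : ℝ × ℝ → ℝ) (s : ℝ) : ℝ :=
  f (hl.omega s) + k * duhamel v (max (hl.omega s) 0, 0)
    - k * duhamel v (max (hl.tau s) 0, s - hl.tau s)

/-- The superposition of the two waves and the Duhamel term, without the boundary datum. -/
noncomputable def superpose (k : ℝ) (f : ℝ → ℝ) (v : ℝ × ℝ → ℝ) (p : ℝ × ℝ) : ℝ :=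
  f (p.1 + p.2) - f (p.1 - p.2) - k * duhamel v (max (p.1 - p.2) 0, 0) + k * duhamel v p

/-- The retraction of the plane onto the closed domain. -/
noncomputable def retract (l : ℝ → ℝ) (p : ℝ × ℝ) : ℝ × ℝ :=
  (max p.1 0, max 0 (min p.2 (ext l p.1)))

theorem IsFront.continuous_retract (hl : IsFront l) : Continuous (retract l) := by
  have := hl.continuous_ext
  unfold retract; fun_prop

theorem retract_of_mem {t x : ℝ} (ht : 0 ≤ t) (hx : 0 ≤ x) (hxl : x ≤ ext l t) :
    retract l (t, x) = (t, x) := by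
  simp [retract, ht, hx, hxl]

theorem IsFront.retract_mem (hl : IsFront l) (p : ℝ × ℝ) :
    0 ≤ (retract l p).1 ∧ 0 ≤ (retract l p).2 ∧ (retract l p).2 ≤ ext l (retract l p).1 := by
  refine ⟨le_max_right _ _, le_max_left _ _, ?_⟩
  simp only [retract]
  refine max_le ((hl.pos.le).trans (hl.ext_ge _)) ((min_le_right _ _).trans ?_)
  exact hl.ext_mono (le_max_left _ _)

theorem continuous_reflect (hl : IsFront l) (k : ℝ) {f : ℝ → ℝ} {v : ℝ × ℝ → ℝ} (hf : Continuous f)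
    (hv : Continuous v) : Continuous (hl.reflect k f v) := by
  have h1 := hl.continuous_tau
  have h2 := hl.continuous_omega
  have h3 := continuous_duhamel hv
  unfold IsFront.reflect
  fun_prop

theorem continuous_superpose (k : ℝ) {f : ℝ → ℝ} {v : ℝ × ℝ → ℝ} (hf : Continuous f)
    (hv : Continuous v) : Continuous (superpose k f v) := by
  have h3 := continuous_duhamel hv
  unfold superpose
  fun_prop

theorem reflect_sub (hl : IsFront l) (k : ℝ) {f f' : ℝ → ℝ} {v v' : ℝ × ℝ → ℝ}
    (hv : Continuous v) (hv' : Continuous v') (s : ℝ) :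
    hl.reflect k (fun s => f s - f' s) (fun p => v p - v' p) s
      = hl.reflect k f v s - hl.reflect k f' v' s := by
  simp only [IsFront.reflect, duhamel_sub hv hv']; ring

theorem superpose_sub (k : ℝ) {f f' : ℝ → ℝ} {v v' : ℝ × ℝ → ℝ}
    (hv : Continuous v) (hv' : Continuous v') (p : ℝ × ℝ) :
    superpose k (fun s => f s - f' s) (fun p => v p - v' p) p
      = superpose k f v p - superpose k f' v' p := by
  simp only [superpose, duhamel_sub hv hv']; ring

variable {k lam A : ℝ} {M : ℝ → ℝ} {f : ℝ → ℝ} {v : ℝ × ℝ → ℝ}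

theorem abs_mul_duhamel_le (hk : 0 ≤ k) (hlam : 0 < lam) (hkl : 128 * k ≤ lam ^ 2)
    (hM : Monotone M) (hM0 : ∀ t, 0 ≤ M t) (hA : 0 ≤ A) (hv : Continuous v)
    (hvA : ∀ t x, 0 ≤ t → |v (t, x)| ≤ A * (Real.exp (lam * t) * M t)) {t : ℝ} (ht : 0 ≤ t)
    (x : ℝ) : |k * duhamel v (t, x)| ≤ A / 64 * (Real.exp (lam * t) * M t) := by
  rw [abs_mul, abs_of_nonneg hk]
  have h1 := abs_duhamel_le hv hlam hM hM0 hA hvA ht x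
  have h2 : k * (2 / lam ^ 2) ≤ 1 / 64 := by
    rw [← mul_div_assoc, div_le_iff₀ (by positivity)]; linarith
  have h3 : 0 ≤ A * (Real.exp (lam * t) * M t) := by have := hM0 t; positivity
  calc _ ≤ k * (2 / lam ^ 2 * (A * (Real.exp (lam * t) * M t))) := by gcongr
    _ = k * (2 / lam ^ 2) * (A * (Real.exp (lam * t) * M t)) := by ring
    _ ≤ 1 / 64 * (A * (Real.exp (lam * t) * M t)) := by gcongr
    _ = _ := by ring

theorem abs_mul_duhamel_max_le (hk : 0 ≤ k) (hlam : 0 < lam) (hkl : 128 * k ≤ lam ^ 2)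
    (hM : Monotone M) (hM0 : ∀ t, 0 ≤ M t) (hA : 0 ≤ A) (hv : Continuous v)
    (hvA : ∀ t x, 0 ≤ t → |v (t, x)| ≤ A * (Real.exp (lam * t) * M t)) {t t' : ℝ} (ht : t ≤ t')
    (x : ℝ) : |k * duhamel v (max t 0, x)| ≤ A / 64 * (Real.exp (lam * t') * M t') := by
  have h0 := hM0 t'
  rcases le_total t 0 with h | h
  · rw [max_eq_right h, duhamel_zero_left, mul_zero, abs_zero]; positivity
  · rw [max_eq_left h]
    refine (abs_mul_duhamel_le hk hlam hkl hM hM0 hA hv hvA h x).trans ?_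
    have := hM ht
    have := hM0 t
    gcongr

/-- The constants are 1/8 · 1/4 + 1/64 + 1/64 = 1/16, half of the share 1/8 allotted to `f`. -/
theorem abs_reflect_le (hl : IsFront l) (hk : 0 ≤ k) (hlam : 0 < lam) (hkl : 128 * k ≤ lam ^ 2)
    (hq : Real.exp (-(lam * l 0)) ≤ 1 / 4)
    (hM : Monotone M) (hM0 : ∀ t, 0 ≤ M t) (hA : 0 ≤ A) (hv : Continuous v)
    (hfA : ∀ s, |f s| ≤ A / 8 * (Real.exp (lam * hl.tau s) * M (hl.tau s)))
    (hvA : ∀ t x, 0 ≤ t → |v (t, x)| ≤ A * (Real.exp (lam * t) * M t)) (s : ℝ) :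
    |hl.reflect k f v s| ≤ A / 16 * (Real.exp (lam * hl.tau s) * M (hl.tau s)) := by
  have hp := hl.pos
  set ρ := Real.exp (lam * hl.tau s) * M (hl.tau s) with hρ
  have h1 : |f (hl.omega s)| ≤ A / 8 * (1 / 4 * ρ) := by
    refine (hfA _).trans (mul_le_mul_of_nonneg_left ?_ (by positivity))
    have h2 : Real.exp (lam * hl.tau (hl.omega s)) ≤ 1 / 4 * Real.exp (lam * hl.tau s) := by
      calc _ ≤ Real.exp (-(lam * l 0) + lam * hl.tau s) := by
            apply Real.exp_le_exp.2
            nlinarith [hl.tau_omega_le s]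
        _ ≤ _ := by rw [Real.exp_add]; gcongr
    have h3 := hM (show hl.tau (hl.omega s) ≤ hl.tau s by linarith [hl.tau_omega_le s])
    have := hM0 (hl.tau (hl.omega s))
    rw [hρ, ← mul_assoc]
    gcongr
  have h2 := abs_mul_duhamel_max_le hk hlam hkl hM hM0 hA hv hvA
    (show hl.omega s ≤ hl.tau s by linarith [hl.omega_le_tau s]) 0
  have h3 := abs_mul_duhamel_max_le hk hlam hkl hM hM0 hA hv hvA (le_refl (hl.tau s))
    (s - hl.tau s)
  rw [IsFront.reflect]
  rw [abs_le] at *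
  constructor <;> linarith

/-- The constants are 1/8 + 1/8 + 1/64 + 1/64 ≤ 1/2. The share 1/8 of `f` is small because `f`
enters twice with no smallness of its own. -/
theorem abs_superpose_le (hl : IsFront l) (hk : 0 ≤ k) (hlam : 0 < lam) (hkl : 128 * k ≤ lam ^ 2)
    (hM : Monotone M) (hM0 : ∀ t, 0 ≤ M t) (hA : 0 ≤ A) (hv : Continuous v)
    (hfA : ∀ s, |f s| ≤ A / 8 * (Real.exp (lam * hl.tau s) * M (hl.tau s)))
    (hvA : ∀ t x, 0 ≤ t → |v (t, x)| ≤ A * (Real.exp (lam * t) * M t)) {t x : ℝ} (ht : 0 ≤ t)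
    (hx : 0 ≤ x) (hxl : x ≤ ext l t) :
    |superpose k f v (t, x)| ≤ A / 2 * (Real.exp (lam * t) * M t) := by
  have hp := hl.pos
  set ρ := Real.exp (lam * t) * M t with hρ
  have hρ0 : 0 ≤ A * ρ := by have := hM0 t; positivity
  have h1 : ∀ s, s ≤ t + ext l t → |f s| ≤ A / 8 * ρ := by
    intro s hs
    refine (hfA _).trans ?_
    have := hl.tau_le hs
    have := hM this
    have := hM0 (hl.tau s)
    rw [hρ]
    gcongr
  have h2 := abs_mul_duhamel_max_le hk hlam hkl hM hM0 hA hv hvA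
    (show t - x ≤ t by linarith) 0
  have h3 := abs_mul_duhamel_le hk hlam hkl hM hM0 hA hv hvA ht x
  have h4 := h1 (t + x) (by linarith)
  have h5 := h1 (t - x) (by linarith [hl.ext_ge t])
  rw [superpose]
  rw [abs_le] at *
  dsimp only
  constructor <;> linarith

end FixedPoint

/-! ### Solution of the coupled equations by contraction. -/

section FixedPoint

open scoped BoundedContinuousFunction

variable {l : ℝ → ℝ} {k : ℝ} {b c M : ℝ → ℝ}

/-- The second requirement makes `k * (2 / lam ^ 2)` at most 1/64, the third makes a reflection gain
a factor 1/4. The summand `3 / l₀` suffices because e³ ≥ 4. -/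
theorem exists_weight_rate {l₀ : ℝ} (hl₀ : 0 < l₀) (hk : 0 ≤ k) :
    ∃ lam : ℝ, 0 < lam ∧ 128 * k ≤ lam ^ 2 ∧ Real.exp (-(lam * l₀)) ≤ 1 / 4 := by
  refine ⟨1 + 3 / l₀ + 128 * k, by positivity, ?_, ?_⟩
  · have : 0 ≤ 3 / l₀ := by positivity
    nlinarith
  · have h1 : (3 : ℝ) ≤ (1 + 3 / l₀ + 128 * k) * l₀ := by
      have h2 : 3 / l₀ * l₀ = 3 := by field_simp
      nlinarith [mul_nonneg hk hl₀.le]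
    rw [Real.exp_neg, inv_le_comm₀ (Real.exp_pos _) (by norm_num)]
    have := Real.add_one_le_exp ((1 + 3 / l₀ + 128 * k) * l₀)
    linarith

theorem abs_weighted_le {A ρ x : ℝ} (hρ : 0 < ρ) (h : |x| ≤ A * ρ) : |x / ρ| ≤ A := by
  rwa [abs_div, abs_of_pos hρ, div_le_iff₀ hρ]

/-- The coupled equations for the outgoing wave `f` and the solution `v`, with incoming data `c` at
the front and `b` at the left end. -/
theorem exists_fixedPoint (hl : IsFront l) (hk : 0 ≤ k) (hc : Continuous c) (hb : Continuous b)
    (hc0 : ∀ s ≤ 0, c s = 0) (hMc : Continuous M) (hM : Monotone M) (hM1 : ∀ t, 1 ≤ M t) {C : ℝ}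
    (hcM : ∀ s, |c s| ≤ C * M (hl.tau s)) (hbM : ∀ t, |b t| ≤ C * M t) :
    ∃ (f : ℝ → ℝ) (v : ℝ × ℝ → ℝ), Continuous f ∧ Continuous v ∧ (∀ s ≤ 0, f s = 0) ∧
      (∀ s, f s = c s + hl.reflect k f v s) ∧
      ∀ t x, 0 ≤ t → 0 ≤ x → x ≤ ext l t → v (t, x) = b (t - x) + superpose k f v (t, x) := by
  have hp := hl.pos
  obtain ⟨lam, hlam, hkl, hq⟩ := exists_weight_rate hp hk
  have hM0 : ∀ t, 0 ≤ M t := fun t => zero_le_one.trans (hM1 t)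
  have hC : 0 ≤ C := nonneg_of_mul_nonneg_left ((abs_nonneg _).trans (hbM 0)) (by linarith [hM1 0])
  set ρ : ℝ → ℝ := fun t => Real.exp (lam * t) * M t with hρ
  have hρ0 : ∀ t, 0 < ρ t := fun t => mul_pos (Real.exp_pos _) (by linarith [hM1 t])
  have hρc : Continuous ρ := by fun_prop
  have hτc := hl.continuous_tau
  have hret := hl.continuous_retract
  -- The unknowns are parametrised by bounded continuous functions, from which the weights are
  -- factored out.
  set fF : (ℝ →ᵇ ℝ) → ℝ → ℝ := fun F s => ρ (hl.tau s) / 8 * F s with hfF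
  set vV : (ℝ × ℝ →ᵇ ℝ) → ℝ × ℝ → ℝ := fun V p => ρ (max p.1 0) * V p with hvV
  have hfc : ∀ F, Continuous (fF F) := fun F => by fun_prop
  have hvc : ∀ V, Continuous (vV V) := fun V => by fun_prop
  have hfA : ∀ (F F' : ℝ →ᵇ ℝ) s, |fF F s - fF F' s| ≤ dist F F' / 8 * ρ (hl.tau s) := by
    intro F F' s
    have h1 := BoundedContinuousFunction.dist_coe_le_dist (f := F) (g := F') s
    rw [Real.dist_eq] at h1
    have h2 := (hρ0 (hl.tau s)).le
    rw [hfF]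
    simp only
    rw [← mul_sub, abs_mul, abs_of_nonneg (by positivity)]
    calc _ ≤ ρ (hl.tau s) / 8 * dist F F' := by gcongr
      _ = _ := by ring
  have hvA : ∀ (V V' : ℝ × ℝ →ᵇ ℝ) t x, 0 ≤ t → |vV V (t, x) - vV V' (t, x)| ≤
      dist V V' * ρ t := by
    intro V V' t x ht
    have h1 := BoundedContinuousFunction.dist_coe_le_dist (f := V) (g := V') (t, x)
    rw [Real.dist_eq] at h1
    have h2 := (hρ0 t).le
    rw [hvV]
    simp only
    rw [max_eq_left ht, ← mul_sub, abs_mul, abs_of_nonneg h2, mul_comm]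
    gcongr
  set g₁ : (ℝ →ᵇ ℝ) × (ℝ × ℝ →ᵇ ℝ) → ℝ → ℝ := fun X s =>
    (c s + hl.reflect k (fF X.1) (vV X.2) s) / (ρ (hl.tau s) / 8) with hg₁
  -- Composition with `retract` extends the equation continuously to the plane. The cone in the
  -- Duhamel term may leave the domain, but only the values of `v` on the domain matter for the wave
  -- equation there.
  set g₂ : (ℝ →ᵇ ℝ) × (ℝ × ℝ →ᵇ ℝ) → ℝ × ℝ → ℝ := fun X p =>
    (b ((retract l p).1 - (retract l p).2) + superpose k (fF X.1) (vV X.2) (retract l p))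
      / ρ (max p.1 0) with hg₂
  have hg₁c : ∀ X, Continuous (g₁ X) := by
    intro X
    have h1 := continuous_reflect hl k (hfc X.1) (hvc X.2)
    exact (hc.add h1).div (by fun_prop) fun s => (div_pos (hρ0 _) (by norm_num)).ne'
  have hg₂c : ∀ X, Continuous (g₂ X) := by
    intro X
    have h1 := continuous_superpose k (hfc X.1) (hvc X.2)
    exact ((hb.comp (hret.fst.sub hret.snd)).add (h1.comp hret)).div (by fun_prop)
      fun s => (hρ0 _).ne'
  have hd₁ : ∀ X Y s, |g₁ X s - g₁ Y s| ≤ 1 / 2 * dist X Y := by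
    intro X Y s
    have h1 : g₁ X s - g₁ Y s = hl.reflect k (fun s => fF X.1 s - fF Y.1 s)
        (fun p => vV X.2 p - vV Y.2 p) s / (ρ (hl.tau s) / 8) := by
      rw [reflect_sub hl k (hvc _) (hvc _)]
      simp only [hg₁]; ring
    rw [h1]
    refine abs_weighted_le (div_pos (hρ0 _) (by norm_num)) ?_
    have := abs_reflect_le (A := dist X Y) hl hk hlam hkl hq hM hM0 dist_nonneg
      ((hvc X.2).sub (hvc Y.2)) (f := fun s => fF X.1 s - fF Y.1 s) (fun s => (hfA _ _ s).trans ?_)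
      (fun t x ht => (hvA _ _ t x ht).trans ?_) s
    · refine this.trans (le_of_eq ?_)
      simp only [hρ]; ring
    · have := (hρ0 (hl.tau s)).le
      gcongr; exact le_max_left _ _
    · have := (hρ0 t).le
      gcongr; exact le_max_right _ _
  have hd₂ : ∀ X Y p, |g₂ X p - g₂ Y p| ≤ 1 / 2 * dist X Y := by
    intro X Y p
    have h1 : g₂ X p - g₂ Y p = superpose k (fun s => fF X.1 s - fF Y.1 s)
        (fun p => vV X.2 p - vV Y.2 p) (retract l p) / ρ (max p.1 0) := by
      rw [superpose_sub k (hvc _) (hvc _)]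
      simp only [hg₂]; ring
    rw [h1]
    refine abs_weighted_le (hρ0 _) ?_
    obtain ⟨r1, r2, r3⟩ := hl.retract_mem p
    have := abs_superpose_le (A := dist X Y) hl hk hlam hkl hM hM0 dist_nonneg
      ((hvc X.2).sub (hvc Y.2)) (f := fun s => fF X.1 s - fF Y.1 s) (fun s => (hfA _ _ s).trans ?_)
      (fun t x ht => (hvA _ _ t x ht).trans ?_) r1 r2 r3
    · refine this.trans (le_of_eq ?_)
      simp only [hρ, retract]; ring
    · have := (hρ0 (hl.tau s)).le
      gcongr; exact le_max_left _ _
    · have := (hρ0 t).le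
      gcongr; exact le_max_right _ _
  -- The weight degenerates as τ → -∞, but `c` vanishes for s ≤ 0 and τ ≥ -ℓ(0) for s ≥ 0.
  have hzero₁ : ∀ s, |g₁ 0 s| ≤ 8 * (C * Real.exp (lam * l 0)) := by
    intro s
    have h1 : g₁ 0 s = c s / (ρ (hl.tau s) / 8) := by
      simp [hg₁, hfF, hvV, IsFront.reflect, duhamel, charInt, prim]
    rw [h1]
    refine abs_weighted_le (div_pos (hρ0 _) (by norm_num)) ?_
    have h5 := hM0 (hl.tau s)
    rcases le_total s 0 with h | h
    · rw [hc0 s h, abs_zero]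
      have := (hρ0 (hl.tau s)).le
      positivity
    · have h2 : 1 ≤ Real.exp (lam * l 0) * Real.exp (lam * hl.tau s) := by
        rw [← Real.exp_add]
        exact Real.one_le_exp (by nlinarith [hl.neg_le_tau h])
      calc |c s| ≤ C * M (hl.tau s) * 1 := by rw [mul_one]; exact hcM s
        _ ≤ C * M (hl.tau s) * (Real.exp (lam * l 0) * Real.exp (lam * hl.tau s)) := by gcongr
        _ = _ := by simp only [hρ]; ring
  have hzero₂ : ∀ p, |g₂ 0 p| ≤ C := by
    intro p
    have h1 : g₂ 0 p = b ((retract l p).1 - (retract l p).2) / ρ (max p.1 0) := by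
      simp [hg₂, hfF, hvV, superpose, duhamel, charInt, prim]
    rw [h1]
    refine abs_weighted_le (hρ0 _) ((hbM _).trans ?_)
    obtain ⟨r1, r2, r3⟩ := hl.retract_mem p
    have h2 : M ((retract l p).1 - (retract l p).2) ≤ M (max p.1 0) := hM (by
      have : (retract l p).1 = max p.1 0 := rfl
      linarith)
    have h3 : 1 ≤ Real.exp (lam * max p.1 0) := Real.one_le_exp (by positivity)
    have h4 := hM0 (max p.1 0)
    have h5 : M (max p.1 0) ≤ ρ (max p.1 0) := by simp only [hρ]; nlinarith
    exact mul_le_mul_of_nonneg_left (h2.trans h5) hC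
  have hb₁ : ∀ X s, ‖g₁ X s‖ ≤ 1 / 2 * dist X 0 + 8 * (C * Real.exp (lam * l 0)) := by
    intro X s
    have := abs_sub_abs_le_abs_sub (g₁ X s) (g₁ 0 s)
    rw [Real.norm_eq_abs]
    linarith [hd₁ X 0 s, hzero₁ s]
  have hb₂ : ∀ X p, ‖g₂ X p‖ ≤ 1 / 2 * dist X 0 + C := by
    intro X p
    have := abs_sub_abs_le_abs_sub (g₂ X p) (g₂ 0 p)
    rw [Real.norm_eq_abs]
    linarith [hd₂ X 0 p, hzero₂ p]
  set T : (ℝ →ᵇ ℝ) × (ℝ × ℝ →ᵇ ℝ) → (ℝ →ᵇ ℝ) × (ℝ × ℝ →ᵇ ℝ) := fun X =>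
    (BoundedContinuousFunction.ofNormedAddCommGroup (g₁ X) (hg₁c X) _ (hb₁ X),
      BoundedContinuousFunction.ofNormedAddCommGroup (g₂ X) (hg₂c X) _ (hb₂ X)) with hT
  have hcontr : ContractingWith (1 / 2) T := by
    refine ⟨by norm_num, LipschitzWith.of_dist_le_mul fun X Y => ?_⟩
    have h0 : (0 : ℝ) ≤ 1 / 2 * dist X Y := by positivity
    have e1 : (((1 / 2 : NNReal)) : ℝ) = 1 / 2 := by norm_num
    rw [e1]
    refine max_le ?_ ?_
    · exact (BoundedContinuousFunction.dist_le h0).2 fun s => by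
        rw [Real.dist_eq]; exact hd₁ X Y s
    · exact (BoundedContinuousFunction.dist_le h0).2 fun p => by
        rw [Real.dist_eq]; exact hd₂ X Y p
  set X := hcontr.fixedPoint T with hX
  have hfix : T X = X := hcontr.fixedPoint_isFixedPt
  have hfix₁ : ∀ s, g₁ X s = X.1 s := fun s => by
    conv_rhs => rw [← hfix]
    rfl
  have hfix₂ : ∀ p, g₂ X p = X.2 p := fun p => by
    conv_rhs => rw [← hfix]
    rfl
  have heq₁ : ∀ s, fF X.1 s = c s + hl.reflect k (fF X.1) (vV X.2) s := by
    intro s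
    have h1 : fF X.1 s = ρ (hl.tau s) / 8 * g₁ X s := by rw [hfix₁]
    rw [h1]
    exact mul_div_cancel₀ _ (div_pos (hρ0 _) (by norm_num)).ne'
  refine ⟨fF X.1, vV X.2, hfc _, hvc _, ?_, heq₁, ?_⟩
  -- For s ≤ 0 the equation reduces to f(s) = f(ω(s)). Each iteration gains a factor 1/4 in the
  -- weighted bound, which forces f(s) = 0.
  · set B := ‖X.1‖ / 8 with hB
    have hbd : ∀ n : ℕ, ∀ s ≤ 0, |fF X.1 s| ≤ (1 / 4) ^ n * (B * ρ (hl.tau s)) := by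
      intro n
      induction n with
      | zero =>
        intro s _
        have h1 := X.1.norm_coe_le_norm s
        rw [Real.norm_eq_abs] at h1
        have h2 := (hρ0 (hl.tau s)).le
        rw [hfF]
        simp only
        rw [abs_mul, abs_of_nonneg (by positivity)]
        calc _ ≤ ρ (hl.tau s) / 8 * ‖X.1‖ := by gcongr
          _ = _ := by rw [hB]; ring
      | succ n ih =>
        intro s hs
        have h1 : hl.omega s ≤ 0 := by linarith [hl.omega_le s]
        have h2 : hl.tau s ≤ 0 := hl.tau_nonpos (by linarith)
        have h3 : fF X.1 s = fF X.1 (hl.omega s) := by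
          rw [heq₁ s, hc0 s hs, IsFront.reflect, max_eq_right h1, max_eq_right h2,
            duhamel_zero_left, duhamel_zero_left]
          ring
        rw [h3]
        refine (ih _ h1).trans ?_
        have h4 : ρ (hl.tau (hl.omega s)) ≤ 1 / 4 * ρ (hl.tau s) := by
          have h5 : Real.exp (lam * hl.tau (hl.omega s)) ≤ 1 / 4 * Real.exp (lam * hl.tau s) := by
            calc _ ≤ Real.exp (-(lam * l 0) + lam * hl.tau s) := by
                  apply Real.exp_le_exp.2
                  nlinarith [hl.tau_omega_le s]
              _ ≤ _ := by rw [Real.exp_add]; gcongr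
          have h6 := hM (show hl.tau (hl.omega s) ≤ hl.tau s by linarith [hl.tau_omega_le s])
          have h7 := hM0 (hl.tau (hl.omega s))
          simp only [hρ]
          rw [← mul_assoc]
          gcongr
        calc _ ≤ (1 / 4) ^ n * (B * (1 / 4 * ρ (hl.tau s))) := by gcongr
          _ = _ := by ring
    intro s hs
    have hlim : Tendsto (fun n : ℕ => (1 / 4 : ℝ) ^ n * (B * ρ (hl.tau s))) atTop (𝓝 0) := by
      simpa using (tendsto_pow_atTop_nhds_zero_of_lt_one (by norm_num) (by norm_num :
        (1 / 4 : ℝ) < 1)).mul_const (B * ρ (hl.tau s))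
    have := ge_of_tendsto' hlim fun n => hbd n s hs
    exact abs_eq_zero.1 (le_antisymm this (abs_nonneg _))
  · intro t x ht hx hxl
    have h1 : vV X.2 (t, x) = ρ (max t 0) * g₂ X (t, x) := by rw [hfix₂]
    rw [h1]
    simp only [hg₂, retract_of_mem ht hx hxl]
    exact mul_div_cancel₀ _ (hρ0 _).ne'

end FixedPoint

/-! ### Primitives of L²_loc functions and the increment inequality. -/

section LocalL2

variable {f g h h' σ : ℝ → ℝ} {S S' : ℝ}

/-- `h ∈ L²_loc(ℝ)`. -/
def LocL2 (h : ℝ → ℝ) : Prop := ∀ a b : ℝ, MemLp h 2 (volume.restrict (Ioc a b))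

/-- `f` is a primitive of the locally square integrable function `h`. -/
structure IsPrimitive (f h : ℝ → ℝ) : Prop where
  locL2 : LocL2 h
  integral_eq : ∀ a b, ∫ x in a..b, h x = f b - f a

theorem LocL2.add (hh : LocL2 h) (hh' : LocL2 h') : LocL2 fun x => h x + h' x :=
  fun a b => (hh a b).add (hh' a b)

theorem LocL2.const_mul (hh : LocL2 h) (c : ℝ) : LocL2 fun x => c * h x :=
  fun a b => (hh a b).const_mul c

theorem LocL2.integrableOn (hh : LocL2 h) (a b : ℝ) : IntegrableOn h (Ioc a b) :=
  (hh a b).integrable (by norm_num)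

theorem LocL2.intervalIntegrable (hh : LocL2 h) (a b : ℝ) : IntervalIntegrable h volume a b :=
  ⟨hh.integrableOn a b, hh.integrableOn b a⟩

theorem LocL2.sq_intervalIntegrable (hh : LocL2 h) (a b : ℝ) :
    IntervalIntegrable (fun x => h x ^ 2) volume a b :=
  ⟨(hh a b).integrable_sq, (hh b a).integrable_sq⟩

theorem LocL2.memLp_subset (hh : LocL2 h) {s : Set ℝ} {a b : ℝ} (hs : s ⊆ Ioc a b) :
    MemLp h 2 (volume.restrict s) := (hh a b).mono_measure (Measure.restrict_mono hs le_rfl)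

theorem LocL2.locallyIntegrable (hh : LocL2 h) : LocallyIntegrable h := by
  intro x
  exact ⟨Ioc (x - 1) (x + 1), Ioc_mem_nhds (by linarith) (by linarith), hh.integrableOn _ _⟩

theorem LocL2.isPrimitive (hh : LocL2 h) (c x₀ : ℝ) :
    IsPrimitive (fun x => c + ∫ y in x₀..x, h y) h := by
  refine ⟨hh, fun a b => ?_⟩
  rw [add_sub_add_left_eq_sub, intervalIntegral.integral_interval_sub_left] <;>
    exact hh.intervalIntegrable _ _

theorem LocL2.indicator (hh : LocL2 h) {s : Set ℝ} (hs : MeasurableSet s) :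
    LocL2 (s.indicator h) := fun a b => (hh a b).indicator hs

theorem LocL2.of_continuous (hh : Continuous h) : LocL2 h := by
  intro a b
  obtain ⟨C, hC⟩ := isCompact_Icc.exists_bound_of_continuousOn (s := Icc a b) hh.continuousOn
  refine MemLp.of_bound hh.aestronglyMeasurable C ?_
  filter_upwards [ae_restrict_mem measurableSet_Ioc] with x hx using hC x (Ioc_subset_Icc_self hx)

theorem IsPrimitive.continuous (hf : IsPrimitive f h) : Continuous f := by
  have h1 : f = fun x => f 0 + ∫ y in (0 : ℝ)..x, h y := by
    funext x; rw [hf.integral_eq]; ring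
  rw [h1]
  exact continuous_const.add
    (intervalIntegral.continuous_primitive (fun a b => hf.locL2.intervalIntegrable a b) 0)

theorem IsPrimitive.ae_hasDerivAt (hf : IsPrimitive f h) : ∀ᵐ x, HasDerivAt f (h x) x := by
  filter_upwards [_root_.LocallyIntegrable.ae_hasDerivAt_integral hf.locL2.locallyIntegrable] with x hx
  have h1 : f = fun x => f 0 + ∫ y in (0 : ℝ)..x, h y := by
    funext x; rw [hf.integral_eq]; ring
  rw [h1]
  exact (hx 0).const_add _

/-- `f` has an increment of order `1 / 2` controlled by a continuous nondecreasing energy on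
`(-∞, S]`. -/
def EnergyOn (S : ℝ) (f : ℝ → ℝ) : Prop :=
  ∃ E : ℝ → ℝ, Monotone E ∧ Continuous E ∧
    ∀ a b, a ≤ b → b ≤ S → (f b - f a) ^ 2 ≤ (b - a) * (E b - E a)

theorem EnergyOn.mono (hf : EnergyOn S f) (hS : S' ≤ S) : EnergyOn S' f := by
  obtain ⟨E, h1, h2, h3⟩ := hf
  exact ⟨E, h1, h2, fun a b hab hb => h3 a b hab (hb.trans hS)⟩

theorem EnergyOn.congr (hf : EnergyOn S f) (h : ∀ s ≤ S, g s = f s) : EnergyOn S g := by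
  obtain ⟨E, h1, h2, h3⟩ := hf
  refine ⟨E, h1, h2, fun a b hab hb => ?_⟩
  rw [h a (hab.trans hb), h b hb]
  exact h3 a b hab hb

theorem EnergyOn.add (hf : EnergyOn S f) (hg : EnergyOn S g) :
    EnergyOn S fun s => f s + g s := by
  obtain ⟨E, h1, h2, h3⟩ := hf
  obtain ⟨E', h1', h2', h3'⟩ := hg
  refine ⟨fun s => 2 * E s + 2 * E' s, ?_, by fun_prop, fun a b hab hb => ?_⟩
  · intro a b hab
    have := h1 hab
    have := h1' hab
    simp only; linarith
  · nlinarith [h3 a b hab hb, h3' a b hab hb, sq_nonneg ((f b - f a) - (g b - g a))]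

theorem EnergyOn.const_mul (hf : EnergyOn S f) (c : ℝ) : EnergyOn S fun s => c * f s := by
  obtain ⟨E, h1, h2, h3⟩ := hf
  refine ⟨fun s => c ^ 2 * E s, fun a b hab => ?_, by fun_prop, fun a b hab hb => ?_⟩
  · have := h1 hab
    simp only; gcongr
  · nlinarith [mul_le_mul_of_nonneg_left (h3 a b hab hb) (sq_nonneg c)]

theorem EnergyOn.sub (hf : EnergyOn S f) (hg : EnergyOn S g) :
    EnergyOn S fun s => f s - g s :=
  (hf.add (hg.const_mul (-1))).congr fun s _ => by ring

/-- This stability is the reason for working with `EnergyOn`: no chain rule is involved, and ω may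
well be constant on intervals, namely where the front moves with speed 1. -/
theorem EnergyOn.comp (hf : EnergyOn S' f) (hσ : Monotone σ)
    (hσ1 : ∀ s s', s ≤ s' → σ s' - σ s ≤ s' - s) (hS : ∀ s ≤ S, σ s ≤ S') :
    EnergyOn S fun s => f (σ s) := by
  obtain ⟨E, h1, h2, h3⟩ := hf
  have hσc : Continuous σ := continuous_of_sub_le hσ hσ1
  refine ⟨fun s => E (σ s), h1.comp hσ, by fun_prop, fun a b hab hb => ?_⟩
  refine (h3 _ _ (hσ hab) (hS b hb)).trans ?_
  have := h1 (hσ hab)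
  exact mul_le_mul_of_nonneg_right (hσ1 a b hab) (by linarith)

theorem energyOn_of_lipschitz {L : ℝ}
    (h : ∀ a b, a ≤ b → b ≤ S → |f b - f a| ≤ L * (b - a)) : EnergyOn S f := by
  refine ⟨fun s => L ^ 2 * s, fun a b hab => by simp only; gcongr, by fun_prop,
    fun a b hab hb => ?_⟩
  have h1 := h a b hab hb
  have h2 := pow_le_pow_left₀ (abs_nonneg _) h1 2
  rw [sq_abs] at h2
  linarith

theorem sq_integral_le (hh : LocL2 h) {a b : ℝ} (hab : a ≤ b) :
    (∫ x in a..b, h x) ^ 2 ≤ (b - a) * ∫ x in a..b, h x ^ 2 := by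
  rcases hab.eq_or_lt with rfl | hlt
  · simp
  set I := ∫ x in a..b, h x with hI
  set m := I / (b - a) with hm
  have h1 : 0 ≤ ∫ x in a..b, (h x - m) ^ 2 :=
    intervalIntegral.integral_nonneg hab fun x _ => sq_nonneg _
  have i1 := hh.sq_intervalIntegrable a b
  have i2 := hh.intervalIntegrable a b
  have h2 : ∫ x in a..b, (h x - m) ^ 2 = (∫ x in a..b, h x ^ 2) - 2 * m * I + m ^ 2 * (b - a) := by
    have e1 : ∀ x, (h x - m) ^ 2 = (h x ^ 2 - 2 * m * h x) + m ^ 2 := fun x => by ring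
    simp_rw [e1]
    rw [intervalIntegral.integral_add (i1.sub (i2.const_mul _)) (by simp),
      intervalIntegral.integral_sub i1 (i2.const_mul _), intervalIntegral.integral_const_mul]
    simp; ring
  rw [h2] at h1
  have hba : 0 < b - a := by linarith
  have h3 : m * (b - a) = I := by rw [hm]; field_simp
  nlinarith

theorem IsPrimitive.energyOn (hf : IsPrimitive f h) (S : ℝ) : EnergyOn S f := by
  have hsq := hf.locL2.sq_intervalIntegrable
  have hE : ∀ a b : ℝ, (∫ x in (0 : ℝ)..b, h x ^ 2) - ∫ x in (0 : ℝ)..a, h x ^ 2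
      = ∫ x in a..b, h x ^ 2 := fun a b =>
    intervalIntegral.integral_interval_sub_left (hsq _ _) (hsq _ _)
  refine ⟨fun s => ∫ x in (0 : ℝ)..s, h x ^ 2, fun a b hab => ?_,
    intervalIntegral.continuous_primitive (fun a b => hsq a b) 0, fun a b hab _ => ?_⟩
  · have : 0 ≤ ∫ x in a..b, h x ^ 2 :=
      intervalIntegral.integral_nonneg hab fun x _ => sq_nonneg _
    simp only
    linarith [hE a b]
  · rw [hE, ← hf.integral_eq]
    exact sq_integral_le hf.locL2 hab

/-- The increments are the masses of disjoint intervals for the Stieltjes measure of `E`. -/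
theorem sum_sub_le_of_disjoint {E : ℝ → ℝ} (hE : Monotone E) (hEc : Continuous E) {a b : ℝ}
    (hab : a ≤ b) {n : ℕ} {I : ℕ → ℝ × ℝ}
    (hI : (n, I) ∈ AbsolutelyContinuousOnInterval.disjWithin a b) :
    ∑ i ∈ Finset.range n, (E (max (I i).1 (I i).2) - E (min (I i).1 (I i).2)) ≤ E b - E a := by
  set μ := (StieltjesFunction.mk E hE fun x => hEc.continuousWithinAt).measure with hμ
  have hIoc : ∀ x y, μ (Ioc x y) = ENNReal.ofReal (E y - E x) := fun x y =>
    StieltjesFunction.measure_Ioc _ x y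
  have h1 : ∑ i ∈ Finset.range n, ENNReal.ofReal (E (max (I i).1 (I i).2) - E (min (I i).1 (I i).2))
      ≤ ENNReal.ofReal (E b - E a) := by
    calc _ = ∑ i ∈ Finset.range n, μ (uIoc (I i).1 (I i).2) :=
          Finset.sum_congr rfl fun i _ => (hIoc _ _).symm
      _ = μ (⋃ i ∈ Finset.range n, uIoc (I i).1 (I i).2) :=
          (measure_biUnion_finset hI.2 fun i _ => measurableSet_uIoc).symm
      _ ≤ μ (Ioc a b) := by
          refine measure_mono ?_
          rw [← uIoc_of_le hab]
          exact AbsolutelyContinuousOnInterval.biUnion_uIoc_subset_of_mem_disjWithin hI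
      _ = _ := hIoc a b
  rw [← ENNReal.ofReal_sum_of_nonneg] at h1
  · exact (ENNReal.ofReal_le_ofReal_iff (sub_nonneg.2 (hE hab))).1 h1
  · exact fun i _ => sub_nonneg.2 (hE min_le_max)

/-- By Young's inequality, √(XY) ≤ λX/2 + Y/(2λ) with X the length of an interval and Y its energy
increment. The energies of disjoint intervals sum to at most `D`. -/
theorem EnergyOn.absolutelyContinuousOnInterval (hf : EnergyOn S f) {a b : ℝ} (hab : a ≤ b)
    (hb : b ≤ S) : AbsolutelyContinuousOnInterval f a b := by
  obtain ⟨E, h1, h2, h3⟩ := hf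
  rw [absolutelyContinuousOnInterval_iff]
  intro ε hε
  set D := E b - E a with hD
  have hD0 : 0 ≤ D := sub_nonneg.2 (h1 hab)
  -- With total length below `ε / lam`, the length part is at most ε / 2 and the energy part `D / (2
  -- * lam)` is less than ε / 2.
  set lam := (D + 1) / ε with hlam
  have hlam0 : 0 < lam := by positivity
  refine ⟨ε / lam, by positivity, fun (n, I) hI hlen => ?_⟩
  have hterm : ∀ i ∈ Finset.range n, dist (f (I i).1) (f (I i).2) ≤
      lam / 2 * dist (I i).1 (I i).2
        + 1 / (2 * lam) * (E (max (I i).1 (I i).2) - E (min (I i).1 (I i).2)) := by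
    intro i hi
    obtain ⟨hi1, hi2⟩ := hI.1 i hi
    rw [uIcc_of_le hab] at hi1 hi2
    have key : ∀ x y, x ≤ y → y ≤ S → |f y - f x| ≤ lam / 2 * (y - x)
        + 1 / (2 * lam) * (E y - E x) := by
      intro x y hxy hy
      have h4 := h3 x y hxy hy
      have h5 := h1 hxy
      refine abs_le_of_sq_le_sq (h4.trans ?_) (by
        have : 0 ≤ E y - E x := by linarith
        have : 0 ≤ y - x := by linarith
        positivity)
      have e1 : (y - x) * (E y - E x) = 4 * (lam / 2 * (y - x)) * (1 / (2 * lam) * (E y - E x)) := by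
        field_simp
        ring
      rw [e1]
      nlinarith [sq_nonneg (lam / 2 * (y - x) - 1 / (2 * lam) * (E y - E x))]
    simp only [Real.dist_eq]
    rcases le_total (I i).1 (I i).2 with h | h
    · rw [max_eq_right h, min_eq_left h, abs_sub_comm, abs_sub_comm (I i).1, abs_of_nonneg
        (by linarith : 0 ≤ (I i).2 - (I i).1)]
      exact key _ _ h (hi2.2.trans hb)
    · rw [max_eq_left h, min_eq_right h, abs_of_nonneg (by linarith : 0 ≤ (I i).1 - (I i).2)]
      exact key _ _ h (hi1.2.trans hb)
  have hs := sum_sub_le_of_disjoint h1 h2 hab hI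
  calc ∑ i ∈ Finset.range n, dist (f (I i).1) (f (I i).2)
      ≤ lam / 2 * (∑ i ∈ Finset.range n, dist (I i).1 (I i).2) + 1 / (2 * lam) *
        ∑ i ∈ Finset.range n, (E (max (I i).1 (I i).2) - E (min (I i).1 (I i).2)) := by
        rw [Finset.mul_sum, Finset.mul_sum, ← Finset.sum_add_distrib]
        exact Finset.sum_le_sum hterm
    _ ≤ lam / 2 * (ε / lam) + 1 / (2 * lam) * D := by
        gcongr
    _ < ε := by
        have e1 : lam / 2 * (ε / lam) = ε / 2 := by field_simp
        have e2 : 1 / (2 * lam) * D = ε / 2 * (D / (D + 1)) := by rw [hlam]; field_simp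
        have e3 : D / (D + 1) < 1 := by rw [div_lt_one (by positivity)]; linarith
        rw [e1, e2]
        nlinarith

theorem EnergyOn.sq_deriv_le {E : ℝ → ℝ} {d D x : ℝ} (hx : x < S)
    (h : ∀ a b, a ≤ b → b ≤ S → (f b - f a) ^ 2 ≤ (b - a) * (E b - E a))
    (hf : HasDerivAt f d x) (hE : HasDerivAt E D x) : d ^ 2 ≤ D := by
  have h1 := (hf.tendsto_slope.mono_left (nhdsWithin_mono x (fun y hy => ne_of_gt hy :
    Ioi x ⊆ {x}ᶜ))).pow 2
  have h2 := hE.tendsto_slope.mono_left (nhdsWithin_mono x (fun y hy => ne_of_gt hy :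
    Ioi x ⊆ {x}ᶜ))
  refine le_of_tendsto_of_tendsto h1 h2 ?_
  filter_upwards [Ioo_mem_nhdsGT hx] with y hy
  have hpos : 0 < y - x := by linarith [hy.1]
  rw [slope_def_field, slope_def_field, div_pow, div_le_div_iff₀ (by positivity) hpos]
  nlinarith [h x y hy.1.le hy.2.le]

/-- Absolute continuity gives the fundamental theorem of calculus. Passing to the limit in the
increment inequality gives f'² ≤ E', and the derivative of a monotone function is locally
integrable. -/
theorem isPrimitive_deriv (hf : ∀ S, EnergyOn S f) : IsPrimitive f (deriv f) := by
  have hac : ∀ a b, a ≤ b → AbsolutelyContinuousOnInterval f a b := fun a b hab =>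
    (hf b).absolutelyContinuousOnInterval hab le_rfl
  refine ⟨fun a b => ?_, fun a b => ?_⟩
  · rcases le_total a b with hab | hab
    · obtain ⟨E, h1, h2, h3⟩ := hf (b + 1)
      have hm : AEStronglyMeasurable (deriv f) (volume.restrict (Ioc a b)) :=
        (measurable_deriv f).aestronglyMeasurable
      rw [memLp_two_iff_integrable_sq hm]
      have hEi : IntegrableOn (deriv E) (Ioc a b) :=
        (h1.monotoneOn (uIcc a b)).intervalIntegrable_deriv.1
      refine Integrable.mono' hEi (hm.pow 2) ?_
      rw [ae_restrict_iff' measurableSet_Ioc]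
      filter_upwards [(hac a b hab).ae_differentiableAt, h1.ae_differentiableAt] with x hx1 hx2 hx
      rw [Real.norm_eq_abs, abs_of_nonneg (sq_nonneg _)]
      refine EnergyOn.sq_deriv_le (by linarith [hx.2]) h3 (hx1 ?_).hasDerivAt hx2.hasDerivAt
      rw [uIcc_of_le hab]; exact Ioc_subset_Icc_self hx
    · rw [Ioc_eq_empty (by linarith)]; simp
  · rcases le_total a b with hab | hab
    · exact (hac a b hab).integral_deriv_eq_sub
    · rw [intervalIntegral.integral_symm, (hac b a hab).integral_deriv_eq_sub]; ring

end LocalL2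

/-! ### Weak derivatives from increments along lines. -/

section LineDerivative

variable {E : Type*} [NormedAddCommGroup E] [NormedSpace ℝ E] [FiniteDimensional ℝ E]
  [MeasureSpace E] [BorelSpace E] [(volume : Measure E).IsAddHaarMeasure]
  {u D φ : E → ℝ} {U : Set E} {e : E}

theorem LocallyIntegrable.comp_add_right' (hD : LocallyIntegrable D) (c : E) :
    LocallyIntegrable fun p => D (p + c) :=
  (locallyIntegrable_map_homeomorph (Homeomorph.addRight c) (f := D) (μ := volume)).1 (by
    rw [Homeomorph.coe_addRight, map_add_right_eq_self]; exact hD)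

theorem continuous_integral_mul_translate (hD : LocallyIntegrable D) {ψ : E → ℝ}
    (hψ : Continuous ψ) (hψc : HasCompactSupport ψ) (e : E) :
    Continuous fun s : ℝ => ∫ p, D (p + s • e) * ψ p := by
  have hψc' : HasCompactSupport fun p => ψ (-p) := hψc.comp_homeomorph (Homeomorph.neg E)
  have h1 := hψc'.continuous_convolution_right (ContinuousLinearMap.mul ℝ ℝ) hD
    (hψ.comp continuous_neg)
  have h2 : Continuous fun s : ℝ => s • e := by fun_prop
  convert h1.comp h2 using 1
  funext s
  simp only [Function.comp, MeasureTheory.convolution, ContinuousLinearMap.mul_apply']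
  rw [← integral_add_right_eq_self (fun t => D t * ψ (-(s • e - t))) (s • e)]
  simp

theorem integrable_translate_mul_test (hDm : Measurable D) (hD : LocallyIntegrable D)
    (hφ : IsTest U φ) (e : E) (r : ℝ) :
    Integrable (fun q : ℝ × E => D (q.2 + q.1 • e) * φ q.2)
      ((volume.restrict (uIoc 0 r)).prod volume) := by
  have hφ' : IsTest univ φ := hφ.mono (subset_univ U)
  have hm : Measurable fun q : ℝ × E => D (q.2 + q.1 • e) * φ q.2 :=
    (hDm.comp (by fun_prop)).mul (hφ.continuous.measurable.comp measurable_snd)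
  rw [integrable_prod_iff hm.aestronglyMeasurable]
  constructor
  · exact Eventually.of_forall fun s => integrable_mul_test
      ((LocallyIntegrable.comp_add_right' hD (s • e)).locallyIntegrableOn _) hφ'
  · have h1 := continuous_integral_mul_translate (D := fun p => ‖D p‖) (ψ := fun p => ‖φ p‖)
      (fun x => let ⟨s, hs, hi⟩ := hD x; ⟨s, hs, hi.norm⟩) hφ.continuous.norm hφ.2.1.norm e
    simp only [norm_mul]
    exact (h1.locallyIntegrable.integrableOn_isCompact isCompact_uIcc).mono_set uIoc_subset_uIcc

/-- By translation invariance, the difference quotient of φ in direction `-e` tested with `u` equals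
the mean of `K` over [0, r], where `K s` tests the translated `D` with φ. As `K` is continuous,
letting r → 0⁺ gives the claim. -/
theorem hasWeakDeriv_of_line (hu : Continuous u) (hDm : Measurable D) (hD : LocallyIntegrable D)
    (h : ∀ p (r : ℝ), u (p + r • e) - u p = ∫ s in (0 : ℝ)..r, D (p + s • e)) :
    HasWeakDeriv univ e u D := by
  refine ⟨hu.locallyIntegrable.locallyIntegrableOn _, hD.locallyIntegrableOn _, fun φ hφ => ?_⟩
  rw [setIntegral_univ, setIntegral_univ]
  set K : ℝ → ℝ := fun s => ∫ p, D (p + s • e) * φ p with hK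
  have hKc : Continuous K := continuous_integral_mul_translate hD hφ.continuous hφ.2.1 e
  obtain ⟨C, hC⟩ := hφ.1.lipschitzWith_of_hasCompactSupport hφ.2.1 (by simp)
  have hlim := hC.integral_inv_smul_sub_mul_tendsto_integral_lineDeriv_mul' (μ := volume) hφ.2.1 hu (-e)
  have huφ : ∀ c : E, Integrable fun p => u (p + c) * φ p := fun c =>
    integrable_mul_test ((hu.comp (continuous_add_const c)).locallyIntegrable.locallyIntegrableOn _)
      hφ
  have hJ : ∀ r : ℝ, ∫ p, (r⁻¹ • (φ (p + r • -e) - φ p)) * u p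
      = r⁻¹ * ∫ s in (0 : ℝ)..r, K s := by
    intro r
    have e1 : ∫ s in (0 : ℝ)..r, K s = ∫ p, (u (p + r • e) - u p) * φ p := by
      rw [hK, intervalIntegral_integral_swap (integrable_translate_mul_test hDm hD hφ e r)]
      refine integral_congr_ae (Eventually.of_forall fun p => ?_)
      simp only
      rw [h, intervalIntegral.integral_mul_const]
    have e2 : ∫ p, (u (p + r • e) - u p) * φ p
        = ∫ p, (φ (p + r • -e) - φ p) * u p := by
      have i0 := huφ 0
      simp only [add_zero] at i0
      have i1 := huφ (r • e)
      have i2 : Integrable fun p => φ (p + r • -e) * u p := by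
        have := i1.comp_add_right (r • -e)
        refine this.congr (Eventually.of_forall fun p => ?_)
        simp [mul_comm]
      have e3 : ∫ p, u (p + r • e) * φ p = ∫ p, φ (p + r • -e) * u p := by
        rw [← integral_add_right_eq_self _ (r • -e)]
        congr 1; funext p; simp [mul_comm]
      simp_rw [sub_mul]
      have i0' : Integrable fun p => φ p * u p := i0.congr (Eventually.of_forall fun p => mul_comm _ _)
      rw [integral_sub i1 i0, integral_sub i2 i0', e3]
      simp_rw [mul_comm (u _) (φ _)]
    rw [e1, e2, ← integral_const_mul]
    congr 1; funext p; simp [mul_assoc]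
  simp_rw [hJ] at hlim
  have hK0 : Tendsto (fun r : ℝ => r⁻¹ * ∫ s in (0 : ℝ)..r, K s) (𝓝[>] 0) (𝓝 (K 0)) := by
    have h1 := (hKc.integral_hasStrictDerivAt 0 0).hasDerivAt.tendsto_slope_zero_right
    simpa using h1
  have heq := tendsto_nhds_unique hlim hK0
  have e4 : ∀ p, lineDeriv ℝ φ p (-e) = -dirDeriv e φ p := by
    intro p
    rw [(hφ.differentiable p).lineDeriv_eq_fderiv, map_neg, dirDeriv]
  have e5 : K 0 = ∫ p, D p * φ p := by simp [hK]
  rw [← e5, ← heq, ← integral_neg]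
  congr 1; funext p; rw [e4]; ring

end LineDerivative

/-! ### One-dimensional H¹ functions as primitives. -/

section OneDimensional

variable {a b : ℝ} {u w g : ℝ → ℝ}

theorem IsPrimitive.hasWeakDeriv {f h : ℝ → ℝ} (hf : IsPrimitive f h) (hm : Measurable h) :
    HasWeakDeriv univ (1 : ℝ) f h := by
  refine hasWeakDeriv_of_line hf.continuous hm hf.locL2.locallyIntegrable fun p r => ?_
  simp only [smul_eq_mul, mul_one]
  rw [intervalIntegral.integral_comp_add_left h p, hf.integral_eq, add_zero]

theorem dirDeriv_one_eq_deriv (φ : ℝ → ℝ) : dirDeriv (1 : ℝ) φ = deriv φ := by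
  funext x; simp [dirDeriv]

theorem exists_isTest_primitive {θ : ℝ → ℝ} (hab : a < b) (hθ : IsTest (Ioo a b) θ)
    (h0 : ∫ x in Ioo a b, θ x = 0) : ∃ Φ, IsTest (Ioo a b) Φ ∧ dirDeriv (1 : ℝ) Φ = θ := by
  obtain ⟨m, M, hm, hmM, hM, hsub⟩ : ∃ m M, a < m ∧ m ≤ M ∧ M < b ∧ tsupport θ ⊆ Icc m M := by
    rcases (tsupport θ).eq_empty_or_nonempty with h | h
    · exact ⟨(a + b) / 2, (a + b) / 2, by linarith, le_rfl, by linarith, by simp [h]⟩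
    · obtain ⟨m, hm1, hm2⟩ := hθ.2.1.isCompact.exists_isLeast h
      obtain ⟨M, hM1, hM2⟩ := hθ.2.1.isCompact.exists_isGreatest h
      exact ⟨m, M, (hθ.2.2 hm1).1, hm2 hM1, (hθ.2.2 hM1).2, fun x hx => ⟨hm2 hx, hM2 hx⟩⟩
  have hzero : ∀ x, x ∉ Icc m M → θ x = 0 := fun x hx =>
    image_eq_zero_of_notMem_tsupport fun h => hx (hsub h)
  have hd : ∀ x, HasDerivAt (fun x => ∫ y in a..x, θ y) (θ x) x := fun x =>
    (hθ.continuous.integral_hasStrictDerivAt a x).hasDerivAt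
  have hderiv : deriv (fun x => ∫ y in a..x, θ y) = θ := funext fun x => (hd x).deriv
  have hsupp : ∀ x, x ∉ Icc m M → ∫ y in a..x, θ y = 0 := by
    intro x hx
    rcases lt_or_ge x m with h | h
    · refine (intervalIntegral.integral_congr fun y hy => ?_).trans
        (intervalIntegral.integral_zero (a := a) (b := x))
      refine hzero y fun h1 => ?_
      have := hy.2
      exact absurd (h1.1.trans this) (not_le.2 (max_lt hm h))
    · have h' : M < x := by by_contra h2; exact hx ⟨h, not_lt.1 h2⟩
      have e1 : ∫ y in a..b, θ y = 0 := by
        rw [intervalIntegral.integral_of_le hab.le, integral_Ioc_eq_integral_Ioo, h0]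
      have e2 : ∫ y in x..b, θ y = 0 := by
        refine (intervalIntegral.integral_congr fun y hy => ?_).trans
          (intervalIntegral.integral_zero (a := x) (b := b))
        refine hzero y fun h1 => ?_
        exact absurd (hy.1.trans h1.2) (not_le.2 (lt_min h' hM))
      rw [← intervalIntegral.integral_add_adjacent_intervals
        (hθ.continuous.intervalIntegrable a x) (hθ.continuous.intervalIntegrable x b), e2,
        add_zero] at e1
      exact e1
  have hts : tsupport (fun x => ∫ y in a..x, θ y) ⊆ Icc m M :=
    closure_minimal (fun x hx => by
      by_contra h; exact hx (hsupp x h)) isClosed_Icc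
  refine ⟨fun x => ∫ y in a..x, θ y, ⟨?_, ?_, fun x hx => ?_⟩, ?_⟩
  · rw [contDiff_infty_iff_deriv]
    exact ⟨fun x => (hd x).differentiableAt, by rw [hderiv]; exact hθ.1⟩
  · exact isCompact_Icc.of_isClosed_subset (isClosed_tsupport _) hts
  · have := hts hx
    exact ⟨hm.trans_le this.1, this.2.trans_lt hM⟩
  · rw [dirDeriv_one_eq_deriv, hderiv]

/-- The du Bois-Reymond argument: subtracting from ψ its mass times a fixed bump of unit mass leaves
a function of mean zero, which is the derivative of a test function. The constant is the mean of `w`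
against the bump. -/
theorem eqOn_const_of_integral_deriv_eq_zero (hab : a < b) (hw : ContinuousOn w (Icc a b))
    (h : ∀ φ, IsTest (Ioo a b) φ → ∫ x in Ioo a b, w x * dirDeriv (1 : ℝ) φ x = 0) :
    ∃ C, EqOn w (fun _ => C) (Icc a b) := by
  obtain ⟨η, hη, hη1⟩ : ∃ η, IsTest (Ioo a b) η ∧ ∫ x in Ioo a b, η x = 1 := by
    set B : ContDiffBump ((a + b) / 2) := ⟨(b - a) / 8, (b - a) / 4, by linarith, by linarith⟩
    have hts : tsupport (B.normed volume) ⊆ Ioo a b := by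
      rw [B.tsupport_normed_eq]
      intro x hx
      rw [Metric.mem_closedBall, Real.dist_eq, abs_le] at hx
      have e : B.rOut = (b - a) / 4 := rfl
      rw [e] at hx
      constructor <;> linarith [hx.1, hx.2]
    have hB : IsTest (Ioo a b) (B.normed volume) :=
      ⟨B.contDiff_normed, B.hasCompactSupport_normed, hts⟩
    refine ⟨B.normed volume, hB, ?_⟩
    rw [setIntegral_eq_integral_of_test fun p hp => hB.eq_zero hp, B.integral_normed]
  have hwi : IntegrableOn w (Icc a b) := hw.integrableOn_Icc
  have hwi' : IntegrableOn w (Ioo a b) := hwi.mono_set Ioo_subset_Icc_self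
  have hwl : LocallyIntegrableOn w (Ioo a b) := hwi'.locallyIntegrableOn
  set C := ∫ x in Ioo a b, w x * η x with hC
  refine ⟨C, ?_⟩
  have hwC : LocallyIntegrableOn (fun x => w x - C) (Ioo a b) :=
    hwl.sub (continuous_const.locallyIntegrable.locallyIntegrableOn _)
  have hae := isOpen_Ioo.ae_eq_zero_of_integral_contDiff_smul_eq_zero (μ := volume) hwC
    (fun ψ h1 h2 h3 => ?_)
  · refine Measure.eqOn_Icc_of_ae_eq volume hab.ne ?_ hw continuousOn_const
    rw [Filter.EventuallyEq, ← restrict_Ioo_eq_restrict_Icc, ae_restrict_iff' measurableSet_Ioo]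
    filter_upwards [hae] with x hx hxI
    have := hx hxI
    linarith
  · have hψ : IsTest (Ioo a b) ψ := ⟨h1, h2, h3⟩
    have iη := integrable_mul_test hwl hη
    have iψ := integrable_mul_test hwl hψ
    have jη : Integrable η := by
      simpa using integrable_mul_test (u := fun _ => (1 : ℝ))
        (continuous_const.locallyIntegrable.locallyIntegrableOn _) hη
    have jψ : Integrable ψ := by
      simpa using integrable_mul_test (u := fun _ => (1 : ℝ))
        (continuous_const.locallyIntegrable.locallyIntegrableOn _) hψ
    set I := ∫ x in Ioo a b, ψ x with hI
    have hθ : IsTest (Ioo a b) fun x => ψ x - I * η x := by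
      refine ⟨hψ.1.sub (contDiff_const.mul hη.1), hψ.2.1.sub hη.2.1.mul_left, ?_⟩
      refine (tsupport_sub _ _).trans (union_subset h3 ((tsupport_mul_subset_right).trans hη.2.2))
    have hθ0 : ∫ x in Ioo a b, (ψ x - I * η x) = 0 := by
      rw [integral_sub jψ.integrableOn (jη.const_mul I).integrableOn, integral_const_mul, hη1]
      ring
    obtain ⟨Φ, hΦ, hΦd⟩ := exists_isTest_primitive hab hθ hθ0
    have key := h Φ hΦ
    rw [hΦd] at key
    have e1 : ∀ x, w x * (ψ x - I * η x) = w x * ψ x - I * (w x * η x) := fun x => by ring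
    simp_rw [e1] at key
    rw [integral_sub iψ.integrableOn (iη.const_mul I).integrableOn, integral_const_mul,
      ← hC] at key
    have e2 : ∀ x, ψ x • (w x - C) = w x * ψ x - C * ψ x := fun x => by simp; ring
    simp_rw [e2]
    rw [integral_sub iψ (jψ.const_mul C), integral_const_mul,
      ← setIntegral_eq_integral_of_test (U := Ioo a b) (fun p hp => by simp [hψ.eq_zero hp]),
      ← setIntegral_eq_integral_of_test (U := Ioo a b) (F := ψ) (fun p hp => hψ.eq_zero hp)]
    linarith

/-- The difference between `u` and the primitive of its weak derivative has zero weak derivative, so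
it is constant. Extending `g` by zero makes it a function on the line. -/
theorem MemH1Icc.exists_primitive (hab : a < b) (hu : MemH1Icc a b u) :
    ∃ g, LocL2 g ∧ (∀ x ∉ Ioo a b, g x = 0) ∧
      ∀ x ∈ Icc a b, u x = u a + ∫ y in a..x, g y := by
  obtain ⟨⟨hu2, hd⟩, huc⟩ := hu
  obtain ⟨g₀, hg2, hg⟩ := hd 1
  set g₁ := hg2.1.mk g₀ with hg₁
  have hg₁m : Measurable g₁ := hg2.1.stronglyMeasurable_mk.measurable
  have hae : g₀ =ᵐ[volume.restrict (Ioo a b)] g₁ := hg2.1.ae_eq_mk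
  have hg₁2 : MemLp g₁ 2 (volume.restrict (Ioo a b)) := (memLp_congr_ae hae).1 hg2
  set g := (Ioo a b).indicator g₁ with hgdef
  have hL : LocL2 g := fun c d =>
    ((memLp_indicator_iff_restrict measurableSet_Ioo).2 hg₁2).mono_measure Measure.restrict_le_self
  have hp := hL.isPrimitive 0 a
  have hw := hp.hasWeakDeriv (hg₁m.indicator measurableSet_Ioo)
  refine ⟨g, hL, fun x hx => indicator_of_notMem hx _, ?_⟩
  obtain ⟨C, hC⟩ := eqOn_const_of_integral_deriv_eq_zero (w := fun x => u x - (0 + ∫ y in a..x, g y))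
    hab (huc.sub hp.continuous.continuousOn) (fun φ hφ => by
      have h1 := hg.2.2 φ hφ
      have h2 := (hw.mono (subset_univ (Ioo a b))).2.2 φ hφ
      have hφd := hφ.dirDeriv (1 : ℝ)
      have e1 : ∫ x in Ioo a b, g₀ x * φ x = ∫ x in Ioo a b, g x * φ x := by
        refine integral_congr_ae ?_
        filter_upwards [hae, ae_restrict_mem measurableSet_Ioo] with x hx hxI
        rw [hx, hgdef, indicator_of_mem hxI]
      simp_rw [sub_mul]
      rw [integral_sub, h1, h2, e1, sub_self]
      · exact (integrable_mul_test hg.1 hφd).integrableOn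
      · exact (integrable_mul_test (hw.mono (subset_univ (Ioo a b))).1 hφd).integrableOn)
  intro x hx
  have h1 := hC hx
  have h2 := hC (left_mem_Icc.2 hab.le)
  simp only [intervalIntegral.integral_same] at h1 h2
  linarith

end OneDimensional

/-! ### Construction of the solution from the data. -/

section Wave

variable {l : ℝ → ℝ}

theorem contDiff_duhamel {G : ℝ × ℝ → ℝ} (hG : Continuous G) : ContDiff ℝ 1 (duhamel G) := by
  rw [contDiff_one_iff_fderiv]
  have h := duhamel_hasFDerivAt hG
  refine ⟨fun p => (h p).differentiableAt, ?_⟩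
  have e : fderiv ℝ (duhamel G) = fun p => _ := funext fun p => (h p).fderiv
  rw [e]
  have h1 := continuous_charInt hG 1
  have h2 := continuous_charInt hG (-1)
  exact ((h1.add h2).smul continuous_const).add ((h1.sub h2).smul continuous_const)

/-- The Duhamel term is C¹, hence Lipschitz on compact sets and along 1-Lipschitz curves in them. -/
theorem energyOn_duhamel {G : ℝ × ℝ → ℝ} (hG : Continuous G) (k : ℝ) {S : ℝ} {q : ℝ → ℝ × ℝ}
    {K : Set (ℝ × ℝ)} (hK : IsCompact K) (hqK : ∀ s ≤ S, q s ∈ K)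
    (hq : ∀ a b, a ≤ b → dist (q b) (q a) ≤ b - a) : EnergyOn S fun s => k * duhamel G (q s) := by
  obtain ⟨C, hC⟩ := LocallyLipschitzOn.exists_lipschitzOnWith_of_compact hK
    (contDiff_duhamel hG).locallyLipschitz.locallyLipschitzOn
  refine EnergyOn.const_mul (energyOn_of_lipschitz (L := C) fun a b hab hb => ?_) k
  have h1 := hC.dist_le_mul _ (hqK b hb) _ (hqK a (hab.trans hb))
  rw [Real.dist_eq] at h1
  exact h1.trans (by gcongr; exact hq a b hab)

theorem dist_pair_le {a b c d r : ℝ} (h1 : 0 ≤ b - a) (h2 : b - a ≤ r) (h3 : 0 ≤ d - c)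
    (h4 : d - c ≤ r) : dist (b, d) (a, c) ≤ r := by
  rw [Prod.dist_eq, Real.dist_eq, Real.dist_eq]
  exact max_le (by rwa [abs_of_nonneg h1]) (by rwa [abs_of_nonneg h3])

theorem max_zero_sub_le {a b : ℝ} (h : a ≤ b) :
    0 ≤ max b 0 - max a 0 ∧ max b 0 - max a 0 ≤ b - a := by
  have h1 := max_le_max_right 0 h
  have h2 : max b 0 ≤ max a 0 + (b - a) :=
    max_le (by linarith [le_max_left a 0]) (by linarith [le_max_right a 0])
  constructor <;> linarith

theorem energyOn_duhamel_left {G : ℝ × ℝ → ℝ} (hG : Continuous G) (k S : ℝ) :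
    EnergyOn S fun s => k * duhamel G (max s 0, 0) := by
  refine energyOn_duhamel hG k (q := fun s => (max s 0, 0))
    (K := Icc 0 (max S 0) ×ˢ Icc 0 0) (isCompact_Icc.prod isCompact_Icc)
    (fun s hs => ⟨⟨le_max_right _ _, max_le_max_right 0 hs⟩, by simp⟩) fun a b hab => ?_
  obtain ⟨h1, h2⟩ := max_zero_sub_le hab
  exact dist_pair_le h1 h2 (by simp) (by simpa using hab)

theorem energyOn_duhamel_front (hl : IsFront l) {G : ℝ × ℝ → ℝ} (hG : Continuous G) (k S : ℝ) :
    EnergyOn S fun s => k * duhamel G (max (hl.tau s) 0, s - hl.tau s) := by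
  have he : ∀ s, s - hl.tau s = ext l (hl.tau s) := fun s => by linarith [hl.tau_add s]
  refine energyOn_duhamel hG k (q := fun s => (max (hl.tau s) 0, s - hl.tau s))
    (K := Icc 0 (max (hl.tau S) 0) ×ˢ Icc 0 (ext l (hl.tau S))) (isCompact_Icc.prod isCompact_Icc)
    (fun s hs => ⟨⟨le_max_right _ _, max_le_max_right 0 (hl.tau_mono hs)⟩, ?_, ?_⟩) fun a b hab => ?_
  · simp only [he]; exact hl.pos.le.trans (hl.ext_ge _)
  · simp only [he]; exact hl.ext_mono (hl.tau_mono hs)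
  · obtain ⟨h1, h2⟩ := max_zero_sub_le (hl.tau_mono hab)
    have h3 := hl.tau_sub_le hab
    have h4 := hl.tau_mono hab
    exact dist_pair_le h1 (h2.trans h3) (by linarith) (by linarith)

/-- The function `f(t + x) + g(t - x) + k D(t, x)`, where `D` is the Duhamel term of `G`. -/
noncomputable def wave (k : ℝ) (f g : ℝ → ℝ) (G : ℝ × ℝ → ℝ) (p : ℝ × ℝ) : ℝ :=
  f (p.1 + p.2) + g (p.1 - p.2) + k * duhamel G p

theorem integral_eq_zero_of_nonpos {α : ℝ → ℝ} {L : ℝ} (hα : ∀ x ∉ Ioo 0 L, α x = 0) {x : ℝ}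
    (hx : x ≤ 0) : ∫ y in (0 : ℝ)..x, α y = 0 := by
  refine (intervalIntegral.integral_congr fun y hy => ?_).trans
    (intervalIntegral.integral_zero (a := 0) (b := x))
  rw [uIcc_of_ge hx] at hy
  exact hα y fun h => absurd h.1 (not_lt.2 hy.2)

theorem integral_eq_of_ge {α : ℝ → ℝ} {L : ℝ} (hαL : LocL2 α) (hα : ∀ x ∉ Ioo 0 L, α x = 0) {x : ℝ}
    (hx : L ≤ x) : ∫ y in (0 : ℝ)..x, α y = ∫ y in (0 : ℝ)..L, α y := by
  rw [← intervalIntegral.integral_add_adjacent_intervals (hαL.intervalIntegrable 0 L)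
    (hαL.intervalIntegrable L x), add_eq_left]
  refine (intervalIntegral.integral_congr fun y hy => ?_).trans
    (intervalIntegral.integral_zero (a := L) (b := x))
  rw [uIcc_of_le hx] at hy
  exact hα y fun h => absurd h.2 (not_lt.2 hy.1)

theorem exists_bound_integral {α : ℝ → ℝ} {L : ℝ} (hL : 0 ≤ L) (hαL : LocL2 α)
    (hα : ∀ x ∉ Ioo 0 L, α x = 0) : ∃ K, 0 ≤ K ∧ ∀ x, |∫ y in (0 : ℝ)..x, α y| ≤ K := by
  have hc := (hαL.isPrimitive 0 0).continuous
  obtain ⟨K, hK⟩ := isCompact_Icc.exists_bound_of_continuousOn (s := Icc 0 L) hc.continuousOn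
  simp only [zero_add, Real.norm_eq_abs] at hK
  refine ⟨K, (abs_nonneg _).trans (hK 0 ⟨le_rfl, hL⟩), fun x => ?_⟩
  rcases le_total x 0 with h | h
  · rw [integral_eq_zero_of_nonpos hα h, abs_zero]
    exact (abs_nonneg _).trans (hK 0 ⟨le_rfl, hL⟩)
  · rcases le_total x L with h' | h'
    · exact hK x ⟨h, h'⟩
    · rw [integral_eq_of_ge hαL hα h']
      exact hK L ⟨hL, le_rfl⟩

theorem LocL2.comp_neg {γ : ℝ → ℝ} (hγ : LocL2 γ) : LocL2 fun x => γ (-x) := by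
  intro a b
  have h1 := (hγ (-b - 1) (-a)).comp_measurePreserving
    ((Measure.measurePreserving_neg (volume : Measure ℝ)).restrict_preimage
      (measurableSet_Ioc (a := -b - 1) (b := -a)))
  refine h1.mono_measure (Measure.restrict_mono (fun x hx => ?_) le_rfl)
  simp only [mem_preimage, mem_Ioc]
  constructor <;> linarith [hx.1, hx.2]

/-- The boundary datum may grow arbitrarily fast, so the weight has to dominate it. Its total
variation is a nondecreasing majorant of its increments. -/
theorem exists_majorant {ζ : ℝ → ℝ} (hζ : ∀ S, EnergyOn S ζ) (h0 : ∀ s ≤ 0, ζ s = ζ 0) :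
    ∃ M : ℝ → ℝ, Continuous M ∧ Monotone M ∧ (∀ t, 1 ≤ M t) ∧
      ∀ t, |ζ t| ≤ (1 + |ζ 0|) * M t := by
  have hp := isPrimitive_deriv hζ
  have hi : ∀ a b, IntervalIntegrable (fun x => |deriv ζ x|) volume a b := fun a b =>
    (hp.locL2.intervalIntegrable a b).abs
  have hmono : ∀ a b, 0 ≤ a → a ≤ b →
      ∫ x in (0 : ℝ)..a, |deriv ζ x| ≤ ∫ x in (0 : ℝ)..b, |deriv ζ x| := by
    intro a b _ hab
    rw [← intervalIntegral.integral_add_adjacent_intervals (hi 0 a) (hi a b)]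
    have := intervalIntegral.integral_nonneg (f := fun x => |deriv ζ x|) (μ := volume) hab
      fun x _ => abs_nonneg _
    linarith
  have h1 : ∀ t, 0 ≤ ∫ x in (0 : ℝ)..max t 0, |deriv ζ x| := fun t =>
    intervalIntegral.integral_nonneg (le_max_right _ _) fun x _ => abs_nonneg _
  refine ⟨fun t => 1 + ∫ x in (0 : ℝ)..max t 0, |deriv ζ x|, ?_, ?_, fun t => by linarith [h1 t],
    fun t => ?_⟩
  · have := intervalIntegral.continuous_primitive hi 0
    exact continuous_const.add (this.comp (by fun_prop))
  · intro s t hst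
    have := hmono _ _ (le_max_right s 0) (max_le_max_right 0 hst)
    simp only; linarith
  · have h2 : ζ t = ζ (max t 0) := by
      rcases le_total t 0 with h | h
      · rw [max_eq_right h, h0 t h]
      · rw [max_eq_left h]
    have h3 := hp.integral_eq 0 (max t 0)
    have h4 := intervalIntegral.abs_integral_le_integral_abs (f := deriv ζ) (μ := volume)
      (le_max_right t 0)
    rw [h3] at h4
    have h5 := abs_sub_abs_le_abs_sub (ζ (max t 0)) (ζ 0)
    rw [h2]
    have := abs_nonneg (ζ 0)
    nlinarith [h1 t]

theorem MemH1Icc.energyOn_extend {z : ℝ → ℝ} (hz : ∀ b : ℝ, 0 < b → MemH1Icc 0 b z) (S : ℝ) :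
    EnergyOn S fun s => z (max s 0) := by
  have hS : 0 < max S 1 := by positivity
  obtain ⟨g, hg, hg0, hgz⟩ := (hz _ hS).exists_primitive hS
  refine (((hg.isPrimitive (z 0) 0).energyOn S)).congr fun s hs => ?_
  rw [hgz _ ⟨le_max_right _ _, max_le (hs.trans (le_max_left _ _)) hS.le⟩]
  rcases le_total s 0 with h | h
  · rw [max_eq_right h, integral_eq_zero_of_nonpos hg0 h]; simp
  · rw [max_eq_left h]

/-- Since ω(s) ≤ s - 2ℓ(0), the equation passes the inequality from (-∞, 2ℓ(0)n] to (-∞, 2ℓ(0)(n +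
1)]. It starts from `f = 0` on the negative axis. -/
theorem energyOn_of_reflect (hl : IsFront l) {k : ℝ} {c f : ℝ → ℝ} {v : ℝ × ℝ → ℝ}
    (hv : Continuous v) (hc : ∀ S, EnergyOn S c) (hf0 : ∀ s ≤ 0, f s = 0)
    (hf : ∀ s, f s = c s + hl.reflect k f v s) (S : ℝ) : EnergyOn S f := by
  have hp := hl.pos
  have key : ∀ n : ℕ, EnergyOn (2 * l 0 * n) f := by
    intro n
    induction n with
    | zero =>
      refine energyOn_of_lipschitz (L := 0) fun a b hab hb => ?_
      have hb' : b ≤ 0 := by simpa using hb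
      rw [hf0 b hb', hf0 a (hab.trans hb')]; simp
    | succ n ih =>
      push_cast
      have h1 : EnergyOn (2 * l 0 * (n + 1)) fun s => f (hl.omega s) :=
        ih.comp hl.omega_mono (fun _ _ => hl.omega_sub_le) fun s hs => by linarith [hl.omega_le s]
      have h2 : EnergyOn (2 * l 0 * (n + 1)) fun s => k * duhamel v (max (hl.omega s) 0, 0) :=
        (energyOn_duhamel_left hv k (2 * l 0 * (n + 1))).comp hl.omega_mono
          (fun _ _ => hl.omega_sub_le) fun s hs => by linarith [hl.omega_le s]
      exact ((hc _).add ((h1.add h2).sub (energyOn_duhamel_front hl hv k _))).congr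
        fun s _ => hf s
  obtain ⟨n, hn⟩ := exists_nat_gt (S / (2 * l 0))
  refine (key n).mono ?_
  rw [div_lt_iff₀ (by positivity)] at hn
  linarith

theorem exists_wave (hl : IsFront l) {k : ℝ} (hk : 0 ≤ k) {z v₀ v₁ : ℝ → ℝ}
    (hz : ∀ b : ℝ, 0 < b → MemH1Icc 0 b z) (hv₀ : MemH1Icc 0 (l 0) v₀)
    (hv₁ : MemLp v₁ 2 (volume.restrict (Ioo 0 (l 0)))) (hc0 : v₀ 0 = z 0) (hcl : v₀ (l 0) = 0) :
    ∃ (f g : ℝ → ℝ) (G : ℝ × ℝ → ℝ), (∀ S, EnergyOn S f) ∧ (∀ S, EnergyOn S g) ∧ Continuous G ∧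
      (∀ t x, 0 ≤ t → 0 ≤ x → x ≤ ext l t → G (t, x) = wave k f g G (t, x)) ∧
      (∀ t, 0 ≤ t → wave k f g G (t, 0) = z t) ∧
      (∀ t, 0 ≤ t → wave k f g G (t, ext l t) = 0) ∧
      (∀ x ∈ Icc 0 (l 0), wave k f g G (0, x) = v₀ x) ∧
      ∀ᵐ x, x ∈ Ioo 0 (l 0) → deriv f x + deriv g (-x) = v₁ x := by
  have hp := hl.pos
  obtain ⟨h, hh, hh0, hhv⟩ := hv₀.exists_primitive hp
  set V := (Ioo 0 (l 0)).indicator v₁ with hV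
  have hVL : LocL2 V := fun a b =>
    ((memLp_indicator_iff_restrict measurableSet_Ioo).2 hv₁).mono_measure Measure.restrict_le_self
  have hV0 : ∀ x ∉ Ioo 0 (l 0), V x = 0 := fun x hx => indicator_of_notMem hx _
  -- The d'Alembert splitting of the initial data: α = (v₀' + v₁)/2 gives f on [0, ℓ(0)], and γ =
  -- (v₀' - v₁)/2 gives x ↦ g(-x), up to constants.
  set α : ℝ → ℝ := fun x => 1 / 2 * h x + 1 / 2 * V x with hα
  set γ : ℝ → ℝ := fun x => 1 / 2 * h x + -1 / 2 * V x with hγ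
  have hαL : LocL2 α := (hh.const_mul _).add (hVL.const_mul _)
  have hγL : LocL2 γ := (hh.const_mul _).add (hVL.const_mul _)
  have hα0 : ∀ x ∉ Ioo 0 (l 0), α x = 0 := fun x hx => by simp [hα, hh0 x hx, hV0 x hx]
  have hγ0 : ∀ x ∉ Ioo 0 (l 0), γ x = 0 := fun x hx => by simp [hγ, hh0 x hx, hV0 x hx]
  set F : ℝ → ℝ := fun x => ∫ y in (0 : ℝ)..x, α y with hF
  set P : ℝ → ℝ := fun x => ∫ y in (0 : ℝ)..x, γ y with hP
  have hFp : IsPrimitive F α := by simpa using hαL.isPrimitive 0 0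
  have hPp : IsPrimitive P γ := by simpa using hγL.isPrimitive 0 0
  have hFP : ∀ x ∈ Icc 0 (l 0), F x + P x + z 0 = v₀ x := by
    intro x hx
    rw [hhv x hx, hc0, hF, hP]
    simp only
    rw [← intervalIntegral.integral_add (hαL.intervalIntegrable _ _) (hγL.intervalIntegrable _ _)]
    have : ∀ y, α y + γ y = h y := fun y => by simp only [hα, hγ]; ring
    simp_rw [this]; ring
  have hend : F (l 0) + P (l 0) + z 0 = 0 := by rw [hFP _ ⟨hp.le, le_rfl⟩, hcl]
  have hPneg : IsPrimitive (fun x => P (-x)) fun x => -1 * γ (-x) := by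
    refine ⟨(hγL.comp_neg).const_mul _, fun a b => ?_⟩
    rw [intervalIntegral.integral_const_mul, intervalIntegral.integral_comp_neg, hPp.integral_eq]
    ring
  set ζ : ℝ → ℝ := fun s => z (max s 0) with hζ
  have hζE : ∀ S, EnergyOn S ζ := MemH1Icc.energyOn_extend hz
  obtain ⟨M, hMc, hM, hM1, hζM⟩ := exists_majorant hζE fun s hs => by simp [hζ, hs]
  -- A single formula for both kinds of incoming data: `P (-ξ)` vanishes for ξ ≥ 0, and `ζ` is the
  -- constant `z 0` for ξ ≤ 0.
  set b : ℝ → ℝ := fun ξ => ζ ξ + P (-ξ) with hb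
  have hbE : ∀ S, EnergyOn S b := fun S => (hζE S).add (hPneg.energyOn S)
  -- Normalised to vanish for s ≥ ℓ(0), where the characteristic meets the front at a nonnegative
  -- time. For s ≤ ℓ(0) the compatibility conditions give F(ℓ(0)) + P(ℓ(0)) + z(0) = 0, so that `c`
  -- below reduces to `F`.
  set a : ℝ → ℝ := fun s => F s - F (l 0) with ha
  have haE : ∀ S, EnergyOn S a := fun S => (hFp.energyOn S).sub
    (energyOn_of_lipschitz (L := 0) fun _ _ _ _ => by simp)
  set c : ℝ → ℝ := fun s => a s - b (hl.omega s) with hc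
  have hcE : ∀ S, EnergyOn S c := fun S => (haE S).sub
    ((hbE S).comp hl.omega_mono (fun _ _ => hl.omega_sub_le) fun s hs => by
      linarith [hl.omega_le s])
  have hbω : ∀ s ≤ l 0, b (hl.omega s) = z 0 + P (l 0) := by
    intro s hs
    have h1 := hl.omega_le s
    simp only [hb, hζ]
    rw [max_eq_right (by linarith), hP]
    simp only
    rw [integral_eq_of_ge hγL hγ0 (by linarith)]
  have hcF : ∀ s ≤ l 0, c s = F s := by
    intro s hs
    simp only [hc, ha, hbω s hs]; linarith
  have hF0 : ∀ s ≤ 0, F s = 0 := fun s hs => integral_eq_zero_of_nonpos hα0 hs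
  have hP0 : ∀ s ≤ 0, P s = 0 := fun s hs => integral_eq_zero_of_nonpos hγ0 hs
  obtain ⟨K, hK0, hK⟩ := exists_bound_integral hp.le hαL hα0
  obtain ⟨K', hK'0, hK'⟩ := exists_bound_integral hp.le hγL hγ0
  set C := 1 + |ζ 0| + K' + 2 * K with hC
  have hbM' : ∀ t, |b t| ≤ (1 + |ζ 0| + K') * M t := by
    intro t
    have h1 := abs_add_le (ζ t) (P (-t))
    have h2 := hζM t
    have h3 : |P (-t)| ≤ K' := hK' (-t)
    have h4 := hM1 t
    calc |b t| ≤ (1 + |ζ 0|) * M t + K' * 1 := by simp only [hb]; linarith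
      _ ≤ (1 + |ζ 0|) * M t + K' * M t := by gcongr
      _ = _ := by ring
  have hbM : ∀ t, |b t| ≤ C * M t := by
    intro t
    refine (hbM' t).trans ?_
    have := hM1 t
    exact mul_le_mul_of_nonneg_right (by rw [hC]; linarith) (by linarith)
  have hcM : ∀ s, |c s| ≤ C * M (hl.tau s) := by
    intro s
    have h1 : |F s| ≤ K := hK s
    have h2 : |F (l 0)| ≤ K := hK (l 0)
    have h3 := hbM' (hl.omega s)
    have h4 := hM (show hl.omega s ≤ hl.tau s by linarith [hl.omega_le_tau s])
    have h5 := hM1 (hl.tau s)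
    have h6 : (1 + |ζ 0| + K') * M (hl.omega s) ≤ (1 + |ζ 0| + K') * M (hl.tau s) := by gcongr
    have h7 : 2 * K * 1 ≤ 2 * K * M (hl.tau s) := by gcongr
    have h8 : |c s| ≤ |F s| + |F (l 0)| + |b (hl.omega s)| := by
      simp only [hc, ha]
      exact (abs_sub _ _).trans (by gcongr; exact abs_sub _ _)
    calc |c s| ≤ 2 * K * M (hl.tau s) + (1 + |ζ 0| + K') * M (hl.tau s) := by linarith
      _ = _ := by rw [hC]; ring
  have cont : ∀ {f : ℝ → ℝ}, (∀ S, EnergyOn S f) → Continuous f := fun hf =>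
    (isPrimitive_deriv hf).continuous
  obtain ⟨f, G, hfc, hGc, hfz, hfeq, hGeq⟩ := exists_fixedPoint hl hk (cont hcE) (cont hbE)
    (fun s hs => by rw [hcF s (hs.trans hp.le), hF0 s hs]) hMc hM hM1 hcM hbM
  have hfE := energyOn_of_reflect hl hGc hcE hfz hfeq
  -- The left boundary condition solved for g.
  set g : ℝ → ℝ := fun ξ => b ξ - f ξ - k * duhamel G (max ξ 0, 0) with hg
  have hgE : ∀ S, EnergyOn S g := fun S =>
    ((hbE S).sub (hfE S)).sub (energyOn_duhamel_left hGc k S)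
  have hfF : ∀ x ≤ l 0, f x = F x := by
    intro x hx
    have h1 := hl.omega_le x
    rw [hfeq, hcF x hx, IsFront.reflect, hfz _ (by linarith), max_eq_right (by linarith),
      max_eq_right (hl.tau_nonpos hx), duhamel_zero_left, duhamel_zero_left]
    ring
  have hgP : ∀ x, 0 ≤ x → g (-x) = z 0 + P x := by
    intro x hx
    simp only [hg, hb, hζ]
    rw [hfz _ (by linarith), max_eq_right (by linarith), duhamel_zero_left, neg_neg]
    ring
  refine ⟨f, g, G, hfE, hgE, hGc, ?_, ?_, ?_, ?_, ?_⟩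
  · intro t x ht hx hxl
    rw [hGeq t x ht hx hxl]
    simp only [wave, superpose, hg]; ring
  · intro t ht
    simp only [wave, hg, hb, hζ, add_zero, sub_zero, max_eq_left ht]
    rw [hP0 _ (by linarith)]; ring
  · intro t ht
    have h1 : a (t + ext l t) = 0 := by
      simp only [ha, hF]
      rw [integral_eq_of_ge hαL hα0 (by linarith [hl.ext_ge t])]; ring
    simp only [wave]
    rw [hfeq, IsFront.reflect, hl.tau_apply, hl.omega_apply]
    simp only [hc, hg, h1, hl.omega_apply, max_eq_left ht, add_sub_cancel_left]
    ring
  · intro x hx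
    simp only [wave, zero_add, zero_sub, duhamel_zero_left]
    rw [hfF x hx.2, hgP x hx.1, ← hFP x hx]; ring
  · filter_upwards [hFp.ae_hasDerivAt, hPp.ae_hasDerivAt] with x h1 h2 hx
    have e1 : deriv f x = α x := by
      refine (h1.congr_of_eventuallyEq ?_).deriv
      filter_upwards [Iio_mem_nhds hx.2] with y hy using hfF y (le_of_lt hy)
    have e2 : deriv g (-x) = -γ x := by
      have h3 : HasDerivAt (fun ξ => z 0 + P (-ξ)) (-γ x) (-x) := by
        have h2' : HasDerivAt P (γ x) (- -x) := by rwa [neg_neg]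
        have := (HasDerivAt.comp (-x) h2' (hasDerivAt_neg (-x))).const_add (z 0)
        simpa using this
      refine (h3.congr_of_eventuallyEq ?_).deriv
      filter_upwards [Iio_mem_nhds (show -x < 0 by linarith [hx.1])] with y hy
      have := hgP (-y) (by have : y < 0 := hy; linarith)
      rwa [neg_neg] at this
    rw [e1, e2]
    simp only [hα, hγ, hV, indicator_of_mem hx]; ring

end Wave

/-! ### Weak derivatives of the constructed function and its wave equation. -/

section WaveDerivatives

variable {l f g f' g' : ℝ → ℝ} {G : ℝ × ℝ → ℝ} {k : ℝ}

/-- The weak derivative of `wave k f g G` in the direction `e`. -/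
noncomputable def waveDeriv (k : ℝ) (f' g' : ℝ → ℝ) (G : ℝ × ℝ → ℝ) (e p : ℝ × ℝ) : ℝ :=
  (e.1 + e.2) * f' (p.1 + p.2) + (e.1 - e.2) * g' (p.1 - p.2)
    + k * (e.1 * (charInt 1 G p + charInt (-1) G p) + e.2 * (charInt 1 G p - charInt (-1) G p))

theorem continuous_wave (hf : Continuous f) (hg : Continuous g) (hG : Continuous G) :
    Continuous (wave k f g G) := by
  have := continuous_duhamel hG
  unfold wave; fun_prop

theorem measurable_waveDeriv (hf : Measurable f') (hg : Measurable g') (hG : Continuous G)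
    (e : ℝ × ℝ) : Measurable (waveDeriv k f' g' G e) := by
  have h1 := (continuous_charInt hG 1).measurable
  have h2 := (continuous_charInt hG (-1)).measurable
  have h3 : Measurable fun p : ℝ × ℝ => f' (p.1 + p.2) := hf.comp (by fun_prop)
  have h4 : Measurable fun p : ℝ × ℝ => g' (p.1 - p.2) := hg.comp (by fun_prop)
  exact ((h3.const_mul _).add (h4.const_mul _)).add
    ((((h1.add h2).const_mul _).add ((h1.sub h2).const_mul _)).const_mul _)

theorem IsPrimitive.line (hf : IsPrimitive f f') (x c r : ℝ) :
    ∫ s in (0 : ℝ)..r, c * f' (x + s * c) = f (x + r * c) - f x := by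
  rw [intervalIntegral.integral_const_mul]
  have h1 := intervalIntegral.smul_integral_comp_add_mul (a := 0) (b := r) (f := f') c x
  rw [smul_eq_mul] at h1
  have h2 : ∀ s : ℝ, f' (x + s * c) = f' (x + c * s) := fun s => by rw [mul_comm]
  simp_rw [h2]
  rw [h1, hf.integral_eq]
  simp [mul_comm]

theorem IsPrimitive.line_intervalIntegrable (hf : IsPrimitive f f') (x c a b : ℝ) :
    IntervalIntegrable (fun s => c * f' (x + s * c)) volume a b := by
  rcases eq_or_ne c 0 with rfl | hc
  · simp
  · have h1 := (hf.locL2.intervalIntegrable (x + a * c) (x + b * c)).comp_add_left x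
    have h2 := h1.comp_mul_right (c := c)
    simp only [add_sub_cancel_left] at h2
    rw [mul_div_cancel_right₀ _ hc, mul_div_cancel_right₀ _ hc] at h2
    exact h2.const_mul c

theorem wave_line (hf : IsPrimitive f f') (hg : IsPrimitive g g') (hG : Continuous G)
    (e p : ℝ × ℝ) (r : ℝ) : wave k f g G (p + r • e) - wave k f g G p
      = ∫ s in (0 : ℝ)..r, waveDeriv k f' g' G e (p + s • e) := by
  have h1 := hf.line (p.1 + p.2) (e.1 + e.2) r
  have h2 := hg.line (p.1 - p.2) (e.1 - e.2) r
  have i1 := hf.line_intervalIntegrable (p.1 + p.2) (e.1 + e.2) 0 r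
  have i2 := hg.line_intervalIntegrable (p.1 - p.2) (e.1 - e.2) 0 r
  set B : ℝ × ℝ → ℝ := fun q => e.1 * (charInt 1 G q + charInt (-1) G q)
    + e.2 * (charInt 1 G q - charInt (-1) G q) with hB
  have hBc : Continuous fun s : ℝ => k * B (p + s • e) := by
    have := continuous_charInt hG 1
    have := continuous_charInt hG (-1)
    fun_prop
  have h3 : ∫ s in (0 : ℝ)..r, k * B (p + s • e)
      = k * duhamel G (p + r • e) - k * duhamel G p := by
    have hd : ∀ s ∈ uIcc 0 r, HasDerivAt (fun s : ℝ => k * duhamel G (p + s • e))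
        (k * B (p + s • e)) s := by
      intro s _
      have hl : HasDerivAt (fun s : ℝ => p + s • e) e s := by
        simpa using ((hasDerivAt_id s).smul_const e).const_add p
      have := (duhamel_hasFDerivAt hG (p + s • e)).comp_hasDerivAt s hl
      refine (this.const_mul k).congr_deriv ?_
      simp only [hB, add_apply, smul_apply,
        ContinuousLinearMap.coe_fst', ContinuousLinearMap.coe_snd', smul_eq_mul]
      ring
    rw [intervalIntegral.integral_eq_sub_of_hasDerivAt hd (hBc.intervalIntegrable _ _)]
    simp
  have e1 : ∀ s : ℝ, waveDeriv k f' g' G e (p + s • e) =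
      ((e.1 + e.2) * f' (p.1 + p.2 + s * (e.1 + e.2))
        + (e.1 - e.2) * g' (p.1 - p.2 + s * (e.1 - e.2))) + k * B (p + s • e) := by
    intro s
    have a1 : (p + s • e).1 + (p + s • e).2 = p.1 + p.2 + s * (e.1 + e.2) := by simp; ring
    have a2 : (p + s • e).1 - (p + s • e).2 = p.1 - p.2 + s * (e.1 - e.2) := by simp; ring
    simp only [waveDeriv, a1, a2, hB]
  simp_rw [e1]
  rw [intervalIntegral.integral_add (i1.add i2) (hBc.intervalIntegrable _ _),
    intervalIntegral.integral_add i1 i2, h1, h2, h3]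
  have a1 : (p + r • e).1 + (p + r • e).2 = p.1 + p.2 + r * (e.1 + e.2) := by simp; ring
  have a2 : (p + r • e).1 - (p + r • e).2 = p.1 - p.2 + r * (e.1 - e.2) := by simp; ring
  simp only [wave, a1, a2]; ring

theorem LocL2.memLp_comp_prod {h : ℝ → ℝ} (hh : LocL2 h) {Φ : ℝ × ℝ → ℝ}
    (hΦ : MeasurePreserving fun p : ℝ × ℝ => (p.1, Φ p)) {s : Set (ℝ × ℝ)} {a b c d : ℝ}
    (hs : ∀ p ∈ s, p.1 ∈ Ioc a b ∧ Φ p ∈ Ioc c d) :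
    MemLp (fun p => h (Φ p)) 2 (volume.restrict s) := by
  have h1 : MemLp (fun p : ℝ × ℝ => h p.2) 2 (volume.restrict (Ioc a b ×ˢ Ioc c d)) := by
    have : (volume : Measure (ℝ × ℝ)).restrict (Ioc a b ×ˢ Ioc c d)
        = (volume.restrict (Ioc a b)).prod (volume.restrict (Ioc c d)) := by
      rw [Measure.prod_restrict]; rfl
    rw [this]
    exact (hh c d).comp_snd _
  have h2 := h1.comp_measurePreserving (hΦ.restrict_preimage
    (measurableSet_Ioc.prod measurableSet_Ioc))
  exact h2.mono_measure (Measure.restrict_mono (fun p hp => hs p hp) le_rfl)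

theorem _root_.Continuous.memLp_of_subset_rect {F : ℝ × ℝ → ℝ} (hF : Continuous F) {R : ℝ}
    {s : Set (ℝ × ℝ)} (hs : s ⊆ Ioo (-R) R ×ˢ Ioo (-R) R) : MemLp F 2 (volume.restrict s) := by
  obtain ⟨C, hC⟩ := (isCompact_Icc.prod isCompact_Icc).exists_bound_of_continuousOn
    (s := Icc (-R) R ×ˢ Icc (-R) R) hF.continuousOn
  have : IsFiniteMeasure ((volume : Measure (ℝ × ℝ)).restrict (Ioo (-R) R ×ˢ Ioo (-R) R)) :=
    isFiniteMeasure_restrict.2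
      ((Metric.isBounded_Ioo _ _).prod (Metric.isBounded_Ioo _ _)).measure_lt_top.ne
  have : MemLp F 2 (volume.restrict (Ioo (-R) R ×ˢ Ioo (-R) R)) := by
    refine MemLp.of_bound hF.aestronglyMeasurable C ?_
    filter_upwards [ae_restrict_mem (measurableSet_Ioo.prod measurableSet_Ioo)] with p hp
    exact hC p ⟨Ioo_subset_Icc_self hp.1, Ioo_subset_Icc_self hp.2⟩
  exact this.mono_measure (Measure.restrict_mono hs le_rfl)

theorem memLp_waveDeriv (hf : LocL2 f') (hg : LocL2 g') (hG : Continuous G) (e : ℝ × ℝ) {R : ℝ}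
    {s : Set (ℝ × ℝ)} (hs : s ⊆ Ioo (-R) R ×ˢ Ioo (-R) R) :
    MemLp (waveDeriv k f' g' G e) 2 (volume.restrict s) := by
  have m1 : MeasurePreserving fun p : ℝ × ℝ => (p.1, p.1 + p.2) :=
    (MeasurePreserving.id volume).skew_product (g := fun t x => t + x)
      (measurable_fst.add measurable_snd)
      (Eventually.of_forall fun t => (measurePreserving_add_left volume t).map_eq)
  have m2 : MeasurePreserving fun p : ℝ × ℝ => (p.1, p.1 - p.2) :=
    (MeasurePreserving.id volume).skew_product (g := fun t x => t - x)
      (measurable_fst.sub measurable_snd)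
      (Eventually.of_forall fun t => (Measure.measurePreserving_sub_left volume t).map_eq)
  have h1 : MemLp (fun p : ℝ × ℝ => f' (p.1 + p.2)) 2 (volume.restrict s) := by
    refine hf.memLp_comp_prod m1 (a := -R) (b := R) (c := -(2 * R)) (d := 2 * R) fun p hp => ?_
    obtain ⟨⟨a1, a2⟩, a3, a4⟩ := hs hp
    exact ⟨⟨a1, a2.le⟩, by linarith, by linarith⟩
  have h2 : MemLp (fun p : ℝ × ℝ => g' (p.1 - p.2)) 2 (volume.restrict s) := by
    refine hg.memLp_comp_prod m2 (a := -R) (b := R) (c := -(2 * R)) (d := 2 * R) fun p hp => ?_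
    obtain ⟨⟨a1, a2⟩, a3, a4⟩ := hs hp
    exact ⟨⟨a1, a2.le⟩, by linarith, by linarith⟩
  have h3 : MemLp (fun p => k * (e.1 * (charInt 1 G p + charInt (-1) G p)
      + e.2 * (charInt 1 G p - charInt (-1) G p))) 2 (volume.restrict s) := by
    have hc : Continuous fun p => k * (e.1 * (charInt 1 G p + charInt (-1) G p)
        + e.2 * (charInt 1 G p - charInt (-1) G p)) := by
      have := continuous_charInt hG 1
      have := continuous_charInt hG (-1)
      fun_prop
    exact hc.memLp_of_subset_rect hs
  exact ((h1.const_mul _).add (h2.const_mul _)).add h3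

theorem locallyIntegrable_waveDeriv (hf : LocL2 f') (hg : LocL2 g') (hG : Continuous G)
    (e : ℝ × ℝ) : LocallyIntegrable (waveDeriv k f' g' G e) := by
  intro p
  set R := |p.1| + |p.2| + 1 with hR
  have h1 := neg_abs_le p.1
  have h2 := le_abs_self p.1
  have h3 := neg_abs_le p.2
  have h4 := le_abs_self p.2
  refine ⟨Ioo (-R) R ×ˢ Ioo (-R) R, prod_mem_nhds (Ioo_mem_nhds ?_ ?_) (Ioo_mem_nhds ?_ ?_), ?_⟩
  · linarith [abs_nonneg p.2]
  · linarith [abs_nonneg p.2]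
  · linarith [abs_nonneg p.1]
  · linarith [abs_nonneg p.1]
  · have : IsFiniteMeasure ((volume : Measure (ℝ × ℝ)).restrict (Ioo (-R) R ×ˢ Ioo (-R) R)) :=
      isFiniteMeasure_restrict.2
        ((Metric.isBounded_Ioo _ _).prod (Metric.isBounded_Ioo _ _)).measure_lt_top.ne
    exact (memLp_waveDeriv hf hg hG e le_rfl).integrable (by norm_num)

theorem hasWeakDeriv_wave (hf : IsPrimitive f f') (hg : IsPrimitive g g') (hfm : Measurable f')
    (hgm : Measurable g') (hG : Continuous G) (e : ℝ × ℝ) :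
    HasWeakDeriv univ e (wave k f g G) (waveDeriv k f' g' G e) :=
  hasWeakDeriv_of_line (continuous_wave hf.continuous hg.continuous hG)
    (measurable_waveDeriv hfm hgm hG e) (locallyIntegrable_waveDeriv hf.locL2 hg.locL2 hG e)
    (wave_line hf hg hG e)

theorem charInt_hasWeakDeriv (hG : Continuous G) :
    HasWeakDeriv univ ((1 : ℝ), (1 : ℝ)) (charInt (-1) G) G := by
  refine hasWeakDeriv_of_line (continuous_charInt hG _) hG.measurable hG.locallyIntegrable
    fun p r => ?_
  have h1 := charInt_line (G := G) (-1) p r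
  have h2 := charInt_line (G := G) (-1) p 0
  rw [neg_neg] at h1 h2
  rw [zero_smul, add_zero, add_zero] at h2
  have hc : Continuous fun s => G (s, p.2 + -1 * (p.1 - s)) := hG.comp (by fun_prop)
  rw [h1, h2, intervalIntegral.integral_interval_sub_left (hc.intervalIntegrable _ _)
    (hc.intervalIntegrable _ _)]
  have h3 := intervalIntegral.integral_comp_add_left (a := 0) (b := r)
    (fun s => G (s, p.2 + -1 * (p.1 - s))) p.1
  rw [add_zero] at h3
  rw [← h3]
  refine intervalIntegral.integral_congr fun s _ => ?_
  congr 1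
  ext <;> simp

theorem IsPrimitive.zero : IsPrimitive (fun _ => (0 : ℝ)) fun _ => 0 :=
  ⟨fun _ _ => MemLp.zero, fun _ _ => by simp⟩

/-- The wave operator is the product of the derivatives along (1, 1) and (1, -1). One of them
annihilates f(t + x), the other g(t - x). The (1, -1)-derivative of the Duhamel term is `2 * charInt
(-1) G`, whose (1, 1)-derivative is `2 * G`. -/
theorem wave_equation (hf : IsPrimitive f f') (hg : IsPrimitive g g') (hfm : Measurable f')
    (hgm : Measurable g') (hG : Continuous G) {φ : ℝ × ℝ → ℝ} {U : Set (ℝ × ℝ)}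
    (hφ : IsTest U φ) :
    ∫ p, wave k f g G p * (dt (dt φ) p - dx (dx φ) p) = 2 * k * ∫ p, G p * φ p := by
  have hφ' : IsTest univ φ := hφ.mono (subset_univ U)
  have e12 : ∀ p, dirDeriv ((1 : ℝ), (-1 : ℝ)) (dirDeriv ((1 : ℝ), (1 : ℝ)) φ) p
      = dt (dt φ) p - dx (dx φ) p := fun p => by rw [dirDeriv_dirDeriv_eq hφ]; ring
  have e21 : ∀ p, dirDeriv ((1 : ℝ), (1 : ℝ)) (dirDeriv ((1 : ℝ), (-1 : ℝ)) φ) p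
      = dt (dt φ) p - dx (dx φ) p := fun p => by rw [dirDeriv_dirDeriv_eq hφ]; ring
  have hG0 : Continuous fun _ : ℝ × ℝ => (0 : ℝ) := continuous_const
  -- Setting two of the three ingredients of `wave` to zero isolates the third, which allows a
  -- different order of the two derivatives for each.
  have A1 := (hasWeakDeriv_wave (k := 0) hf IsPrimitive.zero hfm measurable_const hG0
    ((1 : ℝ), (-1 : ℝ))).2.2 _ (hφ'.dirDeriv ((1 : ℝ), (1 : ℝ)))
  have A2 := (hasWeakDeriv_wave (k := 0) IsPrimitive.zero hg measurable_const hgm hG0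
    ((1 : ℝ), (1 : ℝ))).2.2 _ (hφ'.dirDeriv ((1 : ℝ), (-1 : ℝ)))
  have A3 := (hasWeakDeriv_wave (k := k) IsPrimitive.zero IsPrimitive.zero measurable_const
    measurable_const hG ((1 : ℝ), (-1 : ℝ))).2.2 _ (hφ'.dirDeriv ((1 : ℝ), (1 : ℝ)))
  have A4 := (charInt_hasWeakDeriv hG).2.2 φ hφ'
  simp only [setIntegral_univ, wave, waveDeriv, e12, e21, zero_mul, add_zero, zero_add, mul_zero,
    add_neg_cancel, sub_self, integral_zero, neg_zero, one_mul] at A1 A2 A3 A4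
  have hφt := (hφ'.dirDeriv (1, 0)).dirDeriv (1, 0)
  have hφx := (hφ'.dirDeriv (0, 1)).dirDeriv (0, 1)
  have hint : ∀ u : ℝ × ℝ → ℝ, Continuous u →
      Integrable fun p => u p * (dt (dt φ) p - dx (dx φ) p) := by
    intro u hu
    have hul := hu.locallyIntegrable.locallyIntegrableOn (μ := volume) univ
    refine ((integrable_mul_test hul hφt).sub (integrable_mul_test hul hφx)).congr
      (Eventually.of_forall fun p => ?_)
    simp only [Pi.sub_apply, dt, dx]; ring
  have i1 := hint (fun p => f (p.1 + p.2)) (hf.continuous.comp (by fun_prop))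
  have i2 := hint (fun p => g (p.1 - p.2)) (hg.continuous.comp (by fun_prop))
  have i3 := hint (fun p => k * duhamel G p) (continuous_const.mul (continuous_duhamel hG))
  have e3 : ∀ p, wave k f g G p * (dt (dt φ) p - dx (dx φ) p)
      = f (p.1 + p.2) * (dt (dt φ) p - dx (dx φ) p) + g (p.1 - p.2) * (dt (dt φ) p - dx (dx φ) p)
        + k * duhamel G p * (dt (dt φ) p - dx (dx φ) p) := fun p => by simp only [wave]; ring
  simp_rw [e3]
  rw [integral_add (f := fun p => f (p.1 + p.2) * (dt (dt φ) p - dx (dx φ) p)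
    + g (p.1 - p.2) * (dt (dt φ) p - dx (dx φ) p)) (i1.add i2) i3, integral_add i1 i2, A1, A2, A3]
  have e4 : ∀ p, k * (charInt 1 G p + charInt (-1) G p + -1 * (charInt 1 G p - charInt (-1) G p))
      * dirDeriv ((1 : ℝ), (1 : ℝ)) φ p
      = 2 * k * (charInt (-1) G p * dirDeriv ((1 : ℝ), (1 : ℝ)) φ p) := fun p => by ring
  simp_rw [e4]
  rw [integral_const_mul, A4]; ring

end WaveDerivatives

/-! ### Continuous curves in L²_loc. -/

section Curves

variable {F F' : ℝ → ℝ → ℝ} {h : ℝ → ℝ}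

/-- `t ↦ F t` is a continuous curve in `L²_loc(ℝ)`. -/
structure L2Curve (F : ℝ → ℝ → ℝ) : Prop where
  locL2 : ∀ t, LocL2 (F t)
  tendsto : ∀ t₀ a b, Tendsto (fun t => eLpNorm (fun x => F t x - F t₀ x) 2
    (volume.restrict (Ioc a b))) (𝓝 t₀) (𝓝 0)

theorem L2Curve.add (hF : L2Curve F) (hF' : L2Curve F') : L2Curve fun t x => F t x + F' t x := by
  refine ⟨fun t => (hF.locL2 t).add (hF'.locL2 t), fun t₀ a b => ?_⟩
  have h1 := (hF.tendsto t₀ a b).add (hF'.tendsto t₀ a b)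
  rw [add_zero] at h1
  refine tendsto_of_tendsto_of_tendsto_of_le_of_le tendsto_const_nhds h1 (fun _ => zero_le)
    fun t => ?_
  have := eLpNorm_add_le ((hF.locL2 t a b).sub (hF.locL2 t₀ a b)).1
    ((hF'.locL2 t a b).sub (hF'.locL2 t₀ a b)).1 (p := 2) (by norm_num)
  refine le_trans (le_of_eq ?_) this
  congr 1; funext x
  simp only [Pi.add_apply, Pi.sub_apply]; ring

theorem L2Curve.const_mul (hF : L2Curve F) (c : ℝ) : L2Curve fun t x => c * F t x := by
  refine ⟨fun t => (hF.locL2 t).const_mul c, fun t₀ a b => ?_⟩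
  have h1 := ENNReal.Tendsto.const_mul (a := ‖c‖ₑ) (hF.tendsto t₀ a b) (Or.inr enorm_ne_top)
  rw [mul_zero] at h1
  refine h1.congr fun t => ?_
  rw [← eLpNorm_const_smul]
  congr 1; funext x
  simp only [Pi.smul_apply, smul_eq_mul]; ring

theorem L2Curve.comp_neg (hF : L2Curve F) : L2Curve fun t x => F (-t) x :=
  ⟨fun t => hF.locL2 (-t), fun t₀ a b => (hF.tendsto (-t₀) a b).comp
    (continuous_neg.tendsto t₀)⟩

theorem _root_.Continuous.l2Curve {F : ℝ × ℝ → ℝ} (hF : Continuous F) :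
    L2Curve fun t x => F (t, x) := by
  refine ⟨fun t => LocL2.of_continuous (hF.comp (by fun_prop)), fun t₀ a b => ?_⟩
  set M : ℝ≥0∞ := (volume.restrict (Ioc a b)) univ ^ (2 : ℝ≥0∞).toReal⁻¹ with hM
  have hMt : M ≠ ⊤ := by
    refine ENNReal.rpow_ne_top_of_nonneg (by norm_num) ?_
    simp
  have hlim : Tendsto (fun δ : ℝ => M * ENNReal.ofReal δ) (𝓝[>] 0) (𝓝 0) := by
    have h1 : Tendsto (fun δ : ℝ => ENNReal.ofReal δ) (𝓝[>] 0) (𝓝 0) := by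
      have := (ENNReal.continuous_ofReal.tendsto 0).mono_left
        (nhdsWithin_le_nhds (s := Ioi (0 : ℝ)))
      simpa using this
    simpa using ENNReal.Tendsto.const_mul h1 (Or.inr hMt)
  rw [ENNReal.tendsto_nhds_zero]
  intro ε hε
  obtain ⟨δ, hδ, hδ0⟩ := ((ENNReal.tendsto_nhds_zero.1 hlim ε hε).and self_mem_nhdsWithin).exists
  obtain ⟨v, hv, hvδ⟩ := (isCompact_Icc (a := a) (b := b)).mem_uniformity_of_prod
    (f := fun t x => F (t, x)) (s := univ) (q := t₀) hF.continuousOn (mem_univ _)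
    (Metric.dist_mem_uniformity hδ0)
  rw [nhdsWithin_univ] at hv
  filter_upwards [hv] with t ht
  refine le_trans (eLpNorm_le_of_ae_bound (C := δ) ?_) hδ
  filter_upwards [ae_restrict_mem measurableSet_Ioc] with x hx
  have := hvδ t ht x (Ioc_subset_Icc_self hx)
  exact (le_of_lt (by simpa [dist_eq_norm] using this))

theorem LocL2.comp_add_left (hh : LocL2 h) (t : ℝ) : LocL2 fun x => h (t + x) := by
  intro a b
  have h1 := (hh (t + a) (t + b)).comp_measurePreserving
    ((measurePreserving_add_left volume t).restrict_preimage
      (measurableSet_Ioc (a := t + a) (b := t + b)))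
  simpa [Function.comp_def] using h1

/-- Continuity of translations in L²(ℝ), applied to `h` cut off to an interval that contains all the
shifts with |t - t₀| < 1. -/
theorem LocL2.l2Curve_add (hh : LocL2 h) : L2Curve fun t x => h (t + x) := by
  refine ⟨fun t => hh.comp_add_left t, fun t₀ a b => ?_⟩
  set S := Ioc (t₀ - 1 + a) (t₀ + 1 + b) with hS
  have hH : MemLp (S.indicator h) 2 volume :=
    (memLp_indicator_iff_restrict measurableSet_Ioc).2 (hh _ _)
  have hadd : ∀ t : ℝ, MeasurePreserving
      (((ContinuousMap.mk (fun p : ℝ × ℝ => p.1 + p.2) (by fun_prop)).curry t : C(ℝ, ℝ)))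
      volume volume := fun t => measurePreserving_add_left volume t
  have h1 := Filter.Tendsto.compMeasurePreservingLp (l := 𝓝 t₀)
    (tendsto_const_nhds (x := hH.toLp (S.indicator h)))
    ((ContinuousMap.mk (fun p : ℝ × ℝ => p.1 + p.2) (by fun_prop)).curry.continuous.tendsto t₀)
    hadd (hadd t₀) (by norm_num)
  rw [Lp.tendsto_Lp_iff_tendsto_eLpNorm'] at h1
  refine tendsto_of_tendsto_of_tendsto_of_le_of_le' tendsto_const_nhds h1
    (Eventually.of_forall fun _ => zero_le) ?_
  filter_upwards [Ioo_mem_nhds (show t₀ - 1 < t₀ by linarith) (show t₀ < t₀ + 1 by linarith)]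
    with t ht
  have hae : ∀ t : ℝ, Lp.compMeasurePreserving _ (hadd t) (hH.toLp (S.indicator h))
      =ᵐ[volume] fun x => S.indicator h (t + x) := by
    intro t
    rw [Lp.toLp_compMeasurePreserving]
    exact MemLp.coeFn_toLp _
  refine le_trans ?_ (eLpNorm_mono_measure _ (Measure.restrict_le_self (s := Ioc a b)))
  refine eLpNorm_mono_ae ?_
  filter_upwards [ae_restrict_of_ae (hae t), ae_restrict_of_ae (hae t₀),
    ae_restrict_mem measurableSet_Ioc] with x h1 h2 hx
  rw [Pi.sub_apply, h1, h2, indicator_of_mem, indicator_of_mem]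
  · exact ⟨by linarith [hx.1], by linarith [hx.2]⟩
  · exact ⟨by linarith [hx.1, ht.1], by linarith [hx.2, ht.2]⟩

theorem LocL2.l2Curve_sub (hh : LocL2 h) : L2Curve fun t x => h (t - x) := by
  have := hh.comp_neg.l2Curve_add.comp_neg
  simpa [sub_eq_add_neg, add_comm] using this

theorem l2Curve_waveDeriv {k : ℝ} {f' g' : ℝ → ℝ} {G : ℝ × ℝ → ℝ} (hf : LocL2 f') (hg : LocL2 g')
    (hG : Continuous G) (e : ℝ × ℝ) : L2Curve fun t x => waveDeriv k f' g' G e (t, x) := by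
  have hc : Continuous fun p => k * (e.1 * (charInt 1 G p + charInt (-1) G p)
      + e.2 * (charInt 1 G p - charInt (-1) G p)) := by
    have := continuous_charInt hG 1
    have := continuous_charInt hG (-1)
    fun_prop
  exact ((hf.l2Curve_add.const_mul _).add (hg.l2Curve_sub.const_mul _)).add hc.l2Curve

/-- Both traces, the initial value and the initial velocity are obtained from this one statement, as
continuity at parameter 0 of suitable L² curves. -/
theorem L2Curve.l2LimitAtZero (hF : L2Curve F) {w : ℝ → ℝ → ℝ} {g : ℝ → ℝ} {c δ : ℝ} (hδ : 0 < δ)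
    (hw : ∀ s ∈ Ioo 0 δ, ∀ r ∈ Ioo 0 c, w s r = F s r)
    (hg : ∀ᵐ r ∂volume.restrict (Ioo 0 c), g r = F 0 r) : L2LimitAtZero c w g := by
  refine tendsto_of_tendsto_of_tendsto_of_le_of_le' tendsto_const_nhds
    ((hF.tendsto 0 0 c).mono_left zeroRightAE_le) (Eventually.of_forall fun _ => zero_le) ?_
  refine eventually_zeroRightAE hδ (Eventually.of_forall fun s hs => ?_)
  refine le_trans ?_ (eLpNorm_mono_measure _ (Measure.restrict_mono Ioo_subset_Ioc_self le_rfl))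
  refine eLpNorm_mono_ae ?_
  filter_upwards [hg, ae_restrict_mem measurableSet_Ioo] with r h1 hr
  rw [hw s hs r hr, h1]

end Curves

/-! ### Change of representatives in weak derivatives. -/

section WeakDeriv

variable {E : Type*} [NormedAddCommGroup E] [NormedSpace ℝ E] [MeasureSpace E]
  {U : Set E} {e : E} {u u' g g' : E → ℝ}

theorem LocallyIntegrableOn.congr_ae (hu : LocallyIntegrableOn u U)
    (h : u =ᵐ[volume.restrict U] u') : LocallyIntegrableOn u' U := by
  intro x hx
  obtain ⟨t, ht, hi⟩ := hu x hx
  refine ⟨t ∩ U, inter_mem ht self_mem_nhdsWithin, ?_⟩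
  exact (hi.mono_set inter_subset_left).congr_fun_ae
    (ae_restrict_of_ae_restrict_of_subset inter_subset_right h)

theorem HasWeakDeriv.congr_ae (h : HasWeakDeriv U e u g) (hu : u =ᵐ[volume.restrict U] u')
    (hg : g =ᵐ[volume.restrict U] g') : HasWeakDeriv U e u' g' := by
  refine ⟨LocallyIntegrableOn.congr_ae h.1 hu, LocallyIntegrableOn.congr_ae h.2.1 hg,
    fun φ hφ => ?_⟩
  have h1 := integral_congr_ae (hu.mul (ae_eq_refl (dirDeriv e φ)))
  have h2 := integral_congr_ae (hg.mul (ae_eq_refl φ))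
  simp only [Pi.mul_apply] at h1 h2
  rw [← h1, ← h2]
  exact h.2.2 φ hφ

end WeakDeriv

/-! ### The constructed function solves the problem. -/

section Solution

variable {l f g f' g' z v₀ v₁ : ℝ → ℝ} {G v : ℝ × ℝ → ℝ} {k : ℝ}

/-- A point of the closed set is approached from inside by increasing `t` and moving `x` towards
ℓ(0)/2; the front does not recede as time increases. -/
theorem IsFront.closure_Omega (hl : IsFront l) :
    closure (Omega l) = {p | 0 ≤ p.1 ∧ 0 ≤ p.2 ∧ p.2 ≤ ext l p.1} := by
  have hc := hl.continuous_ext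
  refine subset_antisymm (closure_minimal ?_ ?_) ?_
  · rw [hl.Omega_eq]
    exact fun p hp => ⟨hp.1.le, hp.2.1.le, hp.2.2.le⟩
  · exact (isClosed_le continuous_const continuous_fst).inter
      ((isClosed_le continuous_const continuous_snd).inter
        (isClosed_le continuous_snd (hc.comp continuous_fst)))
  · rintro ⟨t, x⟩ ⟨ht, hx, hxl⟩
    dsimp only at ht hx hxl
    have hγ : Tendsto (fun s : ℝ => (t + s, (1 - s) * x + s * (l 0 / 2))) (𝓝[>] 0)
        (𝓝 (t, x)) := by
      have : Continuous fun s : ℝ => (t + s, (1 - s) * x + s * (l 0 / 2)) := by fun_prop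
      simpa using (this.tendsto 0).mono_left (nhdsWithin_le_nhds (s := Ioi 0))
    refine mem_closure_of_tendsto hγ ?_
    filter_upwards [Ioo_mem_nhdsGT (show (0 : ℝ) < 1 by norm_num)] with s hs
    rw [hl.Omega_eq]
    have hp := hl.pos
    have h1 := hl.ext_ge t
    have h2 := hl.ext_mono (show t ≤ t + s by linarith [hs.1])
    have h3 : 0 < 1 - s := by linarith [hs.2]
    have h4 := hs.1
    refine ⟨by dsimp only; linarith, by dsimp only; positivity, ?_⟩
    dsimp only
    have h5 : (1 - s) * x ≤ (1 - s) * ext l t := mul_le_mul_of_nonneg_left hxl h3.le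
    have h6 : s * (l 0 / 2) < s * ext l t := mul_lt_mul_of_pos_left (by linarith) h4
    linarith

theorem isSolution_wave (hl : IsFront l) (hf : IsPrimitive f f') (hg : IsPrimitive g g')
    (hfm : Measurable f') (hgm : Measurable g') (hG : Continuous G)
    (hGw : ∀ t x, 0 ≤ t → 0 ≤ x → x ≤ ext l t → G (t, x) = wave k f g G (t, x))
    (hz : ∀ t, 0 ≤ t → wave k f g G (t, 0) = z t)
    (hfront : ∀ t, 0 ≤ t → wave k f g G (t, ext l t) = 0)
    (h₀ : ∀ x ∈ Icc 0 (l 0), wave k f g G (0, x) = v₀ x)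
    (hv₁ : AEStronglyMeasurable v₁ (volume.restrict (Ioo 0 (l 0))))
    (h₁ : ∀ᵐ x, x ∈ Ioo 0 (l 0) → f' x + g' (-x) = v₁ x)
    (hv : ∀ p ∈ Omega l, v p = wave k f g G p) :
    IsSolution 0 (-(2 * k)) l z v₀ v₁ v := by
  have hW := continuous_wave (k := k) hf.continuous hg.continuous hG
  have hext := hl.continuous_ext
  have hcurve := l2Curve_waveDeriv (k := k) hf.locL2 hg.locL2 hG (1, 0)
  have hwd : ∀ e, HasWeakDeriv (Omega l) e v (waveDeriv k f' g' G e) := fun e =>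
    ((hasWeakDeriv_wave hf hg hfm hgm hG e).mono (subset_univ _)).congr_ae
      ((ae_restrict_mem hl.isOpen_Omega.measurableSet).mono fun p hp => (hv p hp).symm)
      (ae_eq_refl _)
  refine ⟨fun T hT => ?_, fun φ hφ => ?_, fun T _ => ?_, fun T _ => ?_, ?_, ?_⟩
  · set R := max T (l T) with hR
    have hs : OmegaT l T ⊆ Ioo (-R) R ×ˢ Ioo (-R) R := by
      have hR0 : 0 < R := lt_max_of_lt_left hT
      refine (hl.OmegaT_subset_rect T).trans (prod_mono ?_ ?_)
      · exact Ioo_subset_Ioo (by linarith) (le_max_left _ _)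
      · exact Ioo_subset_Ioo (by linarith) (le_max_right _ _)
    refine ⟨(hW.memLp_of_subset_rect hs).ae_eq ?_, fun e => ⟨waveDeriv k f' g' G e,
      memLp_waveDeriv hf.locL2 hg.locL2 hG e hs, (hwd e).mono (OmegaT_subset l T)⟩⟩
    exact (ae_restrict_mem (hl.isOpen_OmegaT T).measurableSet).mono fun p hp => (hv p hp.1).symm
  · have h1 := wave_equation (k := k) hf hg hfm hgm hG hφ
    have hmem : ∀ p ∈ Omega l, G p = wave k f g G p := by
      intro p hp
      rw [hl.Omega_eq] at hp
      exact hGw p.1 p.2 hp.1.le hp.2.1.le hp.2.2.le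
    have e1 : ∀ p, wave k f g G p * φ p = G p * φ p := by
      intro p
      by_cases hp : p ∈ Omega l
      · rw [hmem p hp]
      · rw [hφ.eq_zero hp, mul_zero, mul_zero]
    have hφt := (hφ.dirDeriv (1, 0)).dirDeriv (1, 0)
    have hφx := (hφ.dirDeriv (0, 1)).dirDeriv (0, 1)
    have hul := hW.locallyIntegrable.locallyIntegrableOn (μ := volume) (Omega l)
    have i1 : Integrable fun p => wave k f g G p * (dt (dt φ) p - dx (dx φ) p) := by
      refine ((integrable_mul_test hul hφt).sub (integrable_mul_test hul hφx)).congr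
        (Eventually.of_forall fun p => ?_)
      simp only [Pi.sub_apply, dt, dx]; ring
    have i2 : Integrable fun p => 2 * k * (wave k f g G p * φ p) :=
      (integrable_mul_test hul hφ).const_mul _
    calc ∫ p in Omega l, v p * (dt (dt φ) p - dx (dx φ) p - 0 * dt φ p + -(2 * k) * φ p)
        = ∫ p in Omega l, (wave k f g G p * (dt (dt φ) p - dx (dx φ) p)
            - 2 * k * (wave k f g G p * φ p)) := by
          refine setIntegral_congr_fun hl.isOpen_Omega.measurableSet fun p hp => ?_
          simp only [hv p hp]; ring
      _ = ∫ p, (wave k f g G p * (dt (dt φ) p - dx (dx φ) p)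
            - 2 * k * (wave k f g G p * φ p)) := by
          refine setIntegral_eq_integral_of_test fun p hp => ?_
          rw [hφ.eq_zero hp]
          simp only [dt, dx, hφt.eq_zero hp, hφx.eq_zero hp]
          simp
      _ = 0 := by
          rw [integral_sub i1 i2, h1, integral_const_mul]
          simp_rw [e1]
          ring
  · refine L2Curve.l2LimitAtZero (F := fun y t => wave k f g G (t, y))
      (hW.comp continuous_swap).l2Curve hl.pos (fun y hy t ht => hv _ ?_) ?_
    · exact ⟨ht.1, hy.1, hy.2.trans_le (hl.mono _ _ le_rfl ht.1.le)⟩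
    · filter_upwards [ae_restrict_mem measurableSet_Ioo] with t ht using (hz t ht.1.le).symm
  · refine L2Curve.l2LimitAtZero (F := fun y t => wave k f g G (t, ext l t - y))
      (hW.comp (g := wave k f g G) (f := fun p : ℝ × ℝ => (p.2, ext l p.2 - p.1))
        (by fun_prop)).l2Curve hl.pos (fun y hy t ht => ?_) ?_
    · rw [ext_of_nonneg ht.1.le]
      have := hl.mono _ _ le_rfl ht.1.le
      exact hv _ ⟨ht.1, by dsimp only; linarith [hy.2], by dsimp only; linarith [hy.1]⟩
    · filter_upwards [ae_restrict_mem measurableSet_Ioo] with t ht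
      rw [sub_zero, hfront t ht.1.le]
  · refine L2Curve.l2LimitAtZero (F := fun t x => wave k f g G (t, x))
      hW.l2Curve one_pos (fun t ht x hx => hv _ ?_) ?_
    · exact ⟨ht.1, hx.1, hx.2.trans_le (hl.mono _ _ le_rfl ht.1.le)⟩
    · filter_upwards [ae_restrict_mem measurableSet_Ioo] with x hx
        using (h₀ x (Ioo_subset_Icc_self hx)).symm
  · refine ⟨waveDeriv k f' g' G (1, 0), hwd _, ?_⟩
    -- The velocity converges in L², which is stronger than the required convergence in H⁻¹.
    have h2 : L2LimitAtZero (l 0) (fun t x => waveDeriv k f' g' G (1, 0) (t, x)) v₁ := by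
      refine hcurve.l2LimitAtZero one_pos (fun _ _ _ _ => rfl) ?_
      filter_upwards [ae_restrict_of_ae h₁, ae_restrict_mem measurableSet_Ioo] with x hx hx'
      rw [← hx hx']
      simp [waveDeriv, charInt]
    refine tendsto_of_tendsto_of_tendsto_of_le_of_le tendsto_const_nhds h2 (fun _ => zero_le)
      fun t => hNegOneNorm_le_eLpNorm ?_
    exact AEStronglyMeasurable.sub ((measurable_waveDeriv hfm hgm hG _).comp
      measurable_prodMk_left).aestronglyMeasurable hv₁

end Solution

/-! ### Truncation at the moving front. -/

section Truncation

variable {l : ℝ → ℝ} {w : ℝ → ℝ → ℝ} {h f q : ℝ → ℝ}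

theorem LocL2.memLp_indicator_Iio (hh : LocL2 h) (L : ℝ) :
    MemLp ((Iio L).indicator h) 2 halfLine := by
  rw [memLp_indicator_iff_restrict measurableSet_Iio, Measure.restrict_restrict measurableSet_Iio]
  exact hh.memLp_subset (a := 0) (b := L) fun x hx => ⟨hx.2, hx.1.le⟩

theorem LocL2.tendsto_indicator_Iio (hh : LocL2 h) (L : ℝ) :
    Tendsto (fun L' => eLpNorm ((Iio L').indicator h - (Iio L).indicator h) 2 halfLine)
      (𝓝 L) (𝓝 0) := by
  rw [ENNReal.tendsto_nhds_zero]
  intro ε hε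
  rcases eq_or_ne ε ⊤ with rfl | hεt
  · exact Eventually.of_forall fun _ => le_top
  have hε' : 0 < ε.toReal := ENNReal.toReal_pos hε.ne' hεt
  obtain ⟨δ, hδ0, hδ⟩ := (hh.memLp_indicator_Iio (L + 1)).eLpNorm_indicator_le (by norm_num)
    (by norm_num) hε'
  rw [ENNReal.ofReal_toReal hεt] at hδ
  have hη : 0 < min (δ / 2) 1 := lt_min (by linarith) one_pos
  filter_upwards [Metric.ball_mem_nhds L hη] with L' hL'
  refine le_trans (eLpNorm_mono fun x => ?_) (hδ (Metric.ball L (min (δ / 2) 1))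
    measurableSet_ball ?_)
  · rw [Metric.mem_ball, Real.dist_eq, lt_min_iff, abs_lt, abs_lt] at hL'
    by_cases hx : x ∈ Metric.ball L (min (δ / 2) 1)
    · rw [indicator_of_mem hx, Pi.sub_apply]
      rw [Metric.mem_ball, Real.dist_eq, lt_min_iff, abs_lt, abs_lt] at hx
      rw [indicator_of_mem (show x ∈ Iio (L + 1) from by rw [mem_Iio]; linarith [hx.2.2])]
      by_cases h1 : x ∈ Iio L' <;> by_cases h2 : x ∈ Iio L <;> simp [h1, h2]
    · rw [indicator_of_notMem hx, Pi.sub_apply, norm_zero, norm_le_zero_iff, sub_eq_zero]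
      have h3 : x ∈ Iio L' ↔ x ∈ Iio L := by
        rw [Metric.mem_ball, Real.dist_eq] at hx
        have h4 : min (δ / 2) 1 ≤ |x - L| := not_lt.1 hx
        have h5 : |L' - L| < min (δ / 2) 1 := lt_min (abs_lt.2 hL'.1) (abs_lt.2 hL'.2)
        rw [abs_lt] at h5
        simp only [mem_Iio]
        rcases le_abs.1 h4 with h6 | h6
        · constructor <;> intro h7 <;> linarith
        · constructor <;> intro h7 <;> linarith
      by_cases h1 : x ∈ Iio L
      · rw [indicator_of_mem h1, indicator_of_mem (h3.2 h1)]
      · rw [indicator_of_notMem h1, indicator_of_notMem (fun h => h1 (h3.1 h))]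
  · refine (Measure.restrict_le_self _).trans ?_
    rw [Real.volume_ball]
    exact ENNReal.ofReal_le_ofReal (by linarith [min_le_left (δ / 2) 1])

/-- The increment splits into the variation of `w` under a fixed truncation and the variation of the
truncation for fixed `w t₀`. The latter is the absolute continuity of the integral. -/
theorem L2Curve.exists_continuous_indicator (hw : L2Curve w) (hl : IsFront l) :
    ∃ V : ℝ → Lp ℝ 2 halfLine, Continuous V ∧
      ∀ t, V t =ᵐ[halfLine] (Iio (ext l t)).indicator (w t) := by
  have hm := fun t => (hw.locL2 t).memLp_indicator_Iio (ext l t)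
  refine ⟨fun t => (hm t).toLp _, continuous_iff_continuousAt.2 fun t₀ => ?_,
    fun t => (hm t).coeFn_toLp⟩
  rw [ContinuousAt, Lp.tendsto_Lp_iff_tendsto_eLpNorm'']
  have h1 := ((hw.locL2 t₀).tendsto_indicator_Iio (ext l t₀)).comp (hl.continuous_ext.tendsto t₀)
  have h2 := (hw.tendsto t₀ 0 (ext l t₀ + 1)).add h1
  rw [add_zero] at h2
  refine tendsto_of_tendsto_of_tendsto_of_le_of_le' tendsto_const_nhds h2
    (Eventually.of_forall fun _ => zero_le) ?_
  filter_upwards [hl.continuous_ext.continuousAt.eventually_lt continuousAt_const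
    (lt_add_one (ext l t₀))] with t ht
  have hm' := fun t => (hw.locL2 t₀).memLp_indicator_Iio (ext l t)
  have e1 : (Iio (ext l t)).indicator (w t) - (Iio (ext l t₀)).indicator (w t₀)
      = ((Iio (ext l t)).indicator (w t) - (Iio (ext l t)).indicator (w t₀))
        + ((Iio (ext l t)).indicator (w t₀) - (Iio (ext l t₀)).indicator (w t₀)) := by abel
  rw [e1]
  refine (eLpNorm_add_le ((hm t).sub (hm' t)).1 ((hm' t).sub (hm' t₀)).1 (by norm_num)).trans ?_
  refine add_le_add ?_ le_rfl
  rw [← indicator_sub', eLpNorm_indicator_eq_eLpNorm_restrict measurableSet_Iio,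
    Measure.restrict_restrict measurableSet_Iio]
  exact eLpNorm_mono_measure _ (Measure.restrict_mono
    (show Iio (ext l t) ∩ Ioi 0 ⊆ Ioc 0 (ext l t₀ + 1) from
      fun x hx => ⟨hx.2, (lt_trans hx.1 ht).le⟩) le_rfl)

/-- As `f` vanishes at the cutting point, the truncation creates no jump, hence no Dirac mass in the
derivative. -/
theorem IsPrimitive.indicator_Iio (hf : IsPrimitive f q) {L : ℝ} (hL : f L = 0) :
    IsPrimitive ((Iio L).indicator f) ((Iio L).indicator q) := by
  have hq := hf.locL2.indicator (measurableSet_Iio (a := L))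
  have key : ∀ c, ∫ x in L..c, (Iio L).indicator q x = (Iio L).indicator f c := by
    intro c
    rcases lt_or_ge c L with hc | hc
    · rw [indicator_of_mem (show c ∈ Iio L from hc), ← sub_zero (f c), ← hL, ← hf.integral_eq]
      refine intervalIntegral.integral_congr_ae ?_
      filter_upwards [Measure.ae_ne volume L] with x hx hx'
      rw [uIoc_of_ge hc.le] at hx'
      exact indicator_of_mem (show x ∈ Iio L from lt_of_le_of_ne hx'.2 hx) _
    · have h0 : (Iio L).indicator f c = 0 :=
        indicator_of_notMem (show c ∉ Iio L from not_lt.2 hc) _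
      rw [h0]
      refine (intervalIntegral.integral_congr_ae (g := fun _ => (0 : ℝ))
        (Eventually.of_forall fun x hx => ?_)).trans (by simp)
      rw [uIoc_of_le hc] at hx
      exact indicator_of_notMem (show x ∉ Iio L from not_lt.2 hx.1.le) _
  refine ⟨hq, fun a b => ?_⟩
  rw [← key b, ← key a, intervalIntegral.integral_interval_sub_left] <;>
    exact hq.intervalIntegrable _ _

/-- The Bochner integral of the continuous curve `V'` is C¹. It is identified with the pointwise
integral by pairing with indicators of sets of finite measure, where Fubini applies. -/
theorem contDiffOn_of_ae_eq_integral {V V' : ℝ → Lp ℝ 2 halfLine} (hV' : Continuous V')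
    (hw : ∀ r, V' r =ᵐ[halfLine] w r)
    (hint : ∀ t, 0 ≤ t → Integrable (Function.uncurry w)
      ((volume.restrict (Ioc 0 t)).prod halfLine))
    (h : ∀ t, 0 ≤ t → ∀ᵐ x ∂halfLine, V t x = V 0 x + ∫ r in (0 : ℝ)..t, w r x) :
    ContDiffOn ℝ 1 V (Ici 0) := by
  set U : ℝ → Lp ℝ 2 halfLine := fun t => ∫ r in (0 : ℝ)..t, V' r with hU
  have hd : ∀ t, HasDerivAt U (V' t) t := fun t =>
    intervalIntegral.integral_hasDerivAt_right (hV'.intervalIntegrable _ _)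
      hV'.aestronglyMeasurable.stronglyMeasurableAtFilter hV'.continuousAt
  have hUc : ContDiff ℝ 1 U := by
    refine contDiff_one_iff_deriv.2 ⟨fun t => (hd t).differentiableAt, ?_⟩
    rwa [show deriv U = V' from funext fun t => (hd t).deriv]
  refine (contDiff_const (c := V 0)).add hUc |>.contDiffOn.congr fun t ht => ?_
  refine Lp.ext ?_
  have hsect : ∀ {s : Set ℝ}, halfLine s < ⊤ → ∀ F : Lp ℝ 2 halfLine, IntegrableOn F s halfLine :=
    fun hs F => integrableOn_Lp_of_measure_ne_top F (by norm_num) hs.ne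
  refine Lp.ae_eq_of_forall_setIntegral_eq _ _ (by norm_num) (by norm_num)
    (fun s _ hs => hsect hs _) (fun s _ hs => hsect hs _) fun s hs hμ => ?_
  have hi : Integrable (Function.uncurry w)
      ((volume.restrict (Ioc 0 t)).prod (halfLine.restrict s)) :=
    (hint t ht).mono_measure (Measure.prod_mono le_rfl Measure.restrict_le_self)
  have h1 : ∫ x in s, U t x ∂halfLine = ∫ x in s, (∫ r in (0 : ℝ)..t, w r x) ∂halfLine := by
    calc ∫ x in s, U t x ∂halfLine
        = innerSL ℝ (indicatorConstLp 2 hs hμ.ne (1 : ℝ)) (U t) :=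
          (L2.inner_indicatorConstLp_one (𝕜 := ℝ) hs hμ.ne (U t)).symm
      _ = ∫ r in (0 : ℝ)..t, innerSL ℝ (indicatorConstLp 2 hs hμ.ne (1 : ℝ)) (V' r) :=
          (ContinuousLinearMap.intervalIntegral_comp_comm _ (hV'.intervalIntegrable _ _)).symm
      _ = ∫ r in (0 : ℝ)..t, ∫ x in s, w r x ∂halfLine := by
          refine intervalIntegral.integral_congr fun r _ => ?_
          exact (L2.inner_indicatorConstLp_one (𝕜 := ℝ) hs hμ.ne (V' r)).trans
            (integral_congr_ae (ae_restrict_of_ae (hw r)))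
      _ = ∫ x in s, (∫ r in (0 : ℝ)..t, w r x) ∂halfLine := by
          simp only [intervalIntegral.integral_of_le ht]
          exact integral_integral_swap hi
  have h2 : ∀ᵐ x ∂halfLine, (V 0 + U t : Lp ℝ 2 halfLine) x = V 0 x + U t x := Lp.coeFn_add _ _
  have h3 : Integrable (fun x => ∫ r in (0 : ℝ)..t, w r x) (halfLine.restrict s) := by
    simp only [intervalIntegral.integral_of_le ht]
    exact hi.integral_prod_right
  rw [integral_congr_ae (ae_restrict_of_ae (h t ht)), integral_congr_ae (ae_restrict_of_ae h2),
    integral_add (hsect hμ _) h3, integral_add (hsect hμ _) (hsect hμ _), h1]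

end Truncation

/-! ### Continuity in H¹ and differentiability in L². -/

section Regularity

variable {l f g f' g' : ℝ → ℝ} {G v : ℝ × ℝ → ℝ} {k : ℝ}

theorem integral_waveDeriv_time (hf : IsPrimitive f f') (hg : IsPrimitive g g')
    (hG : Continuous G) (x s t : ℝ) : ∫ r in s..t, waveDeriv k f' g' G (1, 0) (r, x)
      = wave k f g G (t, x) - wave k f g G (s, x) := by
  have h1 := wave_line (k := k) hf hg hG (1, 0) (s, x) (t - s)
  have h2 := intervalIntegral.integral_comp_add_left (a := 0) (b := t - s)
    (fun r => waveDeriv k f' g' G (1, 0) (r, x)) s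
  simp only [add_zero, add_sub_cancel] at h2
  simp only [Prod.smul_mk, smul_eq_mul, mul_one, mul_zero, Prod.mk_add_mk, add_zero,
    add_sub_cancel] at h1
  rw [h1, h2]

theorem isPrimitive_wave_space (hf : IsPrimitive f f') (hg : IsPrimitive g g')
    (hG : Continuous G) (t : ℝ) :
    IsPrimitive (fun x => wave k f g G (t, x)) fun x => waveDeriv k f' g' G (0, 1) (t, x) := by
  refine ⟨(l2Curve_waveDeriv hf.locL2 hg.locL2 hG _).locL2 t, fun a b => ?_⟩
  have h1 := wave_line (k := k) hf hg hG (0, 1) (t, a) (b - a)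
  have h2 := intervalIntegral.integral_comp_add_left (a := 0) (b := b - a)
    (fun r => waveDeriv k f' g' G (0, 1) (t, r)) a
  simp only [add_zero, add_sub_cancel] at h2
  simp only [Prod.smul_mk, smul_eq_mul, mul_one, mul_zero, Prod.mk_add_mk, add_zero,
    add_sub_cancel] at h1
  rw [h1, h2]

theorem memC0H1_wave (hl : IsFront l) (hf : IsPrimitive f f') (hg : IsPrimitive g g')
    (hfm : Measurable f') (hgm : Measurable g') (hG : Continuous G)
    (hfront : ∀ t, 0 ≤ t → wave k f g G (t, ext l t) = 0)
    (hv : ∀ t, 0 ≤ t → ∀ x, 0 < x →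
      v (t, x) = (Iio (ext l t)).indicator (fun x => wave k f g G (t, x)) x) :
    MemC0H1 v := by
  have hW := continuous_wave (k := k) hf.continuous hg.continuous hG
  obtain ⟨V, hV, hVae⟩ := hW.l2Curve.exists_continuous_indicator hl
  obtain ⟨D, hD, hDae⟩ := (l2Curve_waveDeriv (k := k) hf.locL2 hg.locL2 hG
    (0, 1)).exists_continuous_indicator hl
  have hvt : ∀ t, 0 ≤ t → (Iio (ext l t)).indicator (fun x => wave k f g G (t, x))
      =ᵐ[halfLine] fun x => v (t, x) := fun t ht =>
    (ae_restrict_mem measurableSet_Ioi).mono fun x hx => (hv t ht x hx).symm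
  refine ⟨V, D, hV.continuousOn, hD.continuousOn, fun t ht => ⟨(hVae t).trans (hvt t ht), ?_⟩⟩
  have hp := (isPrimitive_wave_space (k := k) hf hg hG t).indicator_Iio (hfront t ht)
  exact ((hp.hasWeakDeriv (((measurable_waveDeriv hfm hgm hG _).comp
    measurable_prodMk_left).indicator measurableSet_Iio)).mono (subset_univ _)).congr_ae
    (hvt t ht) (hDae t).symm

/-- A point `x` beyond the initial front is outside the domain up to the last time `r₁` at which the
front is at `x`. Before `r₁` the integrand is zero; afterwards the integral is the increment of the
wave, whose value at `(r₁, x)` is zero by the front condition. -/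
theorem indicator_wave_eq (hl : IsFront l) (hf : IsPrimitive f f') (hg : IsPrimitive g g')
    (hG : Continuous G) (hfront : ∀ t, 0 ≤ t → wave k f g G (t, ext l t) = 0) {t : ℝ} (ht : 0 ≤ t)
    (x : ℝ) : (Iio (ext l t)).indicator (fun x => wave k f g G (t, x)) x
      = (Iio (ext l 0)).indicator (fun x => wave k f g G (0, x)) x
        + ∫ r in (0 : ℝ)..t,
          (Iio (ext l r)).indicator (fun x => waveDeriv k f' g' G (1, 0) (r, x)) x := by
  rw [intervalIntegral.integral_of_le ht]
  rcases lt_or_ge x (ext l 0) with h0 | h0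
  · rw [indicator_of_mem (show x ∈ Iio (ext l 0) from h0),
      indicator_of_mem (show x ∈ Iio (ext l t) from h0.trans_le (hl.ext_mono ht)),
      setIntegral_congr_fun (g := fun r => waveDeriv k f' g' G (1, 0) (r, x)) measurableSet_Ioc
        fun r hr => indicator_of_mem
          (show x ∈ Iio (ext l r) from h0.trans_le (hl.ext_mono hr.1.le)) _,
      ← intervalIntegral.integral_of_le ht, integral_waveDeriv_time hf hg hG]
    ring
  rw [indicator_of_notMem (show x ∉ Iio (ext l 0) from not_lt.2 h0), zero_add]
  rcases le_or_gt (ext l t) x with h1 | h1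
  · rw [indicator_of_notMem (show x ∉ Iio (ext l t) from not_lt.2 h1),
      setIntegral_congr_fun (g := fun _ => (0 : ℝ)) measurableSet_Ioc
        fun r hr => indicator_of_notMem
          (show x ∉ Iio (ext l r) from not_lt.2 ((hl.ext_mono hr.2).trans h1)) _]
    simp
  -- The greatest such time is taken because the front may rest at `x` for a while.
  obtain ⟨r₀, ⟨⟨hr0, hrt⟩, hrx⟩, hmax⟩ := (isCompact_Icc.inter_right
    (isClosed_le hl.continuous_ext continuous_const)).exists_isGreatest
    (s := Icc 0 t ∩ {r | ext l r ≤ x}) ⟨0, ⟨le_rfl, ht⟩, h0⟩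
  obtain ⟨r₁, hr₁, hr₁x⟩ := intermediate_value_Icc hrt hl.continuous_ext.continuousOn ⟨hrx, h1.le⟩
  have hr₁₀ : r₁ = r₀ := le_antisymm (hmax ⟨⟨hr0.trans hr₁.1, hr₁.2⟩, hr₁x.le⟩) hr₁.1
  subst hr₁₀
  have h2 : ∀ r ∈ Ioc r₁ t, x < ext l r := fun r hr => by
    by_contra hc
    exact absurd (hmax ⟨⟨hr0.trans hr.1.le, hr.2⟩, not_lt.1 hc⟩) (not_le.2 hr.1)
  rw [setIntegral_eq_of_subset_of_forall_sdiff_eq_zero (s := Ioc r₁ t) measurableSet_Ioc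
      (Ioc_subset_Ioc_left hr0) fun r hr => ?_,
    setIntegral_congr_fun (g := fun r => waveDeriv k f' g' G (1, 0) (r, x)) measurableSet_Ioc
      fun r hr => indicator_of_mem (show x ∈ Iio (ext l r) from h2 r hr) _,
    ← intervalIntegral.integral_of_le hrt, integral_waveDeriv_time hf hg hG,
    indicator_of_mem (show x ∈ Iio (ext l t) from h1)]
  · have := hfront r₁ hr0
    rw [hr₁x] at this
    rw [this, sub_zero]
  · have h3 : r ≤ r₁ := by
      by_contra hc
      exact hr.2 ⟨not_le.1 hc, hr.1.2⟩
    exact indicator_of_notMem (show x ∉ Iio (ext l r) from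
      not_lt.2 ((hl.ext_mono h3).trans hr₁x.le)) _

theorem integrable_indicator_waveDeriv (hl : IsFront l) (hf : LocL2 f') (hg : LocL2 g')
    (hG : Continuous G) (e : ℝ × ℝ) (t : ℝ) :
    Integrable (Function.uncurry fun r => (Iio (ext l r)).indicator
      fun x => waveDeriv k f' g' G e (r, x)) ((volume.restrict (Ioc 0 t)).prod halfLine) := by
  have hS : MeasurableSet {p : ℝ × ℝ | p.2 < ext l p.1} :=
    (isOpen_lt continuous_snd (hl.continuous_ext.comp continuous_fst)).measurableSet
  have e1 : (Function.uncurry fun r => (Iio (ext l r)).indicator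
      fun x => waveDeriv k f' g' G e (r, x))
      = {p : ℝ × ℝ | p.2 < ext l p.1}.indicator (waveDeriv k f' g' G e) := by
    funext p
    simp only [Function.uncurry, indicator, mem_Iio, mem_ofPred_eq]
  rw [e1, Measure.prod_restrict, integrable_indicator_iff hS, IntegrableOn,
    Measure.restrict_restrict hS]
  refine ((locallyIntegrable_waveDeriv hf hg hG e).integrableOn_isCompact
    (isCompact_Icc.prod isCompact_Icc)).mono_set (s := _) (t := Icc 0 t ×ˢ Icc 0 (ext l t)) ?_
  rintro ⟨r, x⟩ ⟨h1, h2, h3⟩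
  exact ⟨⟨h2.1.le, h2.2⟩, (show (0 : ℝ) < x from h3).le,
    (show x < ext l r from h1).le.trans (hl.ext_mono h2.2)⟩

theorem memC1L2_wave (hl : IsFront l) (hf : IsPrimitive f f') (hg : IsPrimitive g g')
    (hG : Continuous G) (hfront : ∀ t, 0 ≤ t → wave k f g G (t, ext l t) = 0)
    (hv : ∀ t, 0 ≤ t → ∀ x, 0 < x →
      v (t, x) = (Iio (ext l t)).indicator (fun x => wave k f g G (t, x)) x) :
    MemC1L2 v := by
  have hW := continuous_wave (k := k) hf.continuous hg.continuous hG
  obtain ⟨V, -, hVae⟩ := hW.l2Curve.exists_continuous_indicator hl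
  obtain ⟨V', hV', hVae'⟩ := (l2Curve_waveDeriv (k := k) hf.locL2 hg.locL2 hG
    (1, 0)).exists_continuous_indicator hl
  refine ⟨V, contDiffOn_of_ae_eq_integral hV' hVae'
    (fun t _ => integrable_indicator_waveDeriv hl hf.locL2 hg.locL2 hG (1, 0) t) fun t ht => ?_,
    fun t ht => (hVae t).trans ?_⟩
  · filter_upwards [hVae t, hVae 0] with x h1 h2
    rw [h1, h2, indicator_wave_eq hl hf hg hG hfront ht]
  · exact (ae_restrict_mem measurableSet_Ioi).mono fun x hx => (hv t ht x hx).symm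

end Regularity

end Debonding

/-! ### Assembly of the main theorem. -/

theorem mainTheorem2 (ν ℓ₀ : ℝ) (hν : 0 ≤ ν) (hℓ₀ : 0 < ℓ₀)
    (l : ℝ → ℝ) (hl_ge : ∀ t : ℝ, 0 ≤ t → ℓ₀ ≤ l t)
    (hl_lip : ∃ K : NNReal, LipschitzOnWith K l (Ici 0)) (hl_zero : l 0 = ℓ₀)
    (hl_deriv : ∀ᵐ t ∂(volume.restrict (Ici (0 : ℝ))), 0 ≤ deriv l t ∧ deriv l t ≤ 1)
    (z v₀ v₁ : ℝ → ℝ)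
    (hz : ∀ b : ℝ, 0 < b → Debonding.MemH1Icc 0 b z)
    (hv₀ : Debonding.MemH1Icc 0 ℓ₀ v₀)
    (hv₁ : MemLp v₁ 2 (volume.restrict (Ioo 0 ℓ₀)))
    (hcompat_zero : v₀ 0 = z 0) (hcompat_front : v₀ ℓ₀ = 0) :
    (∃ v : ℝ × ℝ → ℝ,
      Debonding.IsSolution 0 (-(ν ^ 2 / 4)) l z v₀ v₁ v ∧
      (∀ v' : ℝ × ℝ → ℝ, Debonding.IsSolution 0 (-(ν ^ 2 / 4)) l z v₀ v₁ v' →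
        v' =ᵐ[volume.restrict (Debonding.Omega l)] v) ∧
      ContinuousOn v (closure (Debonding.Omega l)) ∧
      (∀ p : ℝ × ℝ, p ∉ closure (Debonding.Omega l) → v p = 0) ∧
      Debonding.MemC0H1 v ∧ Debonding.MemC1L2 v) ∧
    (∀ u : ℝ × ℝ → ℝ,
      Debonding.IsSolution ν 0 l (fun t => Real.exp (-(ν * t / 2)) * z t) v₀
          (fun x => v₁ x - ν / 2 * v₀ x) u ↔
        Debonding.IsSolution 0 (-(ν ^ 2 / 4)) l z v₀ v₁
          (fun p => Real.exp (ν * p.1 / 2) * u p)) := by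
  subst hl_zero
  obtain ⟨K, hK⟩ := hl_lip
  have hl := Debonding.isFront_of_deriv hK hℓ₀ hl_deriv
  refine ⟨?_, fun u => Debonding.isSolution_damped_iff hl ν hv₀.1.1 hv₁ u⟩
  have hzm : ∀ T : ℝ, AEStronglyMeasurable z (volume.restrict (Ioo 0 T)) := fun T => by
    rcases lt_or_ge 0 T with hT | hT
    · exact (hz T hT).1.1.1
    · simp [Ioo_eq_empty_of_le hT]
  -- The wave operator maps the Duhamel term to `2 * G`, hence `k` is half of the coefficient `ν ^ 2
  -- / 4`.
  obtain ⟨f, g, G, hf, hg, hG, hGw, hwz, hwl, hw₀, hw₁⟩ := Debonding.exists_wave hl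
    (k := ν ^ 2 / 8) (by positivity) hz hv₀ hv₁ hcompat_zero hcompat_front
  have hf' := Debonding.isPrimitive_deriv hf
  have hg' := Debonding.isPrimitive_deriv hg
  set v := (closure (Debonding.Omega l)).indicator (Debonding.wave (ν ^ 2 / 8) f g G) with hv
  have hsol : Debonding.IsSolution 0 (-(ν ^ 2 / 4)) l z v₀ v₁ v := by
    rw [show ν ^ 2 / 4 = 2 * (ν ^ 2 / 8) by ring]
    exact Debonding.isSolution_wave hl hf' hg' (measurable_deriv f) (measurable_deriv g) hG hGw
      hwz hwl hw₀ hv₁.1 hw₁ fun p hp => indicator_of_mem (subset_closure hp) _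
  have hvx : ∀ t, 0 ≤ t → ∀ x, 0 < x → v (t, x) =
      (Iio (Debonding.ext l t)).indicator
        (fun x => Debonding.wave (ν ^ 2 / 8) f g G (t, x)) x := by
    intro t ht x hx
    rw [hv, hl.closure_Omega]
    have hin : x ≤ Debonding.ext l t → (t, x) ∈
        {p : ℝ × ℝ | 0 ≤ p.1 ∧ 0 ≤ p.2 ∧ p.2 ≤ Debonding.ext l p.1} := fun h => ⟨ht, hx.le, h⟩
    rcases lt_trichotomy x (Debonding.ext l t) with h | h | h
    · rw [indicator_of_mem (show x ∈ Iio (Debonding.ext l t) from h),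
        indicator_of_mem (hin h.le)]
    · rw [indicator_of_notMem (show x ∉ Iio (Debonding.ext l t) from not_lt.2 h.ge),
        indicator_of_mem (hin h.le), h, hwl t ht]
    · rw [indicator_of_notMem (show x ∉ Iio (Debonding.ext l t) from not_lt.2 h.le),
        indicator_of_notMem fun hm => absurd hm.2.2 (not_le.2 h)]
  refine ⟨v, hsol, fun v' hv' => hv'.ae_eq hl hzm hv₀.1.1 hv₁ hsol, ?_,
    fun p hp => indicator_of_notMem hp _,
    Debonding.memC0H1_wave hl hf' hg' (measurable_deriv f) (measurable_deriv g) hG hwl hvx,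
    Debonding.memC1L2_wave hl hf' hg' hG hwl hvx⟩
  exact (Debonding.continuous_wave hf'.continuous hg'.continuous hG).continuousOn.congr
    fun p hp => indicator_of_mem hp _
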